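/- Let $G=(V,E)$ be a finite connected graph and $s\in V$. A \emph{broadcast protocol with $t$ rounds} for $(G,s)$ is a spanning tree $T$ of $G$ rooted at $s$ together with a map $\tau:E(T)\to\{1,\dots,t\}$ that is a proper edge colouring of $T$ and such that, for every $v\in V\setminus\{s\}$, the edge from $v$ to its parent has the minimum $\tau$-value among all edges of $T$ incident on $v$. Let $b(G,s)$ be the minimum $t$ for which such a protocol exists. \textsc{Telephone Broadcast} is the problem: given a finite connected graph $G$, a vertex $s$ of $G$ and a positive integer $t$, decide whether $b(G,s)\le t$. The \emph{distance to clique} of $G$ is the minimum size $k$ of a set $X\subseteq V$ such that $G-X$ is a clique. \textbf{Theorem.} \textsc{Telephone Broadcast} is fixed-parameter tractable parameterized by the distance to clique $k$ of the input graph, and it can be solved in time $2^{O(k^2)}\,n^{O(1)}$, where $n=|V|-k$. That is: there are an algorithm (a program of a unit-cost random access machine with addition and subtraction, whose input consists of the adjacency matrix of $G$, of $s$ and of $t$, but neither of $k$ nor of a modulator $X$) and a constant $c$ such that the algorithm decides every instance $(G,s,t)$ correctly within $c\cdot 2^{ck^2}\cdot n^{c}$ steps; fixed-parameter tractable means that some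 algorithm of this kind decides every instance within $f(k)\cdot|V|^{c'}$ steps, for some computable function $f$ and some constant $c'$. -/

import Mathlib

namespace TelephoneBroadcast

/-! ## Broadcasting in the telephone model -/

/-- A broadcast protocol with `t` rounds for `G` with originator `s`: a spanning tree of `G`, rooted
at `s`, with a time-stamp in `{1, …, t}` on each of its edges (values of `stamp` outside the edges
of the tree are irrelevant). The time-stamps form a proper edge colouring of the tree, and at each
vertex `v ≠ s` the edge to the parent of `v` (the neighbour `u` that is one step closer to `s` in
the tree) has the minimum time-stamp among all tree edges incident on `v`. -/
structure BroadcastProtocol {V : Type*} (G : SimpleGraph V) (s : V) (t : ℕ) where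
  tree : SimpleGraph V
  tree_le : tree ≤ G
  isTree : tree.IsTree
  stamp : Sym2 V → ℕ
  stamp_mem : ∀ e ∈ tree.edgeSet, 1 ≤ stamp e ∧ stamp e ≤ t
  proper : ∀ e ∈ tree.edgeSet, ∀ e' ∈ tree.edgeSet, e ≠ e' →
    (∃ v, v ∈ e ∧ v ∈ e') → stamp e ≠ stamp e'
  parent_min : ∀ u v w, tree.Adj u v → tree.dist s v = tree.dist s u + 1 →
    tree.Adj v w → stamp s(u, v) ≤ stamp s(v, w)

/-- `b(G, s)`: the minimum number of rounds of a broadcast protocol for `G` with originator `s`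
(for a finite connected graph such a protocol exists). -/
noncomputable def broadcastTime {V : Type*} (G : SimpleGraph V) (s : V) : ℕ :=
  sInf {t | Nonempty (BroadcastProtocol G s t)}

/-- The distance to clique of a finite graph: the minimum size of a set `X` of vertices
(a modulator) such that `G - X` is a clique. -/
noncomputable def distanceToClique {V : Type*} (G : SimpleGraph V) : ℕ :=
  sInf {k | ∃ X : Finset V, X.card = k ∧ G.IsClique {v | v ∉ X}}

/-- An instance of Telephone Broadcast: a finite connected graph (its vertices are numbered
`0, …, order - 1`), a source vertex and a positive integer `rounds`. -/
structure Instance where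
  order : ℕ
  graph : SimpleGraph (Fin order)
  connected : graph.Connected
  source : Fin order
  rounds : ℕ
  rounds_pos : 0 < rounds

/-- The question: is `b(G, s) ≤ t`? -/
def Instance.IsYes (I : Instance) : Prop :=
  broadcastTime I.graph I.source ≤ I.rounds

/-- The parameter: the distance to clique of the input graph. -/
noncomputable def Instance.dtc (I : Instance) : ℕ :=
  distanceToClique I.graph

/-! ## Random access machines

Structured programs over a random access memory with unit cost. The arithmetic is restricted to
addition and (truncated) subtraction, so that numbers grow by at most one bit per step and the model
is polynomially equivalent to the Turing machine. -/

/-- The memory: scalar registers and arrays, all holding natural numbers. -/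
structure State where
  reg : ℕ → ℕ
  arr : ℕ → ℕ → ℕ

/-- Expressions: constants, registers, array cells at a computed index, sums, truncated
differences. -/
inductive Expr where
  | const (n : ℕ)
  | var (x : ℕ)
  | get (a : ℕ) (i : Expr)
  | add (d e : Expr)
  | sub (d e : Expr)

/-- The value of an expression. -/
def Expr.eval (σ : State) : Expr → ℕ
  | .const n => n
  | .var x => σ.reg x
  | .get a i => σ.arr a (i.eval σ)
  | .add d e => d.eval σ + e.eval σ
  | .sub d e => d.eval σ - e.eval σ

/-- The number of steps that the evaluation of an expression takes: one for each operation and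
each access to the memory. -/
def Expr.cost : Expr → ℕ
  | .const _ => 1
  | .var _ => 1
  | .get _ i => i.cost + 1
  | .add d e => d.cost + e.cost + 1
  | .sub d e => d.cost + e.cost + 1

/-- Programs. A test `e` is passed if the value of `e` is not zero. -/
inductive Program where
  | skip
  | assign (x : ℕ) (e : Expr)
  | store (a : ℕ) (i e : Expr)
  | seq (p q : Program)
  | cond (e : Expr) (p q : Program)
  | loop (e : Expr) (p : Program)

/-- The state after writing `v` into the register `x`. -/
def State.setReg (σ : State) (x v : ℕ) : State :=
  { σ with reg := Function.update σ.reg x v }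

/-- The state after writing `v` into the cell `i` of the array `a`. -/
def State.setArr (σ : State) (a i v : ℕ) : State :=
  { σ with arr := Function.update σ.arr a (Function.update (σ.arr a) i v) }

/-- `Exec p σ σ' m`: started in the state `σ`, the program `p` halts after exactly `m` steps in the
state `σ'`. -/
inductive Exec : Program → State → State → ℕ → Prop
  | skip (σ : State) : Exec .skip σ σ 1
  | assign (σ : State) (x : ℕ) (e : Expr) :
      Exec (.assign x e) σ (σ.setReg x (e.eval σ)) (e.cost + 1)
  | store (σ : State) (a : ℕ) (i e : Expr) :
      Exec (.store a i e) σ (σ.setArr a (i.eval σ) (e.eval σ)) (i.cost + e.cost + 1)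
  | seq {p q : Program} {σ σ' σ'' : State} {m m' : ℕ} :
      Exec p σ σ' m → Exec q σ' σ'' m' → Exec (.seq p q) σ σ'' (m + m')
  | cond_true {e : Expr} {p q : Program} {σ σ' : State} {m : ℕ} :
      e.eval σ ≠ 0 → Exec p σ σ' m → Exec (.cond e p q) σ σ' (e.cost + 1 + m)
  | cond_false {e : Expr} {p q : Program} {σ σ' : State} {m : ℕ} :
      e.eval σ = 0 → Exec q σ σ' m → Exec (.cond e p q) σ σ' (e.cost + 1 + m)
  | loop_true {e : Expr} {p : Program} {σ σ' σ'' : State} {m m' : ℕ} :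
      e.eval σ ≠ 0 → Exec p σ σ' m → Exec (.loop e p) σ' σ'' m' →
      Exec (.loop e p) σ σ'' (e.cost + 1 + m + m')
  | loop_false {e : Expr} {p : Program} {σ : State} :
      e.eval σ = 0 → Exec (.loop e p) σ σ (e.cost + 1)

/-! ## Algorithms for Telephone Broadcast -/

open Classical in
/-- The initial memory: the registers `0, 1, 2` hold the number of vertices, the source and the
number of rounds, the array `0` holds the adjacency matrix of the graph, row by row, and everything
else is `0`. -/
noncomputable def Instance.input (I : Instance) : State where
  reg x := if x = 0 then I.order else if x = 1 then (I.source : ℕ) else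
    if x = 2 then I.rounds else 0
  arr a c := if a = 0 ∧ ∃ i j : Fin I.order, I.graph.Adj i j ∧ c = i * I.order + j then 1 else 0

open Classical in
/-- The program `p` solves Telephone Broadcast in time `T`: on each instance `I` it halts after at
most `T I` steps, and register `0` then holds `1` if the answer is yes and `0` if it is no. -/
def SolvesInTime (p : Program) (T : Instance → ℕ) : Prop :=
  ∀ I : Instance, ∃ (σ : State) (m : ℕ), Exec p I.input σ m ∧ m ≤ T I ∧
    σ.reg 0 = if I.IsYes then 1 else 0

/-- Telephone Broadcast is fixed-parameter tractable with respect to the parameter `κ`: some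
program solves it in time `f (κ I) * |V| ^ c`, with a computable function `f` and a constant `c`. -/
def IsFixedParameterTractable (κ : Instance → ℕ) : Prop :=
  ∃ (p : Program) (f : ℕ → ℕ) (c : ℕ), Computable f ∧
    SolvesInTime p (fun I => f (κ I) * I.order ^ c)

end TelephoneBroadcast

namespace TelephoneBroadcast

open Finset

/-! ## Schedules -/

/-! Let `X` be a modulator that contains `s`, let `k = |X|`, and let `C` be the remaining clique.
Since `G` is connected, one new vertex can be informed per round, so after `k` rounds a clique
vertex is informed; doubling fills `C` in `⌈log₂ |V|⌉` further rounds, and `k` more rounds finish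
`X`. Hence `b(G, s) ≤ 2k + ⌈log₂ |V|⌉` (`hasSchedule_of_isClique_compl`), and `t` can be capped at
this value.

Only the calls from and into `X` have to be guessed. The clique vertices that call into `X`
("slots") number at most `k`, because each can be named after one of the modulator vertices that it
calls. The clique vertices that are called from `X` but do not call into it ("leaves") only need to
be counted for each caller. The other clique vertices are free: they are called from the clique and
call only inside it, so they are interchangeable, and it is optimal to call as many of them as
possible in every round. Whether this informs all of them in time is decided by a recursion on
numbers (`Plan.informed`). Finding clique vertices for the slots and leaves is a bipartite matching
problem, and Hall's condition has to be tested only for pairs of subsets of `X`. So a schedule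
exists if and only if there is a valid plan, which consists of five numbers per modulator vertex
(`IsSchedule.exists_plan`, `Plan.Valid.hasSchedule`).

No modulator has to be given: marking both ends of a non-edge between unmarked vertices, as long as
there is one, is the 2-approximation of vertex cover in the complement graph (`MarkInvariant`).
Together with `s` this yields `k ≤ 2κ + 1`, where `κ` is the distance to clique.

The entries of a plan are digits in base `B = 2k + t + 2 = O(κ + log |V|)`, so there are `B ^ (5k)`
plans. With `q = log log |V|`, the product `q κ` is at most `q² + κ²`, and `q² = O(log |V|)`; this
turns the number of plans into `2 ^ O(κ²) n ^ O(1)` (`succ_pow_le`, `size_le`). A plan is tested in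
time polynomial in `R = B ^ (5k) + 10 |V| + 10`. All loops of the test can therefore have the same
length `R`, kept in register `3`, and the closure properties of `Comp` provide the programs together
with their polynomial time bounds. -/

/-- A broadcast schedule on the vertices `U` for the calling relation `A`: each vertex `v ≠ s` is
called by `p v` in round `τ v`, after `p v` has been called itself, and nobody calls two vertices in
the same round. -/
structure IsSchedule {V : Type*} (U : Finset V) (A : V → V → Prop) (s : V) (t : ℕ)
    (p : V → V) (τ : V → ℕ) : Prop where
  root : τ s = 0
  mem : ∀ v ∈ U, v ≠ s → p v ∈ U
  adj : ∀ v ∈ U, v ≠ s → A (p v) v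
  lt : ∀ v ∈ U, v ≠ s → τ (p v) < τ v
  le : ∀ v ∈ U, v ≠ s → τ v ≤ t
  inj : ∀ v ∈ U, ∀ w ∈ U, v ≠ s → w ≠ s → p v = p w → τ v = τ w → v = w

/-- There is a broadcast schedule with `t` rounds. -/
def HasSchedule {V : Type*} (U : Finset V) (A : V → V → Prop) (s : V) (t : ℕ) : Prop :=
  ∃ p τ, IsSchedule U A s t p τ

theorem HasSchedule.mono {V : Type*} {U : Finset V} {A : V → V → Prop} {s : V} {t t' : ℕ}
    (h : HasSchedule U A s t) (ht : t ≤ t') : HasSchedule U A s t' := by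
  obtain ⟨p, τ, h⟩ := h
  exact ⟨p, τ, { h with le := fun v hv hs => (h.le v hv hs).trans ht }⟩

/-- The caller of `v` is the next vertex on a shortest tree path from `v` to `s`, and `τ v` is the
stamp of the edge between them. `parent_min` and `proper` together make the stamps increase strictly
away from `s`. -/
theorem BroadcastProtocol.hasSchedule {V : Type*} [Fintype V] {G : SimpleGraph V} {s : V} {t : ℕ}
    (P : BroadcastProtocol G s t) : HasSchedule univ G.Adj s t := by
  classical
  have key : ∀ v, ∃ u, v ≠ s → P.tree.Adj u v ∧ P.tree.dist s v = P.tree.dist s u + 1 := by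
    intro v
    by_cases hv : v = s
    · exact ⟨s, fun h => absurd hv h⟩
    · obtain ⟨w, hw⟩ := P.isTree.connected.exists_walk_length_eq_dist v s
      cases w with
      | nil => exact absurd rfl hv
      | @cons _ u _ h w' =>
        refine ⟨u, fun _ => ⟨h.symm, ?_⟩⟩
        have h1 : P.tree.dist u s ≤ w'.length := SimpleGraph.dist_le w'
        have h2 := P.isTree.dist_eq_dist_add_one_of_adj s h
        rw [SimpleGraph.Walk.length_cons] at hw
        rw [SimpleGraph.dist_comm] at hw h1
        omega
  choose p hp using key
  have hmem : ∀ v, v ≠ s → s(p v, v) ∈ P.tree.edgeSet := fun v hv => (hp v hv).1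
  refine ⟨p, fun v => if v = s then 0 else P.stamp s(p v, v), by simp, by simp,
    fun v _ hv => P.tree_le (hp v hv).1, ?_, ?_, ?_⟩
  · intro v _ hv
    simp only [hv, if_false]
    split_ifs with h
    · exact (P.stamp_mem _ (hmem v hv)).1
    · refine lt_of_le_of_ne (P.parent_min _ _ _ (hp _ h).1 (hp _ h).2 (hp v hv).1)
        (P.proper _ (hmem _ h) _ (hmem v hv) ?_ ⟨p v, by simp, by simp⟩)
      intro he
      have h1 := (hp _ h).2
      have h2 := (hp v hv).2
      rw [Sym2.eq_iff] at he
      rcases he with ⟨-, h3⟩ | ⟨h3, -⟩ <;> have h4 := congrArg (P.tree.dist s) h3 <;> omega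
  · intro v _ hv
    simp only [hv, if_false]
    exact (P.stamp_mem _ (hmem v hv)).2
  · intro v _ w _ hv hw hpp hτ
    simp only [hv, hw, if_false] at hτ
    by_contra hne
    refine P.proper _ (hmem v hv) _ (hmem w hw) ?_ ⟨p v, by simp, by simp [hpp]⟩ hτ
    rw [hpp]
    intro he
    exact hne (Sym2.congr_right.1 he)

/-- The tree with parent function `p` and root `s`. -/
def parentTree {V : Type*} (p : V → V) (s : V) : SimpleGraph V :=
  SimpleGraph.fromRel fun u v => v ≠ s ∧ p v = u

/-- The edges `s(p v, v)` connect every vertex to `s`, because `τ` decreases along `p`, and there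
are at most `|V| - 1` of them, so they form a tree. The stamp of an edge is the larger `τ` of its
two ends, which is that of the child. -/
theorem IsSchedule.nonempty_protocol {V : Type*} [Fintype V] {G : SimpleGraph V} {s : V} {t : ℕ}
    {p : V → V} {τ : V → ℕ} (h : IsSchedule univ G.Adj s t p τ) :
    Nonempty (BroadcastProtocol G s t) := by
  classical
  have hne : ∀ v, v ≠ s → p v ≠ v := fun v hv e => (h.adj v (mem_univ _) hv).ne e
  have adj_iff : ∀ u v, (parentTree p s).Adj u v ↔ (v ≠ s ∧ p v = u) ∨ (u ≠ s ∧ p u = v) := by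
    intro u v
    simp only [parentTree, SimpleGraph.fromRel_adj]
    constructor
    · exact fun h => h.2
    · rintro (⟨h1, rfl⟩ | ⟨h1, rfl⟩)
      · exact ⟨hne v h1, Or.inl ⟨h1, rfl⟩⟩
      · exact ⟨(hne u h1).symm, Or.inr ⟨h1, rfl⟩⟩
  have hadj : ∀ v, v ≠ s → (parentTree p s).Adj (p v) v := fun v hv =>
    (adj_iff _ _).2 (Or.inl ⟨hv, rfl⟩)
  have hreach : ∀ n v, τ v ≤ n → (parentTree p s).Reachable s v := by
    intro n
    induction n with
    | zero =>
      intro v hv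
      by_cases hs : v = s
      · rw [hs]
      · have := h.lt v (mem_univ _) hs; omega
    | succ n ih =>
      intro v hv
      by_cases hs : v = s
      · rw [hs]
      · have := h.lt v (mem_univ _) hs
        exact (ih (p v) (by omega)).trans (hadj v hs).reachable
  have hconn : (parentTree p s).Connected := by
    have : Nonempty V := ⟨s⟩
    exact ⟨fun u v => (hreach _ u le_rfl).symm.trans (hreach _ v le_rfl)⟩
  have htree : (parentTree p s).IsTree := by
    rw [SimpleGraph.isTree_iff_connected_and_card]
    refine ⟨hconn, le_antisymm ?_ ?_⟩
    · have hsub : (parentTree p s).edgeSet ⊆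
          (((univ.erase s).image fun v => s(p v, v) : Finset (Sym2 V)) : Set (Sym2 V)) := by
        intro e
        induction e with
        | _ u v =>
          rw [SimpleGraph.mem_edgeSet, adj_iff]
          rintro (⟨h1, rfl⟩ | ⟨h1, rfl⟩)
          · simpa using ⟨v, h1, Or.inl ⟨rfl, rfl⟩⟩
          · simpa using ⟨u, h1, Or.inr ⟨rfl, rfl⟩⟩
      have h1 := Set.ncard_le_ncard hsub (Finset.finite_toSet _)
      rw [Set.ncard_coe_finset] at h1
      have h2 := Finset.card_image_le (s := univ.erase s) (f := fun v => s(p v, v))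
      rw [Finset.card_erase_of_mem (mem_univ s)] at h2
      have h3 : 0 < (univ : Finset V).card := Finset.card_pos.2 ⟨s, mem_univ s⟩
      rw [Nat.card_coe_set_eq, Nat.card_eq_fintype_card]
      rw [Finset.card_univ] at *
      omega
    · have := hconn.card_vert_le_card_edgeSet_add_one
      omega
  -- The number of steps of `p` that lead to `s`. It turns out to be the tree distance, which
  -- identifies the parents in `parent_min` with the values of `p`.
  have hdepth : ∃ δ : V → ℕ, δ s = 0 ∧ ∀ v, v ≠ s → δ v = δ (p v) + 1 := by
    have hex : ∀ n v, τ v ≤ n → ∃ m, p^[m] v = s := by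
      intro n
      induction n with
      | zero =>
        intro v hv
        by_cases hs : v = s
        · exact ⟨0, hs⟩
        · have := h.lt v (mem_univ _) hs; omega
      | succ n ih =>
        intro v hv
        by_cases hs : v = s
        · exact ⟨0, hs⟩
        · have := h.lt v (mem_univ _) hs
          obtain ⟨m, hm⟩ := ih (p v) (by omega)
          exact ⟨m + 1, by simpa using hm⟩
    have hex' : ∀ v, ∃ m, p^[m] v = s := fun v => hex _ v le_rfl
    refine ⟨fun v => Nat.find (hex' v), by simp, fun v hv => ?_⟩
    simpa using Nat.find_comp_succ (hex' v) (hex' (p v)) (by simpa using hv)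
  obtain ⟨δ, hδ0, hδ⟩ := hdepth
  have hle : ∀ n v, δ v = n → (parentTree p s).dist s v ≤ n := by
    intro n
    induction n with
    | zero =>
      intro v hv
      by_cases hs : v = s
      · simp [hs]
      · rw [hδ v hs] at hv; omega
    | succ n ih =>
      intro v hv
      have hs : v ≠ s := by rintro rfl; omega
      rw [hδ v hs] at hv
      refine (hconn.dist_triangle (v := p v)).trans (Nat.add_le_add (ih _ (by omega)) ?_)
      exact (SimpleGraph.dist_eq_one_iff_adj.2 (hadj v hs)).le
  -- `δ` changes by exactly one along an edge, so a walk from `s` to `v` has length at least `δ v`.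
  have hge : ∀ {u v} (w : (parentTree p s).Walk u v), δ v ≤ δ u + w.length := by
    intro u v w
    induction w with
    | nil => simp
    | @cons a b _ hab w ih =>
      rw [SimpleGraph.Walk.length_cons]
      rcases (adj_iff _ _).1 hab with ⟨h1, h2⟩ | ⟨h1, h2⟩
      · have := hδ b h1; rw [h2] at this; omega
      · have := hδ a h1; rw [h2] at this; omega
  have hdist : ∀ v, (parentTree p s).dist s v = δ v := by
    intro v
    refine le_antisymm (hle _ v rfl) ?_
    obtain ⟨w, hw⟩ := hconn.exists_walk_length_eq_dist s v
    have := hge w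
    omega
  have stamp_eq : ∀ v, v ≠ s → max (τ (p v)) (τ v) = τ v := fun v hv =>
    max_eq_right (h.lt v (mem_univ _) hv).le
  let st : Sym2 V → ℕ := Sym2.lift ⟨fun a b => max (τ a) (τ b), fun a b => max_comm _ _⟩
  have st_eq : ∀ v, v ≠ s → st s(p v, v) = τ v := stamp_eq
  have edge : ∀ e ∈ (parentTree p s).edgeSet, ∃ v, v ≠ s ∧ e = s(p v, v) := by
    intro e
    induction e with
    | _ u v =>
      rw [SimpleGraph.mem_edgeSet, adj_iff]
      rintro (⟨h1, rfl⟩ | ⟨h1, rfl⟩)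
      · exact ⟨v, h1, rfl⟩
      · exact ⟨u, h1, Sym2.eq_swap⟩
  refine ⟨⟨parentTree p s, ?_, htree, st, ?_, ?_, ?_⟩⟩
  · intro u v huv
    rcases (adj_iff _ _).1 huv with ⟨h1, rfl⟩ | ⟨h1, rfl⟩
    · exact h.adj v (mem_univ _) h1
    · exact (h.adj u (mem_univ _) h1).symm
  · intro e he
    obtain ⟨v, hv, rfl⟩ := edge e he
    rw [st_eq v hv]
    have := h.lt v (mem_univ _) hv
    exact ⟨by omega, h.le v (mem_univ _) hv⟩
  · rintro e he e' he' hee ⟨x, hx, hx'⟩ hst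
    obtain ⟨v, hv, rfl⟩ := edge e he
    obtain ⟨w, hw, rfl⟩ := edge e' he'
    rw [st_eq v hv, st_eq w hw] at hst
    have hvw : v ≠ w := by rintro rfl; exact hee rfl
    have h1 := h.lt v (mem_univ _) hv
    have h2 := h.lt w (mem_univ _) hw
    rw [Sym2.mem_iff] at hx hx'
    rcases hx with rfl | rfl <;> rcases hx' with hx' | hx'
    · exact hvw (h.inj v (mem_univ _) w (mem_univ _) hv hw hx' hst)
    · rw [hx'] at h1; omega
    · rw [← hx'] at h2; omega
    · exact hvw hx'
  · intro u v w huv hd hvw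
    rw [hdist, hdist] at hd
    rcases (adj_iff _ _).1 huv with ⟨h1, rfl⟩ | ⟨h1, rfl⟩
    · rw [st_eq v h1]
      rcases (adj_iff _ _).1 hvw with ⟨h2, h3⟩ | ⟨h2, h3⟩
      · subst h3
        rw [st_eq w h2]
        exact (h.lt w (mem_univ _) h2).le
      · subst h3
        rw [Sym2.eq_swap, st_eq v h1]
    · have := hδ u h1
      omega

/-! ## An upper bound on the broadcast time -/

/-- The vertices in `B` can be informed one round after those in `A`. -/
def Extends {V : Type*} (G : SimpleGraph V) (A B : Finset V) : Prop :=
  A ⊆ B ∧ ∃ f : V → V, (∀ v ∈ B, v ∉ A → f v ∈ A ∧ G.Adj (f v) v) ∧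
    ∀ v ∈ B, ∀ w ∈ B, v ∉ A → w ∉ A → f v = f w → v = w

theorem Extends.hasSchedule {V : Type*} {G : SimpleGraph V} {A B : Finset V} {s : V} {t : ℕ}
    (hs : s ∈ A) (hA : HasSchedule A G.Adj s t) (h : Extends G A B) :
    HasSchedule B G.Adj s (t + 1) := by
  classical
  obtain ⟨p, τ, hp⟩ := hA
  obtain ⟨hAB, f, hf, hinj⟩ := h
  have hτ : ∀ v ∈ A, τ v ≤ t := fun v hv => by
    by_cases h : v = s
    · rw [h, hp.root]; omega
    · exact hp.le v hv h
  refine ⟨fun v => if v ∈ A then p v else f v, fun v => if v ∈ A then τ v else t + 1,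
    by simp [hs, hp.root], ?_, ?_, ?_, ?_, ?_⟩
  · intro v hv hvs
    split_ifs with h
    · exact hAB (hp.mem v h hvs)
    · exact hAB (hf v hv h).1
  · intro v hv hvs
    split_ifs with h
    · exact hp.adj v h hvs
    · exact (hf v hv h).2
  · intro v hv hvs
    by_cases h : v ∈ A
    · simpa [h, hp.mem v h hvs] using hp.lt v h hvs
    · have := hτ _ (hf v hv h).1
      simp only [h, (hf v hv h).1, if_true, if_false]
      omega
  · intro v hv hvs
    split_ifs with h
    · have := hτ v h; omega
    · exact le_rfl
  · intro v hv w hw hvs hws h1 h2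
    by_cases hvA : v ∈ A <;> by_cases hwA : w ∈ A <;> simp only [hvA, hwA, if_true, if_false] at h1 h2
    · exact hp.inj v hvA w hwA hvs hws h1 h2
    · have := hτ v hvA; omega
    · have := hτ w hwA; omega
    · exact hinj v hv w hw hvA hwA h1

theorem extends_insert {V : Type*} [DecidableEq V] {G : SimpleGraph V} {A : Finset V} {u v : V}
    (hu : u ∈ A) (huv : G.Adj u v) : Extends G A (insert v A) := by
  refine ⟨subset_insert _ _, fun _ => u, ?_, ?_⟩
  · intro w hw hwA
    rcases mem_insert.1 hw with rfl | h
    · exact ⟨hu, huv⟩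
    · exact absurd h hwA
  · intro w hw w' hw' hwA hwA' _
    rcases mem_insert.1 hw with rfl | h
    · rcases mem_insert.1 hw' with rfl | h'
      · rfl
      · exact absurd h' hwA'
    · exact absurd h hwA

theorem exists_extends_of_connected {V : Type*} [Fintype V] [DecidableEq V] {G : SimpleGraph V}
    (hG : G.Connected) {A : Finset V} (hA : A.Nonempty) (hA' : A ≠ univ) :
    ∃ v ∉ A, Extends G A (insert v A) := by
  obtain ⟨a, ha⟩ := hA
  obtain ⟨b, hb⟩ : ∃ b, b ∉ A := by
    by_contra! h
    exact hA' (eq_univ_of_forall h)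
  obtain ⟨w⟩ := hG.preconnected a b
  obtain ⟨d, -, h1, h2⟩ := w.exists_boundary_dart (A : Set V) ha hb
  exact ⟨d.snd, h2, extends_insert h1 d.adj⟩

theorem exists_hasSchedule_grow {V : Type*} [Fintype V] [DecidableEq V] {G : SimpleGraph V}
    (hG : G.Connected) {A : Finset V} {s : V} {t : ℕ} (hs : s ∈ A)
    (hA : HasSchedule A G.Adj s t) (d : ℕ) :
    ∃ B, A ⊆ B ∧ HasSchedule B G.Adj s (t + d) ∧ (B = univ ∨ A.card + d ≤ B.card) := by
  induction d with
  | zero => exact ⟨A, subset_rfl, hA, Or.inr le_rfl⟩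
  | succ d ih =>
    obtain ⟨B, hAB, hB, h⟩ := ih
    by_cases hu : B = univ
    · exact ⟨B, hAB, hB.mono (by omega), Or.inl hu⟩
    · obtain ⟨v, hv, hE⟩ := exists_extends_of_connected hG ⟨s, hAB hs⟩ hu
      refine ⟨insert v B, hAB.trans (subset_insert _ _), hE.hasSchedule (hAB hs) hB, Or.inr ?_⟩
      rw [card_insert_of_notMem hv]
      have := h.resolve_left hu
      omega

/-- Doubling: in every round the informed clique vertices call distinct uninformed ones, as long as
there are enough of these. -/
theorem exists_hasSchedule_clique {V : Type*} [Fintype V] [DecidableEq V] {G : SimpleGraph V}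
    {C : Finset V} (hC : G.IsClique C) {A : Finset V} {s : V} {t : ℕ} (hs : s ∈ A)
    (hA : HasSchedule A G.Adj s t) (hAC : (A ∩ C).Nonempty) (d : ℕ) :
    ∃ B, A ⊆ B ∧ HasSchedule B G.Adj s (t + d) ∧ (C ⊆ B ∨ 2 ^ d ≤ (B ∩ C).card) := by
  induction d with
  | zero => exact ⟨A, subset_rfl, hA, Or.inr (by simpa using hAC)⟩
  | succ d ih =>
    obtain ⟨B, hAB, hB, h⟩ := ih
    by_cases hu : C ⊆ B
    · exact ⟨B, hAB, hB.mono (by omega), Or.inl hu⟩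
    · have h := h.resolve_left hu
      obtain ⟨D, hD, hDcard⟩ := exists_subset_card_eq
        (min_le_right (B ∩ C).card (C \ B).card)
      obtain ⟨f, hf⟩ : ∃ f : D ↪ (B ∩ C : Finset V), True := by
        obtain ⟨f⟩ : Nonempty (D ↪ (B ∩ C : Finset V)) :=
          Function.Embedding.nonempty_of_card_le (by simp only [Fintype.card_coe]; omega)
        exact ⟨f, trivial⟩
      have hDB : Disjoint B D := disjoint_of_subset_right hD disjoint_sdiff
      have hDC : D ⊆ C := hD.trans sdiff_subset
      have hE : Extends G B (B ∪ D) := by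
        refine ⟨subset_union_left, fun v => if hv : v ∈ D then f ⟨v, hv⟩ else v, ?_, ?_⟩
        · intro v hv hvB
          have hvD : v ∈ D := (mem_union.1 hv).resolve_left hvB
          simp only [hvD, dif_pos]
          have := mem_inter.1 (f ⟨v, hvD⟩).2
          exact ⟨this.1, hC this.2 (hDC hvD) (fun e => hvB (e ▸ this.1))⟩
        · intro v hv w hw hvB hwB he
          have hvD : v ∈ D := (mem_union.1 hv).resolve_left hvB
          have hwD : w ∈ D := (mem_union.1 hw).resolve_left hwB
          simp only [hvD, hwD, dif_pos] at he
          simpa using f.injective (Subtype.ext he)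
      refine ⟨B ∪ D, hAB.trans subset_union_left, hE.hasSchedule (hAB hs) hB, ?_⟩
      by_cases hle : (C \ B).card ≤ (B ∩ C).card
      · left
        have : D = C \ B := eq_of_subset_of_card_le hD (by omega)
        rw [this]
        intro v hv
        by_cases hvB : v ∈ B <;> simp [hv, hvB]
      · right
        rw [union_inter_distrib_right, card_union_of_disjoint
          (hDB.mono inter_subset_left inter_subset_left), inter_eq_left.2 hDC, pow_succ]
        omega

/-- Three phases. Unless everything is informed earlier, `#X` rounds with one new vertex each inform
`#X + 1` vertices, hence one outside `X`. Doubling then fills the clique, and `#X` more rounds reach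
the rest of `X`. -/
theorem hasSchedule_of_isClique_compl {V : Type*} [Fintype V] [DecidableEq V] {G : SimpleGraph V}
    (hG : G.Connected) {X : Finset V} (hX : G.IsClique {v | v ∉ X}) (s : V) :
    HasSchedule univ G.Adj s (2 * X.card + Nat.clog 2 (Fintype.card V)) := by
  have h0 : HasSchedule {s} G.Adj s 0 := by
    refine ⟨id, fun _ => 0, rfl, ?_, ?_, ?_, ?_, ?_⟩ <;> simp +contextual
  obtain ⟨B, hB, hBs, hBc⟩ := exists_hasSchedule_grow hG (mem_singleton_self s) h0 X.card
  have hsB := hB (mem_singleton_self s)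
  by_cases hu : B = univ
  · rw [hu] at hBs
    exact hBs.mono (by omega)
  have hBc := hBc.resolve_left hu
  rw [card_singleton] at hBc
  have hBX : (B ∩ Xᶜ).Nonempty := by
    by_contra hne
    have : B ⊆ X := by
      intro v hv
      by_contra hvX
      exact hne ⟨v, by simp [hv, hvX]⟩
    have := card_le_card this
    omega
  have hC : G.IsClique ((Xᶜ : Finset V) : Set V) := by
    convert hX using 1
    ext; simp
  obtain ⟨D, hD, hDs, hDc⟩ := exists_hasSchedule_clique hC hsB hBs hBX
    (Nat.clog 2 (Fintype.card V))
  have hXD : Xᶜ ⊆ D := by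
    rcases hDc with h | h
    · exact h
    · have h1 := Nat.le_pow_clog (one_lt_two) (Fintype.card V)
      have h2 : (Xᶜ : Finset V).card ≤ Fintype.card V := card_le_univ _
      have h3 : D ∩ Xᶜ = Xᶜ := eq_of_subset_of_card_le inter_subset_right (by omega)
      rw [← h3]
      exact inter_subset_left
  obtain ⟨E, hE, hEs, hEc⟩ := exists_hasSchedule_grow hG (hD hsB) hDs X.card
  have hEu : E = univ := by
    rcases hEc with h | h
    · exact h
    · rw [← card_eq_iff_eq_univ]
      have h1 := card_le_card hXD
      rw [card_compl] at h1
      have h2 : E.card ≤ Fintype.card V := card_le_univ _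
      omega
  rw [hEu] at hEs
  exact hEs.mono (by omega)

theorem broadcastTime_le_iff {V : Type*} [Fintype V] {G : SimpleGraph V} (hG : G.Connected) (s : V)
    (t : ℕ) : broadcastTime G s ≤ t ↔ HasSchedule univ G.Adj s t := by
  classical
  -- The trivial modulator `univ` provides a protocol. Without one the infimum in `broadcastTime`
  -- would be that of the empty set, which is `0`.
  have hne : {t | Nonempty (BroadcastProtocol G s t)}.Nonempty := by
    obtain ⟨p, τ, h⟩ := hasSchedule_of_isClique_compl hG (X := univ) (by simp) s
    exact ⟨_, h.nonempty_protocol⟩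
  constructor
  · intro h
    obtain ⟨P⟩ := Nat.sInf_mem hne
    exact P.hasSchedule.mono h
  · rintro ⟨p, τ, h⟩
    exact Nat.sInf_le h.nonempty_protocol

/-! ## Plans -/

/-- The part of a schedule that concerns a modulator. For a vertex `i` of the modulator, `time i` is
the round in which it is called, `parent i` encodes its caller, and `leaves i` is the number of
clique vertices that it calls and that call no vertex of the modulator themselves. The clique
vertices that call into the modulator are represented by slots, which are numbered by vertices of
the modulator: `slotTime j` and `slotParent j` are the round and the caller of the slot `j`. -/
structure Plan (V : Type*) where
  time : V → ℕ
  parent : V → ℕ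
  leaves : V → ℕ
  slotTime : V → ℕ
  slotParent : V → ℕ

/-- The fixed data of an instance: a modulator `X`, the clique `C`, the calling relation, the
source, the number of rounds, and a numbering of `X` by `0, …, k - 1`. -/
structure Setting (V : Type*) where
  X : Finset V
  C : Finset V
  A : V → V → Prop
  s : V
  t : ℕ
  rk : V → ℕ
  k : ℕ

namespace Plan

variable {V : Type*}

open scoped Classical in
/-- The number of slots that call into the modulator in round `r`. -/
noncomputable def busy (π : Plan V) (S : Setting V) (r : ℕ) : ℕ :=
  #{i ∈ S.X | i ≠ S.s ∧ S.k ≤ π.parent i ∧ π.time i = r}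

open scoped Classical in
/-- The number of slots that are called from the clique in round `r`. -/
noncomputable def pending (π : Plan V) (S : Setting V) (r : ℕ) : ℕ :=
  #{j ∈ S.X | S.k ≤ π.slotParent j ∧ π.slotTime j = r}

/-- The vertex `i` of the modulator is informed before round `r`, and calls neither a vertex of the
modulator nor a slot in round `r`. -/
def Idle (π : Plan V) (S : Setting V) (i : V) (r : ℕ) : Prop :=
  π.time i < r ∧ (∀ i' ∈ S.X, i' ≠ S.s → π.parent i' = S.rk i → π.time i' ≠ r) ∧
    ∀ j ∈ S.X, π.slotParent j = S.rk i → π.slotTime j ≠ r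

open scoped Classical in
/-- The number of rounds up to `r` in which `i` is idle. -/
noncomputable def idleCount (π : Plan V) (S : Setting V) (i : V) (r : ℕ) : ℕ :=
  Nat.count (π.Idle S i) (r + 1)

open scoped Classical in
/-- The number of slots and leaves that are informed by round `r`. -/
noncomputable def fixed (π : Plan V) (S : Setting V) (r : ℕ) : ℕ :=
  #{j ∈ S.X | π.slotTime j ≤ r} + ∑ i ∈ S.X, min (π.leaves i) (π.idleCount S i r)

open scoped Classical in
/-- The number of clique vertices that are neither slots nor leaves. -/
noncomputable def free (π : Plan V) (S : Setting V) : ℕ :=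
  #S.C - #{j ∈ S.X | π.slotTime j ≤ S.t} - ∑ i ∈ S.X, π.leaves i

/-- The number of free vertices that are informed by round `r` if the clique vertices call free
vertices as often as possible. -/
noncomputable def informed (π : Plan V) (S : Setting V) : ℕ → ℕ
  | 0 => 0
  | r + 1 => min (π.free S) (π.informed S r +
      (π.informed S r + π.fixed S r - π.busy S (r + 1) - π.pending S (r + 1)))

/-- The vertex `v` can play the role of the slot `j`. -/
def Fits (π : Plan V) (S : Setting V) (j v : V) : Prop :=
  (∀ i ∈ S.X, i ≠ S.s → π.parent i = S.k + S.rk j → S.A v i) ∧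
    ∀ a ∈ S.X, π.slotParent j = S.rk a → S.A a v

open scoped Classical in
/-- The conditions under which a plan is part of a schedule. -/
structure Valid (π : Plan V) (S : Setting V) : Prop where
  root : π.time S.s = 0
  time_le : ∀ i ∈ S.X, i ≠ S.s → π.time i ≤ S.t
  -- Codes below `k` name callers in the modulator; `k + rk j` names the slot `j`.
  parent : ∀ i ∈ S.X, i ≠ S.s →
    (∃ j ∈ S.X, π.parent i = S.rk j ∧ S.A j i ∧ π.time j < π.time i) ∨
    (∃ j ∈ S.X, π.parent i = S.k + S.rk j ∧ π.slotTime j < π.time i)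
  -- A slot with `slotTime j > t` is unused. A value of `slotParent j` that is at least `k` means
  -- that the slot is called from the clique.
  slot_pos : ∀ j ∈ S.X, 1 ≤ π.slotTime j
  slot_parent : ∀ j ∈ S.X, π.slotTime j ≤ S.t → ∀ a ∈ S.X, π.slotParent j = S.rk a →
    π.time a < π.slotTime j
  inj : ∀ i ∈ S.X, ∀ i' ∈ S.X, i ≠ S.s → i' ≠ S.s → π.parent i = π.parent i' →
    π.time i = π.time i' → i = i'
  slot_inj : ∀ j ∈ S.X, ∀ j' ∈ S.X, π.slotTime j ≤ S.t → π.slotTime j' ≤ S.t →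
    π.slotParent j < S.k → π.slotParent j = π.slotParent j' →
    π.slotTime j = π.slotTime j' → j = j'
  mixed : ∀ i ∈ S.X, i ≠ S.s → ∀ j ∈ S.X, π.slotTime j ≤ S.t → π.parent i < S.k →
    π.parent i = π.slotParent j → π.time i ≠ π.slotTime j
  -- All leaves of one vertex compete for the same neighbours, so Hall's condition for sets of
  -- single leaves and slots reduces to subsets of the modulator.
  hall : ∀ Y ⊆ S.X, ∀ Z ⊆ S.X, ∑ i ∈ Y, π.leaves i + #{j ∈ Z | π.slotTime j ≤ S.t} ≤
    #{v ∈ S.C | (∃ i ∈ Y, S.A i v) ∨ ∃ j ∈ Z, π.slotTime j ≤ S.t ∧ π.Fits S j v}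
  -- Enough clique vertices are informed for the calls that the plan prescribes; this makes the
  -- truncated subtractions in `informed` exact.
  room : ∀ r < S.t, π.busy S (r + 1) + π.pending S (r + 1) ≤ π.informed S r + π.fixed S r
  final : π.free S ≤ π.informed S S.t
  leaves_le : ∀ i ∈ S.X, π.leaves i ≤ π.idleCount S i S.t

end Plan

/-- The properties of a modulator, of the remaining clique and of the numbering. -/
structure Setting.Good {V : Type*} (S : Setting V) : Prop where
  source_mem : S.s ∈ S.X
  disj : Disjoint S.X S.C
  clique : ∀ u ∈ S.C, ∀ v ∈ S.C, u ≠ v → S.A u v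
  rk_lt : ∀ i ∈ S.X, S.rk i < S.k
  rk_inj : ∀ i ∈ S.X, ∀ j ∈ S.X, S.rk i = S.rk j → i = j
  rk_surj : ∀ r < S.k, ∃ i ∈ S.X, S.rk i = r

/-! ### From a schedule to a valid plan -/

open scoped Classical in
-- The plan is read off from the schedule: a clique vertex `d` that calls into the modulator becomes
-- the slot named `child d`. The conditions on the numbers hold because the greedy recursion informs
-- at least as many free vertices as any schedule. The bounds on the entries make them digits in
-- base `2 * k + t + 2`.
theorem IsSchedule.exists_plan {V : Type*} {S : Setting V} (hS : S.Good) {p : V → V} {τ : V → ℕ}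
    (h : IsSchedule (S.X ∪ S.C) S.A S.s S.t p τ) :
    ∃ π : Plan V, π.Valid S ∧ ∀ i ∈ S.X, π.time i ≤ S.t ∧ π.parent i < 2 * S.k ∧
      π.leaves i ≤ S.t + 1 ∧ π.slotTime i ≤ S.t + 1 ∧ π.slotParent i ≤ S.k := by
  obtain ⟨X, C, A, s, t, rk, k⟩ := S
  obtain ⟨hs, hXC, hclq, hlt, hinj, hsurj⟩ := hS
  dsimp only at *
  -- A schedule does not restrict `p s`. Moving it to `s`, which is in the modulator, keeps the
  -- entry `parent s` below `2 * k` as well.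
  wlog hps : p s = s generalizing p
  · have hup : ∀ {v}, v ≠ s → Function.update p s s v = p v := fun hv =>
      Function.update_of_ne hv _ _
    refine this (p := Function.update p s s) ⟨h.root, ?_, ?_, ?_, h.le, ?_⟩ (by simp)
    · intro v hv hvs; rw [hup hvs]; exact h.mem v hv hvs
    · intro v hv hvs; rw [hup hvs]; exact h.adj v hv hvs
    · intro v hv hvs; rw [hup hvs]; exact h.lt v hv hvs
    · intro v hv w hw hvs hws; rw [hup hvs, hup hws]; exact h.inj v hv w hw hvs hws
  have hX : ∀ {v}, v ∈ X → v ∈ X ∪ C := fun hv => mem_union_left _ hv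
  have hC : ∀ {v}, v ∈ C → v ∈ X ∪ C := fun hv => mem_union_right _ hv
  have hne : ∀ {v}, v ∈ C → v ≠ s := fun hv e => disjoint_left.1 hXC (e ▸ hs) hv
  have hXnC : ∀ {v}, v ∈ X → v ∉ C := fun hv hv' => disjoint_left.1 hXC hv hv'
  have hpm : ∀ {v}, v ∈ X ∪ C → v ≠ s → p v ∉ X → p v ∈ C := fun hv hvs hp =>
    (mem_union.1 (h.mem _ hv hvs)).resolve_left hp
  have hpos : ∀ {v}, v ∈ X ∪ C → v ≠ s → 1 ≤ τ v := fun hv hvs => by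
    have := h.lt _ hv hvs; omega
  have hle : ∀ {v}, v ∈ X ∪ C → τ v ≤ t := fun {v} hv => by
    by_cases e : v = s
    · rw [e, h.root]; omega
    · exact h.le v hv e
  have hchild : ∀ d, ∃ i, (∃ i ∈ X, i ≠ s ∧ p i = d) → i ∈ X ∧ i ≠ s ∧ p i = d := fun d => by
    by_cases hd : ∃ i ∈ X, i ≠ s ∧ p i = d
    · obtain ⟨i, hi⟩ := hd; exact ⟨i, fun _ => hi⟩
    · exact ⟨s, fun h => absurd h hd⟩
  choose child hchild using hchild
  have hch : ∀ {i}, i ∈ X → i ≠ s → child (p i) ∈ X ∧ child (p i) ≠ s ∧ p (child (p i)) = p i :=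
    fun {i} hi his => hchild _ ⟨i, hi, his, rfl⟩
  -- Of all modulator vertices with the same caller in the clique, only the chosen child is a used
  -- slot.
  let Used : V → Prop := fun j => j ≠ s ∧ p j ∈ C ∧ child (p j) = j
  let caller : V → Prop := fun d => ∃ i ∈ X, i ≠ s ∧ p i = d
  let π : Plan V :=
    { time := τ
      parent := fun i => if p i ∈ X then rk (p i) else k + rk (child (p i))
      leaves := fun i => #{v ∈ C | p v = i ∧ ¬ caller v}
      slotTime := fun j => if Used j then τ (p j) else t + 1
      slotParent := fun j => if p (p j) ∈ X then rk (p (p j)) else k }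
  let S : Setting V := ⟨X, C, A, s, t, rk, k⟩
  have used_iff : ∀ j ∈ X, π.slotTime j ≤ t ↔ Used j := fun j hj => by
    by_cases hu : Used j
    · simpa [π, hu] using hle (hC hu.2.1)
    · simp [π, hu]
  have slotTime_eq : ∀ j, Used j → π.slotTime j = τ (p j) := fun j hu => by simp [π, hu]
  have used_of_eq : ∀ {j r}, j ∈ X → r ≤ t → π.slotTime j = r → Used j ∧ τ (p j) = r :=
    fun {j r} hj hr e => by
      have hu := (used_iff j hj).1 (by omega)
      exact ⟨hu, by rw [← slotTime_eq j hu, e]⟩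
  have used_inj : ∀ {j j'}, Used j → Used j' → p j = p j' → j = j' := fun {j j'} hj hj' e => by
    rw [← hj.2.2, ← hj'.2.2, e]
  have slot_of_caller : ∀ d ∈ C, caller d → child d ∈ X ∧ Used (child d) ∧ p (child d) = d := by
    intro d hd hc
    obtain ⟨h1, h2, h3⟩ := hchild d hc
    exact ⟨h1, ⟨h2, by rwa [h3], by rw [h3]⟩, h3⟩
  have caller_of_used : ∀ j ∈ X, Used j → caller (p j) := fun j hj hu => ⟨j, hj, hu.1, rfl⟩
  have parent_rk : ∀ {i a}, i ∈ X → a ∈ X → (π.parent i = rk a ↔ p i = a) := by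
    intro i a hi ha
    by_cases hp : p i ∈ X
    · simp only [π, hp, if_true]
      exact ⟨fun e => hinj _ hp _ ha e, fun e => by rw [e]⟩
    · simp only [π, hp, if_false]
      have := hlt a ha
      exact ⟨fun e => by omega, fun e => absurd (e ▸ ha) hp⟩
  have slotParent_rk : ∀ {j a}, a ∈ X → (π.slotParent j = rk a ↔ p (p j) = a) := by
    intro j a ha
    by_cases hp : p (p j) ∈ X
    · simp only [π, hp, if_true]
      exact ⟨fun e => hinj _ hp _ ha e, fun e => by rw [e]⟩
    · simp only [π, hp, if_false]
      have := hlt a ha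
      exact ⟨fun e => by omega, fun e => absurd (e ▸ ha) hp⟩
  have parent_ge : ∀ i, k ≤ π.parent i ↔ p i ∉ X := by
    intro i
    by_cases hp : p i ∈ X
    · simpa [π, hp] using hlt _ hp
    · simp [π, hp]
  have slotParent_ge : ∀ i, k ≤ π.slotParent i ↔ p (p i) ∉ X := by
    intro i
    by_cases hp : p (p i) ∈ X
    · simpa [π, hp] using hlt _ hp
    · simp [π, hp]
  have parent_slot : ∀ {i j}, i ∈ X → i ≠ s → j ∈ X → π.parent i = k + rk j →
      p i ∈ C ∧ child (p i) = j := by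
    intro i j hi his hj e
    have hp : p i ∉ X := (parent_ge i).1 (by omega)
    simp only [π, hp, if_false] at e
    exact ⟨hpm (hX hi) his hp, hinj _ (hch hi his).1 _ hj (by omega)⟩
  -- A vertex that calls a leaf in some round makes no other call in it. Hence distinct leaves of
  -- `i` take distinct idle rounds of `i`, which bounds their number by `idleCount`.
  have leaf_idle : ∀ {i v}, i ∈ X → v ∈ C → p v = i → ¬ caller v → π.Idle S i (τ v) := by
    intro i v hi hv hpv hcv
    refine ⟨?_, ?_, ?_⟩
    · have := h.lt v (hC hv) (hne hv)
      rwa [hpv] at this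
    · intro i' hi' his' e e'
      have := h.inj i' (hX hi') v (hC hv) his' (hne hv) (((parent_rk hi' hi).1 e).trans hpv.symm) e'
      exact hXnC hi' (this ▸ hv)
    · intro j hj e e'
      obtain ⟨hu, e''⟩ := used_of_eq hj (hle (hC hv)) e'
      have := h.inj (p j) (hC hu.2.1) v (hC hv) (hne hu.2.1) (hne hv)
        (((slotParent_rk hi).1 e).trans hpv.symm) e''
      exact hcv (this ▸ caller_of_used j hj hu)
  have leaf_count : ∀ i ∈ X, ∀ r,
      #{v ∈ C | (p v = i ∧ ¬ caller v) ∧ τ v ≤ r} ≤ min (π.leaves i) (π.idleCount S i r) := by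
    intro i hi r
    refine le_min (card_le_card ?_) ?_
    · intro v hv
      simp only [mem_filter] at hv ⊢
      exact ⟨hv.1, hv.2.1⟩
    · rw [Plan.idleCount, Nat.count_eq_card_filter_range]
      refine card_le_card_of_injOn τ ?_ ?_
      · intro v hv
        simp only [coe_filter, Set.mem_ofPred_eq] at hv
        simp only [coe_filter, mem_range, Set.mem_ofPred_eq]
        exact ⟨by omega, leaf_idle hi hv.1 hv.2.1.1 hv.2.1.2⟩
      · intro v hv w hw e
        simp only [coe_filter, Set.mem_ofPred_eq] at hv hw
        exact h.inj v (hC hv.1) w (hC hw.1) (hne hv.1) (hne hw.1)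
          (hv.2.1.1.trans hw.2.1.1.symm) e
  -- `p` is injective on the used slots, so they can be counted as the clique vertices that call
  -- into the modulator.
  have card_slots : ∀ (Z : Finset V), Z ⊆ X → ∀ (R : V → Prop) [DecidablePred R],
      #{j ∈ Z | Used j ∧ R (p j)} = #{d ∈ C | (∃ j ∈ Z, Used j ∧ p j = d) ∧ R d} := by
    intro Z hZ R _
    rw [← card_image_of_injOn (f := p) (s := {j ∈ Z | Used j ∧ R (p j)})]
    · congr 1
      ext d
      simp only [mem_image, mem_filter]
      constructor
      · rintro ⟨j, ⟨hj, hu, hR⟩, rfl⟩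
        exact ⟨hu.2.1, ⟨j, hj, hu, rfl⟩, hR⟩
      · rintro ⟨hd, ⟨j, hj, hu, rfl⟩, hR⟩
        exact ⟨j, ⟨hj, hu, hR⟩, rfl⟩
    · intro j hj j' hj' e
      simp only [coe_filter, Set.mem_ofPred_eq] at hj hj'
      exact used_inj hj.2.1 hj'.2.1 e
  have card_leaves : ∀ (Y : Finset V), Y ⊆ X → ∀ (R : V → Prop) [DecidablePred R],
      ∑ i ∈ Y, #{v ∈ C | (p v = i ∧ ¬ caller v) ∧ R v} =
        #{v ∈ C | (p v ∈ Y ∧ ¬ caller v) ∧ R v} := by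
    intro Y hY R _
    rw [← card_biUnion]
    · congr 1
      ext v
      simp only [mem_biUnion, mem_filter]
      constructor
      · rintro ⟨i, hi, hv, ⟨rfl, hc⟩, hR⟩
        exact ⟨hv, ⟨hi, hc⟩, hR⟩
      · rintro ⟨hv, ⟨hi, hc⟩, hR⟩
        exact ⟨_, hi, hv, ⟨rfl, hc⟩, hR⟩
    · intro i _ i' _ hii
      rw [Function.onFun, disjoint_left]
      intro v hv hv'
      simp only [mem_filter] at hv hv'
      exact hii (hv.2.1.1.symm.trans hv'.2.1.1)
  -- the clique vertices that are neither slots nor leaves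
  let Fr : V → Prop := fun v => ¬ caller v ∧ p v ∉ X
  have card_split : ∀ (R : V → Prop) [DecidablePred R], #{v ∈ C | R v} =
      #{j ∈ X | Used j ∧ R (p j)} + ∑ i ∈ X, #{v ∈ C | (p v = i ∧ ¬ caller v) ∧ R v} +
        #{v ∈ C | Fr v ∧ R v} := by
    intro R _
    rw [card_slots X subset_rfl R, card_leaves X subset_rfl R, ← card_union_of_disjoint,
      ← card_union_of_disjoint]
    · congr 1
      ext v
      simp only [mem_filter, mem_union, Fr]
      constructor
      · rintro ⟨hv, hR⟩
        by_cases hc : caller v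
        · obtain ⟨h1, h2, h3⟩ := slot_of_caller v hv hc
          exact Or.inl (Or.inl ⟨hv, ⟨_, h1, h2, h3⟩, hR⟩)
        · by_cases hp : p v ∈ X
          · exact Or.inl (Or.inr ⟨hv, ⟨hp, hc⟩, hR⟩)
          · exact Or.inr ⟨hv, ⟨hc, hp⟩, hR⟩
      · rintro ((h | h) | h) <;> exact ⟨h.1, h.2.2⟩
    · rw [disjoint_left]
      intro v hv hv'
      simp only [mem_filter, mem_union, Fr] at hv hv'
      rcases hv with ⟨_, ⟨j, hj, hu, rfl⟩, _⟩ | ⟨_, ⟨hp, _⟩, _⟩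
      · exact hv'.2.1.1 (caller_of_used j hj hu)
      · exact hv'.2.1.2 hp
    · rw [disjoint_left]
      intro v hv hv'
      simp only [mem_filter] at hv hv'
      obtain ⟨_, ⟨j, hj, hu, rfl⟩, _⟩ := hv
      exact hv'.2.1.2 (caller_of_used j hj hu)
  have used_filter : #{j ∈ X | π.slotTime j ≤ t} = #{j ∈ X | Used j} := by
    congr 1
    exact filter_congr used_iff
  have free_eq : π.free S = #{v ∈ C | Fr v} := by
    have h1 := card_split (fun _ => True)
    simp only [and_true, filter_true] at h1
    rw [Plan.free]
    change #C - #{j ∈ X | π.slotTime j ≤ t} -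
      ∑ i ∈ X, #{v ∈ C | p v = i ∧ ¬ caller v} = _
    rw [used_filter]
    omega
  -- Only an inequality: the schedule may call a leaf later than in the earliest idle rounds, which
  -- `fixed` presupposes.
  have fixed_le : ∀ r ≤ t, #{v ∈ C | τ v ≤ r} ≤ π.fixed S r + #{v ∈ C | Fr v ∧ τ v ≤ r} := by
    intro r hr
    rw [card_split (fun v => τ v ≤ r), Plan.fixed]
    refine Nat.add_le_add_right (Nat.add_le_add ?_ (sum_le_sum fun i hi => leaf_count i hi r)) _
    refine card_le_card ?_
    intro j hj
    simp only [mem_filter] at hj ⊢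
    exact ⟨hj.1, by rw [slotTime_eq j hj.2.1]; exact hj.2.2⟩
  -- The vertices that are called from the clique in round `r + 1` have distinct callers, all of
  -- them clique vertices informed by round `r`.
  have calls_le : ∀ r < t, π.busy S (r + 1) + π.pending S (r + 1) +
      #{v ∈ C | Fr v ∧ τ v = r + 1} ≤ #{v ∈ C | τ v ≤ r} := by
    intro r hr
    have hpend : π.pending S (r + 1) =
        #{d ∈ C | (∃ j ∈ X, Used j ∧ p j = d) ∧ p d ∉ X ∧ τ d = r + 1} := by
      rw [← card_slots X subset_rfl (fun d => p d ∉ X ∧ τ d = r + 1), Plan.pending]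
      congr 1
      refine filter_congr fun j hj => ?_
      rw [show S.k = k from rfl, slotParent_ge]
      constructor
      · rintro ⟨h1, h2⟩
        obtain ⟨h3, h4⟩ := used_of_eq hj (by omega) h2
        exact ⟨h3, h1, h4⟩
      · rintro ⟨h1, h2, h3⟩
        exact ⟨h2, by rw [slotTime_eq j h1, h3]⟩
    have hbusy : π.busy S (r + 1) = #{i ∈ X | i ≠ s ∧ p i ∉ X ∧ τ i = r + 1} := by
      rw [Plan.busy]
      congr 1
      refine filter_congr fun i _ => ?_
      rw [show S.k = k from rfl, parent_ge]
    rw [hpend, hbusy, ← card_union_of_disjoint, ← card_union_of_disjoint]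
    · refine card_le_card_of_injOn p ?_ ?_
      · intro v hv
        have hv : v ∈ X ∪ C ∧ v ≠ s ∧ p v ∉ X ∧ τ v = r + 1 := by
          simp only [coe_union, coe_filter, Set.mem_union, Set.mem_ofPred_eq, Fr] at hv
          rcases hv with (⟨h1, h2, h3, h4⟩ | ⟨h1, -, h2, h3⟩) | ⟨h1, ⟨-, h2⟩, h3⟩
          · exact ⟨hX h1, h2, h3, h4⟩
          · exact ⟨hC h1, hne h1, h2, h3⟩
          · exact ⟨hC h1, hne h1, h2, h3⟩
        have := h.lt v hv.1 hv.2.1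
        simp only [coe_filter, Set.mem_ofPred_eq]
        exact ⟨hpm hv.1 hv.2.1 hv.2.2.1, by omega⟩
      · have key : ∀ v ∈ ((({i ∈ X | i ≠ s ∧ p i ∉ X ∧ τ i = r + 1} : Finset V) ∪
            {d ∈ C | (∃ j ∈ X, Used j ∧ p j = d) ∧ p d ∉ X ∧ τ d = r + 1}) ∪
            {v ∈ C | Fr v ∧ τ v = r + 1}), v ∈ X ∪ C ∧ v ≠ s ∧ τ v = r + 1 := by
          intro v hv
          simp only [mem_union, mem_filter] at hv
          rcases hv with (⟨h1, h2, h3, h4⟩ | ⟨h1, -, h2, h3⟩) | ⟨h1, ⟨-, h2⟩, h3⟩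
          · exact ⟨hX h1, h2, h4⟩
          · exact ⟨hC h1, hne h1, h3⟩
          · exact ⟨hC h1, hne h1, h3⟩
        intro v hv w hw e
        obtain ⟨h1, h2, h3⟩ := key v (mem_coe.1 hv)
        obtain ⟨h4, h5, h6⟩ := key w (mem_coe.1 hw)
        exact h.inj v h1 w h4 h2 h5 e (h3.trans h6.symm)
    · rw [disjoint_left]
      intro v hv hv'
      simp only [mem_union, mem_filter, Fr] at hv hv'
      rcases hv with ⟨h1, -⟩ | ⟨-, ⟨j, hj, hu, rfl⟩, -⟩
      · exact hXnC h1 hv'.1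
      · exact hv'.2.1.1 (caller_of_used j hj hu)
    · rw [disjoint_left]
      intro v hv hv'
      simp only [mem_filter] at hv hv'
      exact hXnC hv.1 hv'.1
  -- The greedy recursion dominates the schedule. By `fixed_le` and `calls_le`, the schedule gains
  -- no more free vertices in a round than the recursion does, which starts the round with at least
  -- as many.
  have informed_ge : ∀ r ≤ t, #{v ∈ C | Fr v ∧ τ v ≤ r} ≤ π.informed S r := by
    intro r
    induction r with
    | zero =>
      intro _
      rw [Plan.informed, Nat.le_zero, card_eq_zero, filter_eq_empty_iff]
      rintro v hv ⟨-, h0⟩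
      have := hpos (hC hv) (hne hv)
      omega
    | succ r ih =>
      intro hr
      have ih := ih (by omega)
      have h1 := fixed_le r (by omega)
      have h2 := calls_le r (by omega)
      rw [Plan.informed, free_eq]
      refine le_min (card_le_card ?_) ?_
      · intro v hv
        simp only [mem_filter] at hv ⊢
        exact ⟨hv.1, hv.2.1⟩
      · have h3 : #{v ∈ C | Fr v ∧ τ v ≤ r + 1} ≤
            #{v ∈ C | Fr v ∧ τ v ≤ r} + #{v ∈ C | Fr v ∧ τ v = r + 1} := by
          refine (card_le_card ?_).trans (card_union_le _ _)
          intro v hv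
          simp only [mem_filter, mem_union] at hv ⊢
          rcases Nat.lt_or_ge (τ v) (r + 1) with h | h
          · exact Or.inl ⟨hv.1, hv.2.1, by omega⟩
          · exact Or.inr ⟨hv.1, hv.2.1, by omega⟩
        omega
  have leaves_eq : ∀ i, π.leaves i = #{v ∈ C | (p v = i ∧ ¬ caller v) ∧ True} := fun i => by
    simp [π]
  have leaves_le : ∀ i ∈ X, π.leaves i ≤ π.idleCount S i t := by
    intro i hi
    refine le_trans ?_ ((leaf_count i hi t).trans (min_le_right _ _))
    rw [leaves_eq]
    refine card_le_card ?_
    intro v hv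
    simp only [mem_filter] at hv ⊢
    exact ⟨hv.1, hv.2.1, hle (hC hv.1)⟩
  refine ⟨π, ⟨h.root, fun i hi _ => hle (hX hi), ?_, ?_, ?_, ?_, ?_, ?_, ?_, ?_, ?_, leaves_le⟩, ?_⟩
  · intro i hi his
    by_cases hp : p i ∈ X
    · exact Or.inl ⟨p i, hp, (parent_rk hi hp).2 rfl, h.adj i (hX hi) his, h.lt i (hX hi) his⟩
    · obtain ⟨h1, h2, h3⟩ := hch hi his
      refine Or.inr ⟨child (p i), h1, by simp [π, hp], ?_⟩
      rw [slotTime_eq _ ⟨h2, by rw [h3]; exact hpm (hX hi) his hp, by rw [h3]⟩, h3]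
      exact h.lt i (hX hi) his
  · intro j hj
    by_cases hu : Used j
    · rw [slotTime_eq j hu]
      exact hpos (hC hu.2.1) (hne hu.2.1)
    · simp [π, hu]
  · intro j hj hjt a ha e
    have hu := (used_iff j hj).1 hjt
    rw [slotTime_eq j hu]
    have := h.lt (p j) (hC hu.2.1) (hne hu.2.1)
    rwa [(slotParent_rk ha).1 e] at this
  · intro i hi i' hi' his his' e e'
    refine h.inj i (hX hi) i' (hX hi') his his' ?_ e'
    by_cases hp : p i ∈ X
    · exact ((parent_rk hi' hp).1 (e.symm.trans ((parent_rk hi hp).2 rfl))).symm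
    · obtain ⟨h1, h2, h3⟩ := hch hi his
      have he : π.parent i' = k + rk (child (p i)) := by
        rw [← e]; simp [π, hp]
      obtain ⟨h4, h5⟩ := parent_slot hi' his' h1 he
      rw [← h3, ← h5, (hch hi' his').2.2]
  · intro j hj j' hj' hjt hjt' hk e e'
    have hu := (used_iff j hj).1 hjt
    have hu' := (used_iff j' hj').1 hjt'
    have hp : p (p j) ∈ X := by
      by_contra hp
      exact absurd hk (not_lt.2 ((slotParent_ge j).2 hp))
    rw [slotTime_eq j hu, slotTime_eq j' hu'] at e'
    have h1 := (slotParent_rk hp).1 (e.symm.trans ((slotParent_rk hp).2 rfl))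
    exact used_inj hu hu' (h.inj _ (hC hu.2.1) _ (hC hu'.2.1) (hne hu.2.1) (hne hu'.2.1) h1.symm e')
  · intro i hi his j hj hjt hk e e'
    have hu := (used_iff j hj).1 hjt
    have hp : p i ∈ X := by
      by_contra hp
      exact absurd hk (not_lt.2 ((parent_ge i).2 hp))
    rw [slotTime_eq j hu] at e'
    have h1 := (slotParent_rk hp).1 (e.symm.trans ((parent_rk hi hp).2 rfl))
    have := h.inj i (hX hi) (p j) (hC hu.2.1) his (hne hu.2.1) h1.symm e'
    exact hXnC hi (this ▸ hu.2.1)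
  · intro Y hY Z hZ
    have hZ' : #{j ∈ Z | π.slotTime j ≤ t} = #{j ∈ Z | Used j ∧ True} := by
      congr 1
      exact filter_congr fun j hj => by rw [used_iff j (hZ hj), and_true]
    simp only [leaves_eq]
    rw [card_leaves Y hY (fun _ => True), hZ', card_slots Z hZ (fun _ => True),
      ← card_union_of_disjoint]
    · refine card_le_card ?_
      intro v hv
      simp only [mem_union, mem_filter] at hv ⊢
      rcases hv with ⟨hv, ⟨h1, h2⟩, -⟩ | ⟨hv, ⟨j, hj, hu, rfl⟩, -⟩
      · exact ⟨hv, Or.inl ⟨p v, h1, h.adj v (hC hv) (hne hv)⟩⟩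
      · refine ⟨hv, Or.inr ⟨j, hj, (used_iff j (hZ hj)).2 hu, ?_, ?_⟩⟩
        · intro i hi his e
          obtain ⟨h1, h2⟩ := parent_slot hi his (hZ hj) e
          have h3 := h.adj i (hX hi) his
          rwa [← (hch hi his).2.2, h2] at h3
        · intro a ha e
          have h3 := h.adj _ (hC hv) (hne hv)
          rwa [(slotParent_rk ha).1 e] at h3
    · rw [disjoint_left]
      intro v hv hv'
      simp only [mem_filter] at hv hv'
      obtain ⟨_, ⟨j, hj, hu, rfl⟩, _⟩ := hv'
      exact hv.2.1.2 (caller_of_used j (hZ hj) hu)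
  · intro r hr
    have h1 := fixed_le r hr.le
    have h2 := calls_le r hr
    have h3 := informed_ge r hr.le
    exact (by omega : π.busy S (r + 1) + π.pending S (r + 1) ≤ π.informed S r + π.fixed S r)
  · refine le_trans ?_ (informed_ge t le_rfl)
    rw [free_eq]
    refine card_le_card ?_
    intro v hv
    simp only [mem_filter] at hv ⊢
    exact ⟨hv.1, hv.2, hle (hC hv.1)⟩
  · intro i hi
    refine ⟨hle (hX hi), ?_, ?_, ?_, ?_⟩
    · by_cases hp : p i ∈ X
      · have := hlt _ hp
        simp only [π, hp, if_true]; omega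
      · simp only [π, hp, if_false]
        by_cases his : i = s
        · exact absurd hs (by rwa [his, hps] at hp)
        · have := hlt _ (hch hi his).1
          omega
    · refine (leaves_le i hi).trans ?_
      exact Nat.count_le _
    · by_cases hu : Used i
      · rw [slotTime_eq i hu]
        have := hle (hC hu.2.1)
        omega
      · simp [π, hu]
    · by_cases hp : p (p i) ∈ X
      · have := hlt _ hp
        simp only [π, hp, if_true]; omega
      · simp [π, hp]

/-! ### From a valid plan to a schedule -/

/-- Each success raises the count by one, so some success lifts it from `l` to `l + 1`. This serves
to call leaf number `l` of a vertex in its idle round number `l`, counted from `0`. -/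
theorem exists_lt_of_lt_count {p : ℕ → Prop} [DecidablePred p] {l n : ℕ} (h : l < Nat.count p n) :
    ∃ r < n, p r ∧ Nat.count p r = l := by
  induction n with
  | zero => simp at h
  | succ n ih =>
    by_cases hl : l < Nat.count p n
    · obtain ⟨r, hr, hp, hc⟩ := ih hl
      exact ⟨r, by omega, hp, hc⟩
    · rw [Nat.count_succ] at h
      split_ifs at h with hp
      · exact ⟨n, by omega, hp, by omega⟩
      · omega

theorem exists_embedding_on {V : Type*} [DecidableEq V] {s t : Finset V} (h : #s ≤ #t) :
    ∃ f : V → V, (∀ v ∈ s, f v ∈ t) ∧ ∀ v ∈ s, ∀ w ∈ s, f v = f w → v = w := by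
  obtain ⟨f⟩ : Nonempty (s ↪ t) := Function.Embedding.nonempty_of_card_le (by simpa using h)
  refine ⟨fun v => if hv : v ∈ s then f ⟨v, hv⟩ else v, ?_, ?_⟩
  · intro v hv
    simp [hv]
  · intro v hv w hw e
    simp only [hv, hw, dif_pos] at e
    simpa using f.injective (Subtype.ext e)

open scoped Classical in
/-- Distinct clique vertices can be assigned to all leaves and all used slots. -/
theorem Plan.Valid.exists_assignment {V : Type*} {S : Setting V} {π : Plan V} (h : π.Valid S) :
    ∃ (leaf : V → ℕ → V) (slot : V → V),
      (∀ i ∈ S.X, ∀ l < π.leaves i, leaf i l ∈ S.C ∧ S.A i (leaf i l)) ∧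
      (∀ j ∈ S.X, π.slotTime j ≤ S.t → slot j ∈ S.C ∧ π.Fits S j (slot j)) ∧
      (∀ i ∈ S.X, ∀ l < π.leaves i, ∀ i' ∈ S.X, ∀ l' < π.leaves i', leaf i l = leaf i' l' →
        i = i' ∧ l = l') ∧
      (∀ j ∈ S.X, π.slotTime j ≤ S.t → ∀ j' ∈ S.X, π.slotTime j' ≤ S.t → slot j = slot j' →
        j = j') ∧
      ∀ i ∈ S.X, ∀ l < π.leaves i, ∀ j ∈ S.X, π.slotTime j ≤ S.t → leaf i l ≠ slot j := by
  let I : Finset ((Σ _ : V, ℕ) ⊕ V) :=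
    (S.X.sigma fun i => range (π.leaves i)).disjSum {j ∈ S.X | π.slotTime j ≤ S.t}
  let N : I → Finset V := fun a => {v ∈ S.C | Sum.elim (fun b => S.A b.1 v)
    (fun j => π.Fits S j v) a.1}
  have hmemL : ∀ {i l}, (Sum.inl ⟨i, l⟩ : (Σ _ : V, ℕ) ⊕ V) ∈ I ↔ i ∈ S.X ∧ l < π.leaves i := by
    simp [I]
  have hmemR : ∀ {j}, (Sum.inr j : (Σ _ : V, ℕ) ⊕ V) ∈ I ↔ j ∈ S.X ∧ π.slotTime j ≤ S.t := by
    simp [I]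
  -- Let `Y` and `Z` be the modulator vertices whose leaves and slots occur in `F`. Adding all other
  -- leaves of the vertices in `Y` enlarges `F` but not the union of the neighbourhoods, so the
  -- condition for `Y` and `Z` suffices.
  have hall : ∀ F : Finset I, #F ≤ #(F.biUnion N) := by
    intro F
    let Y : Finset V := {i ∈ S.X | ∃ l, Sum.inl ⟨i, l⟩ ∈ F.map (Function.Embedding.subtype _)}
    let Z : Finset V := {j ∈ S.X | Sum.inr j ∈ F.map (Function.Embedding.subtype _)}
    have h1 : F.map (Function.Embedding.subtype _) ⊆
        (Y.sigma fun i => range (π.leaves i)).disjSum {j ∈ Z | π.slotTime j ≤ S.t} := by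
      intro a ha
      have haI : a ∈ I := by
        simp only [mem_map, Function.Embedding.coe_subtype] at ha
        obtain ⟨b, -, rfl⟩ := ha
        exact b.2
      rcases a with ⟨i, l⟩ | j
      · rw [hmemL] at haI
        rw [inl_mem_disjSum, mem_sigma, mem_range, mem_filter]
        exact ⟨⟨haI.1, l, ha⟩, haI.2⟩
      · rw [hmemR] at haI
        rw [inr_mem_disjSum, mem_filter, mem_filter]
        exact ⟨⟨haI.1, ha⟩, haI.2⟩
    have h2 := card_le_card h1
    rw [card_map, card_disjSum, card_sigma] at h2
    simp only [card_range] at h2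
    refine h2.trans ((h.hall Y (filter_subset _ _) Z (filter_subset _ _)).trans (card_le_card ?_))
    intro v hv
    rw [mem_filter] at hv
    rw [mem_biUnion]
    rcases hv with ⟨hv, ⟨i, hi, hA⟩ | ⟨j, hj, -, hA⟩⟩
    · obtain ⟨l, hl⟩ := (mem_filter.1 hi).2
      obtain ⟨b, hb, hb'⟩ := mem_map.1 hl
      refine ⟨b, hb, mem_filter.2 ⟨hv, ?_⟩⟩
      rw [show b.1 = _ from hb']
      exact hA
    · obtain ⟨b, hb, hb'⟩ := mem_map.1 (mem_filter.1 hj).2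
      refine ⟨b, hb, mem_filter.2 ⟨hv, ?_⟩⟩
      rw [show b.1 = _ from hb']
      exact hA
  obtain ⟨f, hf, hfN⟩ := (all_card_le_biUnion_card_iff_exists_injective N).1 hall
  refine ⟨fun i l => if h : Sum.inl ⟨i, l⟩ ∈ I then f ⟨_, h⟩ else i,
    fun j => if h : Sum.inr j ∈ I then f ⟨_, h⟩ else j, ?_, ?_, ?_, ?_, ?_⟩
  · intro i hi l hl
    simp only [hmemL.2 ⟨hi, hl⟩, dif_pos]
    exact mem_filter.1 (hfN ⟨_, hmemL.2 ⟨hi, hl⟩⟩)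
  · intro j hj hjt
    simp only [hmemR.2 ⟨hj, hjt⟩, dif_pos]
    exact mem_filter.1 (hfN ⟨_, hmemR.2 ⟨hj, hjt⟩⟩)
  · intro i hi l hl i' hi' l' hl' e
    simp only [hmemL.2 ⟨hi, hl⟩, hmemL.2 ⟨hi', hl'⟩, dif_pos] at e
    simpa using hf e
  · intro j hj hjt j' hj' hjt' e
    simp only [hmemR.2 ⟨hj, hjt⟩, hmemR.2 ⟨hj', hjt'⟩, dif_pos] at e
    simpa using hf e
  · intro i hi l hl j hj hjt e
    simp only [hmemR.2 ⟨hj, hjt⟩, hmemL.2 ⟨hi, hl⟩, dif_pos] at e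
    simpa using hf e

theorem Plan.informed_le_free {V : Type*} (π : Plan V) (S : Setting V) (r : ℕ) :
    π.informed S r ≤ π.free S := by
  cases r with
  | zero => exact Nat.zero_le _
  | succ r => exact min_le_left _ _

open scoped Classical in
-- Slots and leaves are placed in the clique by Hall's theorem, and each leaf is called in the
-- earliest idle round of its caller that is left. The free vertices are numbered, and number `x` is
-- called in the first round `r` with `x < informed r`. The calls inside the clique in one round
-- never outnumber the clique vertices that are informed and not busy; as the clique is complete,
-- any injection from the former to the latter assigns the callers.
theorem Plan.Valid.hasSchedule {V : Type*} {S : Setting V} (hS : S.Good) {π : Plan V}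
    (h : π.Valid S) : HasSchedule (S.X ∪ S.C) S.A S.s S.t := by
  obtain ⟨leaf, slot, hleaf, hslot, leaf_inj, slot_inj, leaf_ne⟩ := h.exists_assignment
  have hXnC : ∀ {v}, v ∈ S.X → v ∉ S.C := fun hv hv' => disjoint_left.1 hS.disj hv hv'
  -- the rounds in which the leaves are called
  have hround : ∀ i l, ∃ r, i ∈ S.X → l < π.leaves i →
      r ≤ S.t ∧ π.Idle S i r ∧ Nat.count (π.Idle S i) r = l := by
    intro i l
    by_cases hi : i ∈ S.X ∧ l < π.leaves i
    · obtain ⟨r, hr, h1, h2⟩ := exists_lt_of_lt_count (hi.2.trans_le (h.leaves_le i hi.1))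
      exact ⟨r, fun _ _ => ⟨by omega, h1, h2⟩⟩
    · exact ⟨0, fun h1 h2 => absurd ⟨h1, h2⟩ hi⟩
  choose round hround using hround
  let Dset : Finset V := {j ∈ S.X | π.slotTime j ≤ S.t}.image slot
  let Lset : Finset V := (S.X.sigma fun i => range (π.leaves i)).image fun b => leaf b.1 b.2
  let Fset : Finset V := S.C \ (Dset ∪ Lset)
  have mem_D : ∀ {v}, v ∈ Dset ↔ ∃ j ∈ S.X, π.slotTime j ≤ S.t ∧ slot j = v := by
    intro v
    simp [Dset, and_assoc]
  have mem_L : ∀ {v}, v ∈ Lset ↔ ∃ i ∈ S.X, ∃ l < π.leaves i, leaf i l = v := by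
    intro v
    simp only [Lset, mem_image, mem_sigma, mem_range, Sigma.exists]
    constructor
    · rintro ⟨i, l, ⟨h1, h2⟩, h3⟩
      exact ⟨i, h1, l, h2, h3⟩
    · rintro ⟨i, h1, l, h2, h3⟩
      exact ⟨i, l, ⟨h1, h2⟩, h3⟩
  have hDC : Dset ⊆ S.C := fun v hv => by
    obtain ⟨j, hj, hjt, rfl⟩ := mem_D.1 hv
    exact (hslot j hj hjt).1
  have hLC : Lset ⊆ S.C := fun v hv => by
    obtain ⟨i, hi, l, hl, rfl⟩ := mem_L.1 hv
    exact (hleaf i hi l hl).1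
  have hDL : Disjoint Dset Lset := by
    rw [disjoint_left]
    intro v hv hv'
    obtain ⟨j, hj, hjt, rfl⟩ := mem_D.1 hv
    obtain ⟨i, hi, l, hl, e⟩ := mem_L.1 hv'
    exact leaf_ne i hi l hl j hj hjt e
  have card_image_slot : ∀ (R : V → Prop) [DecidablePred R], (∀ j ∈ S.X, R j → π.slotTime j ≤ S.t) →
      #({j ∈ S.X | R j}.image slot) = #{j ∈ S.X | R j} := by
    intro R _ hR
    refine card_image_of_injOn ?_
    intro j hj j' hj' e
    simp only [coe_filter, Set.mem_ofPred_eq] at hj hj'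
    exact slot_inj j hj.1 (hR j hj.1 hj.2) j' hj'.1 (hR j' hj'.1 hj'.2) e
  have card_image_leaf : ∀ m : V → ℕ, (∀ i ∈ S.X, m i ≤ π.leaves i) →
      #((S.X.sigma fun i => range (m i)).image fun b => leaf b.1 b.2) = ∑ i ∈ S.X, m i := by
    intro m hm
    rw [card_image_of_injOn, card_sigma]
    · simp
    · rintro ⟨i, l⟩ hb ⟨i', l'⟩ hb' e
      simp only [coe_sigma, Set.mem_sigma_iff, mem_coe, mem_range] at hb hb'
      obtain ⟨rfl, rfl⟩ := leaf_inj i hb.1 l (hb.2.trans_le (hm i hb.1)) i' hb'.1 l'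
        (hb'.2.trans_le (hm i' hb'.1)) e
      rfl
  have card_F : #Fset = π.free S := by
    have h1 : #Dset = _ := card_image_slot (fun j => π.slotTime j ≤ S.t) (fun _ _ h => h)
    have h2 : #Lset = _ := card_image_leaf π.leaves (fun _ _ => le_rfl)
    rw [card_sdiff_of_subset (union_subset hDC hLC), card_union_of_disjoint hDL, h1, h2, Plan.free]
    omega
  -- the rounds in which the free vertices are called
  obtain ⟨idx, hidx⟩ : ∃ idx : V → ℕ, Set.BijOn idx Fset (range (π.free S)) := by
    have : #Fset = #(range (π.free S)) := by rw [card_F, card_range]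
    let e := Finset.equivOfCardEq this
    refine ⟨fun v => if hv : v ∈ Fset then (e ⟨v, hv⟩ : ℕ) else 0, ?_, ?_, ?_⟩
    · intro v hv
      have hv' : v ∈ Fset := hv
      simp only [hv', dif_pos]
      exact (e ⟨v, hv'⟩).2
    · intro v hv w hw he
      have hv' : v ∈ Fset := hv
      have hw' : w ∈ Fset := hw
      simp only [hv', hw', dif_pos] at he
      simpa using e.injective (Subtype.ext he)
    · intro r hr
      refine ⟨(e.symm ⟨r, hr⟩).1, (e.symm ⟨r, hr⟩).2, ?_⟩
      simp
  have idx_lt : ∀ v ∈ Fset, idx v < π.free S := fun v hv => mem_range.1 (hidx.1 hv)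
  have hfree : ∀ v ∈ Fset, ∃ r, idx v < π.informed S r := fun v hv =>
    ⟨S.t, (idx_lt v hv).trans_le h.final⟩
  obtain ⟨τ, τX, τD, τL, τF⟩ : ∃ τ : V → ℕ, (∀ i ∈ S.X, τ i = π.time i) ∧
      (∀ j ∈ S.X, π.slotTime j ≤ S.t → τ (slot j) = π.slotTime j) ∧
      (∀ i ∈ S.X, ∀ l < π.leaves i, τ (leaf i l) = round i l) ∧
      ∀ v ∈ Fset, ∀ r, τ v ≤ r ↔ ∃ r' ≤ r, idx v < π.informed S r' := by
    have : ∀ v, ∃ r, (v ∈ S.X → r = π.time v) ∧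
        (∀ j ∈ S.X, π.slotTime j ≤ S.t → slot j = v → r = π.slotTime j) ∧
        (∀ i ∈ S.X, ∀ l < π.leaves i, leaf i l = v → r = round i l) ∧
        (v ∈ Fset → ∀ r', r ≤ r' ↔ ∃ r'' ≤ r', idx v < π.informed S r'') := by
      intro v
      by_cases hX : v ∈ S.X
      · refine ⟨π.time v, fun _ => rfl, ?_, ?_, ?_⟩
        · rintro j hj hjt rfl
          exact absurd (hslot j hj hjt).1 (hXnC hX)
        · rintro i hi l hl rfl
          exact absurd (hleaf i hi l hl).1 (hXnC hX)
        · intro hv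
          exact absurd (mem_sdiff.1 hv).1 (hXnC hX)
      by_cases hD : v ∈ Dset
      · obtain ⟨j, hj, hjt, rfl⟩ := mem_D.1 hD
        refine ⟨π.slotTime j, fun h => absurd h hX, ?_, ?_, ?_⟩
        · intro j' hj' hjt' e
          rw [slot_inj j' hj' hjt' j hj hjt e]
        · intro i hi l hl e
          exact absurd e (leaf_ne i hi l hl j hj hjt)
        · intro hv
          exact absurd (mem_union_left _ hD) (mem_sdiff.1 hv).2
      by_cases hL : v ∈ Lset
      · obtain ⟨i, hi, l, hl, rfl⟩ := mem_L.1 hL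
        refine ⟨round i l, fun h => absurd h hX, ?_, ?_, ?_⟩
        · intro j hj hjt e
          exact absurd e.symm (leaf_ne i hi l hl j hj hjt)
        · intro i' hi' l' hl' e
          obtain ⟨rfl, rfl⟩ := leaf_inj i' hi' l' hl' i hi l hl e
          rfl
        · intro hv
          exact absurd (mem_union_right _ hL) (mem_sdiff.1 hv).2
      by_cases hF : v ∈ Fset
      · refine ⟨Nat.find (hfree v hF), fun h => absurd h hX, ?_, ?_, fun _ r => Nat.find_le_iff _ _⟩
        · intro j hj hjt e
          exact absurd (mem_D.2 ⟨j, hj, hjt, e⟩) hD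
        · intro i hi l hl e
          exact absurd (mem_L.2 ⟨i, hi, l, hl, e⟩) hL
      · refine ⟨0, fun h => absurd h hX, ?_, ?_, fun h => absurd h hF⟩
        · intro j hj hjt e
          exact absurd (mem_D.2 ⟨j, hj, hjt, e⟩) hD
        · intro i hi l hl e
          exact absurd (mem_L.2 ⟨i, hi, l, hl, e⟩) hL
    choose τ hτ using this
    exact ⟨τ, fun i hi => (hτ i).1 hi, fun j hj hjt => (hτ _).2.1 j hj hjt rfl,
      fun i hi l hl => (hτ _).2.2.1 i hi l hl rfl, fun v hv => (hτ v).2.2.2 hv⟩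
  have informed_mono : Monotone (π.informed S) := by
    refine monotone_nat_of_le_succ fun r => ?_
    have := π.informed_le_free S r
    rw [Plan.informed]
    omega
  have τF' : ∀ v ∈ Fset, ∀ r, τ v ≤ r ↔ idx v < π.informed S r := by
    intro v hv r
    rw [τF v hv]
    exact ⟨fun ⟨r', h1, h2⟩ => h2.trans_le (informed_mono h1), fun h => ⟨r, le_rfl, h⟩⟩
  have τF_pos : ∀ v ∈ Fset, 1 ≤ τ v := by
    intro v hv
    by_contra hlt
    have := (τF' v hv 0).1 (by omega)
    simp [Plan.informed] at this
  have τF_le : ∀ v ∈ Fset, τ v ≤ S.t := fun v hv =>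
    (τF' v hv _).2 ((idx_lt v hv).trans_le h.final)
  have hsplit : ∀ v ∈ S.C, v ∈ Dset ∨ v ∈ Lset ∨ v ∈ Fset := by
    intro v hv
    by_cases h1 : v ∈ Dset
    · exact Or.inl h1
    by_cases h2 : v ∈ Lset
    · exact Or.inr (Or.inl h2)
    · exact Or.inr (Or.inr (mem_sdiff.2 ⟨hv, by simp [h1, h2]⟩))
  -- the calls inside the clique
  let Need : ℕ → Finset V := fun r => {v ∈ Fset | τ v = r + 1} ∪
    {j ∈ S.X | S.k ≤ π.slotParent j ∧ π.slotTime j = r + 1}.image slot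
  let Busy : ℕ → Finset V := fun r => {v ∈ S.C | ∃ i ∈ S.X, i ≠ S.s ∧ π.time i = r + 1 ∧
    ∃ j ∈ S.X, π.parent i = S.k + S.rk j ∧ slot j = v}
  let Avail : ℕ → Finset V := fun r => {v ∈ S.C | τ v ≤ r} \ Busy r
  -- The reverse of the estimate for an arbitrary schedule: leaves are now called as early as
  -- possible, so by round `r` at least `min (leaves i) (idleCount i r)` leaves of `i` are informed.
  have card_informed : ∀ r ≤ S.t, π.informed S r + π.fixed S r ≤ #{v ∈ S.C | τ v ≤ r} := by
    intro r hr
    have h1 : π.informed S r = #{v ∈ Fset | τ v ≤ r} := by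
      rw [← card_range (π.informed S r), ← card_image_of_injOn (s := {v ∈ Fset | τ v ≤ r}) (f := idx)]
      · congr 1
        ext x
        simp only [mem_range, mem_image, mem_filter]
        constructor
        · intro hx
          obtain ⟨v, hv, rfl⟩ := hidx.2.2 (mem_coe.2 (mem_range.2
            (hx.trans_le (π.informed_le_free S r))))
          exact ⟨v, ⟨hv, (τF' v hv r).2 hx⟩, rfl⟩
        · rintro ⟨v, ⟨hv, hvr⟩, rfl⟩
          exact (τF' v hv r).1 hvr
      · exact hidx.2.1.mono fun v hv => (mem_filter.1 (mem_coe.1 hv)).1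
    rw [h1, Plan.fixed, ← card_image_slot (fun j => π.slotTime j ≤ r) (fun j _ hj => hj.trans hr),
      ← card_image_leaf _ (fun i _ => min_le_left _ _), ← card_union_of_disjoint,
      ← card_union_of_disjoint]
    · refine card_le_card ?_
      intro v hv
      rw [mem_union, mem_union, mem_image, mem_image] at hv
      rw [mem_filter]
      rcases hv with hv | ⟨j, hj, rfl⟩ | ⟨⟨i, l⟩, hb, rfl⟩
      · exact ⟨(mem_sdiff.1 (mem_filter.1 hv).1).1, (mem_filter.1 hv).2⟩
      · obtain ⟨hj, hjr⟩ := mem_filter.1 hj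
        exact ⟨(hslot j hj (hjr.trans hr)).1, by rwa [τD j hj (hjr.trans hr)]⟩
      · obtain ⟨hi, hl⟩ := mem_sigma.1 hb
        rw [mem_range, lt_min_iff] at hl
        refine ⟨(hleaf i hi l hl.1).1, ?_⟩
        dsimp only at hi hl ⊢
        rw [τL i hi l hl.1]
        obtain ⟨-, -, h3⟩ := hround i l hi hl.1
        by_contra hlt
        have h4 := Nat.count_monotone (π.Idle S i) (show r + 1 ≤ round i l by omega)
        have h5 := hl.2
        rw [Plan.idleCount] at h5
        omega
    · rw [disjoint_left]
      intro v hv hv'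
      refine (mem_sdiff.1 (mem_filter.1 hv).1).2 ?_
      rcases mem_union.1 hv' with h | h
      · exact mem_union_left _ (image_subset_image
          (monotone_filter_right _ fun j _ hj => le_trans hj hr) h)
      · exact mem_union_right _ (image_subset_image
          (sigma_mono subset_rfl fun i => range_subset_range.2 (min_le_left _ _)) h)
    · refine disjoint_of_subset_left (image_subset_image ?_)
        (disjoint_of_subset_right (image_subset_image ?_) hDL)
      · exact monotone_filter_right _ fun j _ hj => le_trans hj hr
      · exact sigma_mono subset_rfl fun i => range_subset_range.2 (min_le_left _ _)
  have card_Busy : ∀ r, #(Busy r) ≤ π.busy S (r + 1) := by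
    intro r
    have : ∀ i, ∃ v, i ∈ S.X → ∀ j ∈ S.X, π.parent i = S.k + S.rk j → slot j = v := by
      intro i
      by_cases hi : ∃ j ∈ S.X, π.parent i = S.k + S.rk j
      · obtain ⟨j, hj, e⟩ := hi
        refine ⟨slot j, fun _ j' hj' e' => ?_⟩
        rw [hS.rk_inj j' hj' j hj (by omega)]
      · exact ⟨i, fun _ j hj e => absurd ⟨j, hj, e⟩ hi⟩
    choose g hg using this
    rw [Plan.busy]
    refine le_trans (card_le_card ?_) (card_image_le (f := g))
    intro v hv
    obtain ⟨-, i, hi, his, hit, j, hj, e, rfl⟩ := mem_filter.1 hv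
    exact mem_image.2 ⟨i, mem_filter.2 ⟨hi, his, by omega, hit⟩, (hg i hi j hj e).symm⟩
  -- The recursion lets `informed` grow by at most the number of informed clique vertices that are
  -- left after the prescribed calls; `room` excludes that this difference is truncated.
  have card_Need : ∀ r < S.t, #(Need r) ≤ #(Avail r) := by
    intro r hr
    have h1 : #{v ∈ Fset | τ v = r + 1} ≤ π.informed S (r + 1) - π.informed S r := by
      rw [← Nat.card_Ico]
      refine card_le_card_of_injOn idx ?_ (hidx.2.1.mono fun v hv => (mem_filter.1 (mem_coe.1 hv)).1)
      intro v hv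
      obtain ⟨hv, e⟩ := mem_filter.1 (mem_coe.1 hv)
      rw [mem_coe, mem_Ico]
      refine ⟨?_, (τF' v hv _).1 e.le⟩
      by_contra hlt
      have := (τF' v hv r).2 (by omega)
      omega
    have h2 : #({j ∈ S.X | S.k ≤ π.slotParent j ∧ π.slotTime j = r + 1}.image slot) ≤
        π.pending S (r + 1) := card_image_le
    have h3 := card_informed r hr.le
    have h4 := card_Busy r
    have h5 := le_card_sdiff (Busy r) {v ∈ S.C | τ v ≤ r}
    have h6 := h.room r hr
    have h7 : π.informed S (r + 1) ≤ _ := min_le_right _ _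
    have h8 := informed_mono (Nat.le_succ r)
    refine (card_union_le _ _).trans ?_
    change _ ≤ #({v ∈ S.C | τ v ≤ r} \ Busy r)
    omega
  have hφ : ∀ r, ∃ f : V → V, r < S.t → (∀ v ∈ Need r, f v ∈ Avail r) ∧
      ∀ v ∈ Need r, ∀ w ∈ Need r, f v = f w → v = w := by
    intro r
    by_cases hr : r < S.t
    · obtain ⟨f, hf⟩ := exists_embedding_on (card_Need r hr)
      exact ⟨f, fun _ => hf⟩
    · exact ⟨id, fun h => absurd h hr⟩
  choose φ hφ using hφ
  -- Calls are classified by the side of the caller and by the reason for the call, so that two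
  -- calls in the same round can be compared case by case.
  let CallX : V → V → Prop := fun u v => u ∈ S.X ∧
    ((v ∈ S.X ∧ v ≠ S.s ∧ π.parent v = S.rk u) ∨
      (∃ j ∈ S.X, π.slotTime j ≤ S.t ∧ v = slot j ∧ π.slotParent j = S.rk u) ∨
      ∃ l < π.leaves u, v = leaf u l)
  let CallC : V → V → Prop := fun u v => u ∈ S.C ∧
    ((v ∈ S.X ∧ v ≠ S.s ∧ ∃ j ∈ S.X, u = slot j ∧ π.slotTime j ≤ S.t ∧
      π.parent v = S.k + S.rk j) ∨
      ∃ r < S.t, v ∈ Need r ∧ u = φ r v ∧ τ v = r + 1)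
  have exists_caller : ∀ v, ∃ u, v ∈ S.X ∪ S.C → v ≠ S.s →
      (CallX u v ∨ CallC u v) ∧ S.A u v ∧ τ u < τ v ∧ τ v ≤ S.t := by
    intro v
    by_cases hv : v ∈ S.X ∪ S.C ∧ v ≠ S.s
    swap
    · exact ⟨v, fun h1 h2 => absurd ⟨h1, h2⟩ hv⟩
    have hNeed : ∀ r < S.t, v ∈ Need r → v ∈ S.C → τ v = r + 1 →
        ∃ u, (CallX u v ∨ CallC u v) ∧ S.A u v ∧ τ u < τ v ∧ τ v ≤ S.t := by
      intro r hr hvN hvC e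
      have h1 := (hφ r hr).1 v hvN
      obtain ⟨h2, -⟩ := mem_sdiff.1 h1
      obtain ⟨h2, h3⟩ := mem_filter.1 h2
      refine ⟨φ r v, Or.inr ⟨h2, Or.inr ⟨r, hr, hvN, rfl, e⟩⟩, ?_, by omega, by omega⟩
      refine hS.clique _ h2 v hvC ?_
      intro e'
      rw [e'] at h3
      omega
    suffices ∃ u, (CallX u v ∨ CallC u v) ∧ S.A u v ∧ τ u < τ v ∧ τ v ≤ S.t by
      obtain ⟨u, hu⟩ := this
      exact ⟨u, fun _ _ => hu⟩
    obtain ⟨hv, hvs⟩ := hv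
    rcases mem_union.1 hv with hvX | hvC
    · rcases h.parent v hvX hvs with ⟨j, hj, h1, h2, h3⟩ | ⟨j, hj, h1, h2⟩
      · refine ⟨j, Or.inl ⟨hj, Or.inl ⟨hvX, hvs, h1⟩⟩, h2, ?_, ?_⟩
        · rwa [τX j hj, τX v hvX]
        · rw [τX v hvX]; exact h.time_le v hvX hvs
      · have h3 := h.time_le v hvX hvs
        have hjt : π.slotTime j ≤ S.t := h2.le.trans h3
        refine ⟨slot j, Or.inr ⟨(hslot j hj hjt).1, Or.inl ⟨hvX, hvs, j, hj, rfl, hjt, h1⟩⟩,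
          (hslot j hj hjt).2.1 v hvX hvs h1, ?_, ?_⟩
        · rwa [τD j hj hjt, τX v hvX]
        · rwa [τX v hvX]
    · rcases hsplit v hvC with hD | hL | hF
      · obtain ⟨j, hj, hjt, rfl⟩ := mem_D.1 hD
        by_cases hk : π.slotParent j < S.k
        · obtain ⟨a, ha, e⟩ := hS.rk_surj _ hk
          refine ⟨a, Or.inl ⟨ha, Or.inr (Or.inl ⟨j, hj, hjt, rfl, e.symm⟩)⟩,
            (hslot j hj hjt).2.2 a ha e.symm, ?_, ?_⟩
          · rw [τX a ha, τD j hj hjt]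
            exact h.slot_parent j hj hjt a ha e.symm
          · rwa [τD j hj hjt]
        · have := h.slot_pos j hj
          refine hNeed (π.slotTime j - 1) (by omega) ?_ hvC (by rw [τD j hj hjt]; omega)
          refine mem_union_right _ (mem_image.2 ⟨j, mem_filter.2 ⟨hj, by omega, by omega⟩, rfl⟩)
      · obtain ⟨i, hi, l, hl, rfl⟩ := mem_L.1 hL
        obtain ⟨h1, h2, h3⟩ := hround i l hi hl
        refine ⟨i, Or.inl ⟨hi, Or.inr (Or.inr ⟨l, hl, rfl⟩)⟩, (hleaf i hi l hl).2, ?_, ?_⟩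
        · rw [τX i hi, τL i hi l hl]
          exact h2.1
        · rwa [τL i hi l hl]
      · have h1 := τF_pos v hF
        have h2 := τF_le v hF
        exact hNeed (τ v - 1) (by omega)
          (mem_union_left _ (mem_filter.2 ⟨hF, by omega⟩)) hvC (by omega)
  choose p hp using exists_caller
  have slot_mem : ∀ {j}, j ∈ S.X → π.slotTime j ≤ S.t → slot j ∈ S.C := fun hj hjt =>
    (hslot _ hj hjt).1
  refine ⟨p, τ, by rw [τX _ hS.source_mem, h.root], ?_, fun v hv hvs => (hp v hv hvs).2.1,
    fun v hv hvs => (hp v hv hvs).2.2.1, fun v hv hvs => (hp v hv hvs).2.2.2, ?_⟩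
  · intro v hv hvs
    rcases (hp v hv hvs).1 with h1 | h1
    · exact mem_union_left _ h1.1
    · exact mem_union_right _ h1.1
  · -- a caller in the modulator calls one vertex at a time
    have xd : ∀ {u v j}, v ∈ S.X → v ≠ S.s → u ∈ S.X → π.parent v = S.rk u → j ∈ S.X →
        π.slotTime j ≤ S.t → π.slotParent j = S.rk u → τ v ≠ τ (slot j) := by
      intro u v j hv hvs hu e hj hjt e'
      rw [τX v hv, τD j hj hjt]
      exact h.mixed v hv hvs j hj hjt (e ▸ hS.rk_lt u hu) (e.trans e'.symm)
    have xl : ∀ {u v l}, v ∈ S.X → v ≠ S.s → u ∈ S.X → π.parent v = S.rk u → l < π.leaves u →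
        τ v ≠ τ (leaf u l) := by
      intro u v l hv hvs hu e hl
      rw [τX v hv, τL u hu l hl]
      exact (hround u l hu hl).2.1.2.1 v hv hvs e
    have dl : ∀ {u j l}, u ∈ S.X → j ∈ S.X → π.slotTime j ≤ S.t → π.slotParent j = S.rk u →
        l < π.leaves u → τ (slot j) ≠ τ (leaf u l) := by
      intro u j l hu hj hjt e hl
      rw [τD j hj hjt, τL u hu l hl]
      exact (hround u l hu hl).2.1.2.2 j hj e
    have callX_inj : ∀ u v w, CallX u v → CallX u w → τ v = τ w → v = w := by
      rintro u v w ⟨hu, h1⟩ ⟨-, h2⟩ e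
      rcases h1 with ⟨hv, hvs, ev⟩ | ⟨j, hj, hjt, rfl, ej⟩ | ⟨l, hl, rfl⟩ <;>
        rcases h2 with ⟨hw, hws, ew⟩ | ⟨j', hj', hjt', rfl, ej'⟩ | ⟨l', hl', rfl⟩
      · rw [τX v hv, τX w hw] at e
        exact h.inj v hv w hw hvs hws (ev.trans ew.symm) e
      · exact absurd e (xd hv hvs hu ev hj' hjt' ej')
      · exact absurd e (xl hv hvs hu ev hl')
      · exact absurd e.symm (xd hw hws hu ew hj hjt ej)
      · rw [τD j hj hjt, τD j' hj' hjt'] at e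
        rw [h.slot_inj j hj j' hj' hjt hjt' (ej ▸ hS.rk_lt u hu) (ej.trans ej'.symm) e]
      · exact absurd e (dl hu hj hjt ej hl')
      · exact absurd e.symm (xl hw hws hu ew hl)
      · exact absurd e.symm (dl hu hj' hjt' ej' hl)
      · rw [τL u hu l hl, τL u hu l' hl'] at e
        rw [← (hround u l hu hl).2.2, ← (hround u l' hu hl').2.2, e]
    have busy_need : ∀ {u v w r}, v ∈ S.X → v ≠ S.s → (∃ j ∈ S.X, u = slot j ∧
        π.slotTime j ≤ S.t ∧ π.parent v = S.k + S.rk j) → r < S.t → w ∈ Need r → u = φ r w →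
        τ v ≠ r + 1 := by
      rintro u v w r hv hvs ⟨j, hj, rfl, hjt, e⟩ hr hw hφw hτ
      have h1 := (hφ r hr).1 w hw
      rw [← hφw] at h1
      refine (mem_sdiff.1 h1).2 (mem_filter.2 ⟨slot_mem hj hjt, v, hv, hvs, ?_, j, hj, e, rfl⟩)
      rw [← τX v hv, hτ]
    have callC_inj : ∀ u v w, CallC u v → CallC u w → τ v = τ w → v = w := by
      rintro u v w ⟨-, h1⟩ ⟨-, h2⟩ e
      rcases h1 with ⟨hv, hvs, hj⟩ | ⟨r, hr, hv, hφv, hτ⟩ <;>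
        rcases h2 with ⟨hw, hws, hj'⟩ | ⟨r', hr', hw, hφw, hτ'⟩
      · obtain ⟨j, hj, rfl, hjt, ej⟩ := hj
        obtain ⟨j', hj', es, hjt', ej'⟩ := hj'
        obtain rfl := slot_inj j hj hjt j' hj' hjt' es
        rw [τX v hv, τX w hw] at e
        exact h.inj v hv w hw hvs hws (ej.trans ej'.symm) e
      · exact absurd (e.trans hτ') (busy_need hv hvs hj hr' hw hφw)
      · exact absurd (e.symm.trans hτ) (busy_need hw hws hj' hr hv hφv)
      · obtain rfl : r = r' := by omega
        exact (hφ r hr).2 v hv w hw (hφv.symm.trans hφw)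
    intro v hv w hw hvs hws e e'
    have h1 := (hp v hv hvs).1
    have h2 := (hp w hw hws).1
    rw [e] at h1
    rcases h1 with h1 | h1 <;> rcases h2 with h2 | h2
    · exact callX_inj _ v w h1 h2 e'
    · exact absurd h2.1 (hXnC h1.1)
    · exact absurd h1.1 (hXnC h2.1)
    · exact callC_inj _ v w h1 h2 e'

/-! ## Functions that are computable with loops of a fixed length

Register `3` holds the length of all loops. The registers below `10` and the arrays are the global
memory; the registers from `10` on are used for local variables and intermediate results. -/

/-- The polynomial `c * (x + 1) ^ c`. -/
def polyBound (c x : ℕ) : ℕ := c * (x + 1) ^ c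

theorem polyBound_mono {c c' : ℕ} (h : c ≤ c') (x : ℕ) : polyBound c x ≤ polyBound c' x :=
  Nat.mul_le_mul h (Nat.pow_le_pow_right (Nat.succ_pos x) h)

theorem polyBound_add_le (c c' x : ℕ) :
    polyBound c x + polyBound c' x ≤ polyBound (c + c') x := by
  rw [polyBound, polyBound, polyBound, Nat.add_mul]
  exact Nat.add_le_add (Nat.mul_le_mul_left _ (Nat.pow_le_pow_right (Nat.succ_pos x) (by omega)))
    (Nat.mul_le_mul_left _ (Nat.pow_le_pow_right (Nat.succ_pos x) (by omega)))

theorem le_polyBound (c x : ℕ) : c ≤ polyBound c x :=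
  Nat.le_mul_of_pos_right _ (Nat.pow_pos (Nat.succ_pos x))

theorem mul_polyBound_le (c x : ℕ) : x * polyBound c x ≤ polyBound (c + 1) x := by
  rw [polyBound, polyBound, pow_succ]
  calc x * (c * (x + 1) ^ c) = c * ((x + 1) ^ c * x) := by ring
    _ ≤ (c + 1) * ((x + 1) ^ c * (x + 1)) :=
      Nat.mul_le_mul (by omega) (Nat.mul_le_mul_left _ (by omega))

/-- The states agree on the registers below `d` and on the arrays. -/
def Agree (d : ℕ) (σ σ' : State) : Prop :=
  (∀ x < d, σ'.reg x = σ.reg x) ∧ σ'.arr = σ.arr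

theorem Agree.trans {d : ℕ} {σ σ' σ'' : State} (h : Agree d σ σ') (h' : Agree d σ' σ'') :
    Agree d σ σ'' :=
  ⟨fun x hx => (h'.1 x hx).trans (h.1 x hx), h'.2.trans h.2⟩

theorem Agree.mono {d d' : ℕ} {σ σ' : State} (h : Agree d' σ σ') (hd : d ≤ d') : Agree d σ σ' :=
  ⟨fun x hx => h.1 x (hx.trans_le hd), h.2⟩

@[simp] theorem State.setReg_reg_self (σ : State) (x v : ℕ) : (σ.setReg x v).reg x = v := by
  simp [State.setReg]

@[simp] theorem State.setReg_reg_of_ne (σ : State) {x y : ℕ} (v : ℕ) (h : y ≠ x) :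
    (σ.setReg x v).reg y = σ.reg y := by
  simp [State.setReg, h]

theorem Agree.setReg (σ : State) {d x : ℕ} (v : ℕ) (h : d ≤ x) : Agree d σ (σ.setReg x v) :=
  ⟨fun y hy => State.setReg_reg_of_ne _ _ (by omega), rfl⟩

/-- The global part of a state. -/
def State.global (σ : State) : State :=
  ⟨fun x => if x < 10 then σ.reg x else 0, σ.arr⟩

theorem Agree.global_eq {d : ℕ} {σ σ' : State} (h : Agree d σ σ') (hd : 10 ≤ d) :
    σ'.global = σ.global := by
  rw [State.global, State.global, h.2]
  congr 1
  funext x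
  split_ifs with hx
  · exact h.1 x (by omega)
  · rfl

/-- A type of contexts: a global memory together with the values of some local variables.
`Valid d rd` says that `rd` reads a context from the global memory and from registers below `d`. -/
class Ctx (Γ : Type) where
  base : Γ → State
  Valid : ℕ → (State → Γ) → Prop
  valid_mono : ∀ {d d' : ℕ} {rd : State → Γ}, d ≤ d' → Valid d rd → Valid d' rd
  ten_le : ∀ {d : ℕ} {rd : State → Γ}, Valid d rd → 10 ≤ d
  base_eq : ∀ {d : ℕ} {rd : State → Γ}, Valid d rd → ∀ σ, base (rd σ) = σ.global
  agree : ∀ {d : ℕ} {rd : State → Γ}, Valid d rd → ∀ {σ σ' : State}, Agree d σ σ' → rd σ' = rd σ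

instance : Ctx State where
  base γ := γ
  Valid d rd := 10 ≤ d ∧ rd = State.global
  valid_mono h h' := ⟨h'.1.trans h, h'.2⟩
  ten_le h := h.1
  base_eq h σ := by rw [h.2]
  agree h _ _ ha := by rw [h.2]; exact ha.global_eq h.1

/-- One more local variable, kept in a register below `d`. Contexts grow like a stack with the
latest variable as last component; the registers from `d` on are free for a computation, and `Agree
d` protects those below. -/
instance (Γ : Type) [Ctx Γ] : Ctx (Γ × ℕ) where
  base γ := Ctx.base γ.1
  Valid d rd := ∃ (rd' : State → Γ) (r : ℕ), Ctx.Valid d rd' ∧ r < d ∧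
    rd = fun σ => (rd' σ, σ.reg r)
  valid_mono := by
    rintro d d' _ h ⟨rd', r, h1, h2, rfl⟩
    exact ⟨rd', r, Ctx.valid_mono h h1, h2.trans_le h, rfl⟩
  ten_le := by
    rintro d _ ⟨rd', r, h1, h2, rfl⟩
    exact Ctx.ten_le h1
  base_eq := by
    rintro d _ ⟨rd', r, h1, h2, rfl⟩ σ
    exact Ctx.base_eq h1 σ
  agree := by
    rintro d _ ⟨rd', r, h1, h2, rfl⟩ σ σ' h
    simp only [Ctx.agree h1 h, h.1 r h2]

/-- There is a program that computes `f`, with the result in register `d`, in a time that is bounded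
by a polynomial in the length of the loops. -/
def Comp {Γ : Type} [Ctx Γ] (f : Γ → ℕ) : Prop :=
  ∀ (d : ℕ) (rd : State → Γ), Ctx.Valid d rd → ∃ (p : Program) (c : ℕ), ∀ σ : State,
    ∃ (σ' : State) (m : ℕ), Exec p σ σ' m ∧ m ≤ polyBound c (σ.reg 3) ∧ Agree d σ σ' ∧
      σ'.reg d = f (rd σ)

open scoped Classical in
/-- The predicate `P` is decided by a program. -/
def CompP {Γ : Type} [Ctx Γ] (P : Γ → Prop) : Prop :=
  Comp fun γ => if P γ then 1 else 0

/-- A counting loop. -/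
theorem exec_for {x N c : ℕ} {p : Program} {I : ℕ → State → Prop}
    (hI : ∀ i σ, I i σ → σ.reg x = i ∧ σ.reg 3 = N)
    (step : ∀ i < N, ∀ σ, I i σ → ∃ σ' m, Exec p σ σ' m ∧ m ≤ c ∧ I (i + 1) σ')
    {σ : State} (h : I 0 σ) :
    ∃ σ' m, Exec (.loop (.sub (.var 3) (.var x)) p) σ σ' m ∧ m ≤ N * (c + 4) + 4 ∧ I N σ' := by
  -- The test `reg 3 - reg x` takes four steps, in each round of the loop and once more at the end.
  have main : ∀ n i σ, i + n = N → I i σ →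
      ∃ σ' m, Exec (.loop (.sub (.var 3) (.var x)) p) σ σ' m ∧ m ≤ n * (c + 4) + 4 ∧ I N σ' := by
    intro n
    induction n with
    | zero =>
      intro i σ hn hi
      obtain rfl : i = N := by omega
      refine ⟨σ, _, Exec.loop_false ?_, by simp [Expr.cost], hi⟩
      simp [Expr.eval, (hI _ σ hi).1, (hI _ σ hi).2]
    | succ n ih =>
      intro i σ hn hi
      obtain ⟨σ', m, he, hm, hi'⟩ := step i (by omega) σ hi
      obtain ⟨σ'', m', he', hm', hi''⟩ := ih (i + 1) σ' (by omega) hi'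
      refine ⟨σ'', _, Exec.loop_true ?_ he he', ?_, hi''⟩
      · simp only [Expr.eval, (hI i σ hi).1, (hI i σ hi).2]
        omega
      · simp only [Expr.cost]
        rw [Nat.succ_mul]
        omega
  exact main N 0 σ (by omega) h

/-! ### Closure under composition, case distinction, iteration, sums and bounded quantifiers -/

section Closure

variable {Γ : Type} [Ctx Γ] {f g : Γ → ℕ} {P Q : Γ → Prop}

theorem Comp.of_expr {e : ∀ (d : ℕ) (rd : State → Γ), Ctx.Valid d rd → Expr}
    (h : ∀ d rd hd σ, (e d rd hd).eval σ = f (rd σ)) : Comp f := by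
  intro d rd hd
  refine ⟨.assign d (e d rd hd), (e d rd hd).cost + 1, fun σ => ⟨_, _, Exec.assign _ _ _,
    le_polyBound _ _, Agree.setReg _ _ le_rfl, ?_⟩⟩
  rw [State.setReg_reg_self, h]

theorem Comp.const (n : ℕ) : Comp fun _ : Γ => n :=
  Comp.of_expr (e := fun _ _ _ => .const n) fun _ _ _ _ => rfl

theorem Comp.reg (x : ℕ) (hx : x < 10) : Comp fun γ : Γ => (Ctx.base γ).reg x :=
  Comp.of_expr (e := fun _ _ _ => .var x) fun d rd hd σ => by
    simp [Ctx.base_eq hd, State.global, hx, Expr.eval]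

theorem Comp.var : Comp fun γ : Γ × ℕ => γ.2 := by
  rintro d _ ⟨rd, r, h1, h2, rfl⟩
  exact ⟨.assign d (.var r), 2, fun σ => ⟨_, _, Exec.assign _ _ _,
    le_polyBound _ _, Agree.setReg _ _ le_rfl, by simp [Expr.eval]⟩⟩

theorem Comp.weaken (hf : Comp f) : Comp fun γ : Γ × ℕ => f γ.1 := by
  rintro d _ ⟨rd, r, h1, h2, rfl⟩
  exact hf d rd h1

theorem Comp.var1 : Comp fun γ : (Γ × ℕ) × ℕ => γ.1.2 := Comp.var.weaken

theorem Comp.var2 : Comp fun γ : ((Γ × ℕ) × ℕ) × ℕ => γ.1.1.2 := Comp.var1.weaken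

theorem Comp.var3 : Comp fun γ : (((Γ × ℕ) × ℕ) × ℕ) × ℕ => γ.1.1.1.2 := Comp.var2.weaken

/-- Apply an instruction to the result of one computation. -/
theorem Comp.unary (hf : Comp f) {e : ℕ → Expr} {F : State → ℕ → ℕ}
    (he : ∀ d, 10 ≤ d → ∀ σ, (e d).eval σ = F σ.global (σ.reg d)) :
    Comp fun γ => F (Ctx.base γ) (f γ) := by
  intro d rd hd
  obtain ⟨p, c, hp⟩ := hf d rd hd
  refine ⟨.seq p (.assign d (e d)), c + ((e d).cost + 1), fun σ => ?_⟩
  obtain ⟨σ', m, h1, h2, h3, h4⟩ := hp σ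
  refine ⟨_, _, Exec.seq h1 (Exec.assign _ _ _), ?_, h3.trans (Agree.setReg _ _ le_rfl), ?_⟩
  · exact (Nat.add_le_add h2 (le_polyBound _ _)).trans (polyBound_add_le _ _ _)
  · rw [State.setReg_reg_self, he d (Ctx.ten_le hd), h3.global_eq (Ctx.ten_le hd), h4]
    simp only [Ctx.base_eq hd]

theorem Comp.get (a : ℕ) (hf : Comp f) : Comp fun γ => (Ctx.base γ).arr a (f γ) :=
  hf.unary (e := fun d => .get a (.var d)) (F := fun σ x => σ.arr a x) fun _ _ _ => rfl

/-- Sequential composition: the second program may use the result of the first one. -/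
theorem Comp.bind {h : Γ × ℕ → ℕ} (hf : Comp f) (hh : Comp h) : Comp fun γ => h (γ, f γ) := by
  intro d rd hd
  obtain ⟨p, c, hp⟩ := hf d rd hd
  obtain ⟨q, c', hq⟩ := hh (d + 1) (fun σ => (rd σ, σ.reg d))
    ⟨rd, d, Ctx.valid_mono (Nat.le_succ d) hd, Nat.lt_succ_self d, rfl⟩
  refine ⟨.seq p (.seq q (.assign d (.var (d + 1)))), c + (c' + 2), fun σ => ?_⟩
  obtain ⟨σ', m, h1, h2, h3, h4⟩ := hp σ
  obtain ⟨σ'', m', h5, h6, h7, h8⟩ := hq σ'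
  refine ⟨_, _, Exec.seq h1 (Exec.seq h5 (Exec.assign _ _ _)), ?_,
    (h3.trans (h7.mono (Nat.le_succ d))).trans (Agree.setReg _ _ le_rfl), ?_⟩
  · rw [h3.1 3 (by have := Ctx.ten_le hd; omega)] at h6
    refine (Nat.add_le_add h2 ?_).trans (polyBound_add_le _ _ _)
    exact (Nat.add_le_add h6 (le_polyBound 2 _)).trans (polyBound_add_le _ _ _)
  · rw [State.setReg_reg_self, Expr.eval, h8, h4, Ctx.agree hd h3]

/-- Apply an instruction to the results of two computations. -/
theorem Comp.binary (hf : Comp f) (hg : Comp g) {e : ℕ → ℕ → Expr} {F : ℕ → ℕ → ℕ}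
    (he : ∀ x y σ, (e x y).eval σ = F (σ.reg x) (σ.reg y)) :
    Comp fun γ => F (f γ) (g γ) := by
  intro d rd hd
  obtain ⟨p, c, hp⟩ := hf d rd hd
  obtain ⟨q, c', hq⟩ := hg (d + 1) rd (Ctx.valid_mono (Nat.le_succ d) hd)
  refine ⟨.seq p (.seq q (.assign d (e d (d + 1)))), c + (c' + ((e d (d + 1)).cost + 1)),
    fun σ => ?_⟩
  obtain ⟨σ', m, h1, h2, h3, h4⟩ := hp σ
  obtain ⟨σ'', m', h5, h6, h7, h8⟩ := hq σ'
  refine ⟨_, _, Exec.seq h1 (Exec.seq h5 (Exec.assign _ _ _)), ?_,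
    (h3.trans (h7.mono (Nat.le_succ d))).trans (Agree.setReg _ _ le_rfl), ?_⟩
  · rw [h3.1 3 (by have := Ctx.ten_le hd; omega)] at h6
    refine (Nat.add_le_add h2 ?_).trans (polyBound_add_le _ _ _)
    exact (Nat.add_le_add h6 (le_polyBound _ _)).trans (polyBound_add_le _ _ _)
  · rw [State.setReg_reg_self, he, h8, h7.1 d (Nat.lt_succ_self d), h4, Ctx.agree hd h3]

theorem Comp.add (hf : Comp f) (hg : Comp g) : Comp fun γ => f γ + g γ :=
  hf.binary hg (e := fun x y => .add (.var x) (.var y)) (F := fun a b => a + b) fun _ _ _ => rfl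

theorem Comp.sub (hf : Comp f) (hg : Comp g) : Comp fun γ => f γ - g γ :=
  hf.binary hg (e := fun x y => .sub (.var x) (.var y)) (F := fun a b => a - b) fun _ _ _ => rfl

theorem Comp.congr (hf : Comp f) (h : ∀ γ, f γ = g γ) : Comp g := by
  rwa [← funext h]

theorem CompP.congr (hP : CompP P) (h : ∀ γ, P γ ↔ Q γ) : CompP Q := by
  rwa [← funext fun γ => propext (h γ)]

theorem Comp.ite {_ : DecidablePred P} (hP : CompP P) (hf : Comp f) (hg : Comp g) :
    Comp fun γ => if P γ then f γ else g γ := by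
  intro d rd hd
  obtain ⟨p, c, hp⟩ := hP d rd hd
  obtain ⟨q, c', hq⟩ := hf d rd hd
  obtain ⟨r, c'', hr⟩ := hg d rd hd
  refine ⟨.seq p (.cond (.var d) q r), c + (2 + (c' + c'')), fun σ => ?_⟩
  obtain ⟨σ', m, h1, h2, h3, h4⟩ := hp σ
  by_cases h : P (rd σ)
  · obtain ⟨σ'', m', h5, h6, h7, h8⟩ := hq σ'
    rw [h3.1 3 (by have := Ctx.ten_le hd; omega)] at h6
    refine ⟨_, _, Exec.seq h1 (Exec.cond_true (by simp [Expr.eval, h4, h]) h5), ?_, h3.trans h7, ?_⟩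
    · refine (Nat.add_le_add h2 ?_).trans (polyBound_add_le _ _ _)
      exact (Nat.add_le_add (le_polyBound 2 _) (h6.trans (polyBound_mono (by omega) _))).trans
        (polyBound_add_le _ _ _)
    · rw [h8, Ctx.agree hd h3]; simp only [if_pos h]
  · obtain ⟨σ'', m', h5, h6, h7, h8⟩ := hr σ'
    rw [h3.1 3 (by have := Ctx.ten_le hd; omega)] at h6
    refine ⟨_, _, Exec.seq h1 (Exec.cond_false (by simp [Expr.eval, h4, h]) h5), ?_, h3.trans h7, ?_⟩
    · refine (Nat.add_le_add h2 ?_).trans (polyBound_add_le _ _ _)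
      exact (Nat.add_le_add (le_polyBound 2 _) (h6.trans (polyBound_mono (by omega) _))).trans
        (polyBound_add_le _ _ _)
    · rw [h8, Ctx.agree hd h3]; simp only [if_neg h]

/-- Iteration: the number of iterations is the length of the loops. -/
theorem Comp.iterate {h : Γ → ℕ → ℕ → ℕ} (hf : Comp f)
    (hh : Comp fun γ : (Γ × ℕ) × ℕ => h γ.1.1 γ.1.2 γ.2) :
    Comp fun γ => Nat.rec (motive := fun _ => ℕ) (f γ) (fun i a => h γ i a)
      ((Ctx.base γ).reg 3) := by
  intro d rd hd
  have hten := Ctx.ten_le hd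
  obtain ⟨p, c, hp⟩ := hf d rd hd
  -- Register `d` holds the accumulator and register `d + 1` the counter; the body uses the
  -- registers from `d + 2` on.
  obtain ⟨q, c', hq⟩ := hh (d + 2) (fun σ => ((rd σ, σ.reg (d + 1)), σ.reg d))
    ⟨_, d, ⟨rd, d + 1, Ctx.valid_mono (by omega) hd, by omega, rfl⟩, by omega, rfl⟩
  refine ⟨.seq p (.seq (.assign (d + 1) (.const 0)) (.loop (.sub (.var 3) (.var (d + 1)))
    (.seq q (.seq (.assign d (.var (d + 2)))
      (.assign (d + 1) (.add (.var (d + 1)) (.const 1))))))), c + (2 + (c' + 6 + 4 + 1 + 4)),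
    fun σ => ?_⟩
  obtain ⟨σ₁, m₁, h1, h2, h3, h4⟩ := hp σ
  let I : ℕ → State → Prop := fun i σ' => Agree d σ σ' ∧ σ'.reg (d + 1) = i ∧
    σ'.reg d = Nat.rec (motive := fun _ => ℕ) (f (rd σ)) (fun i a => h (rd σ) i a) i
  have hloop := exec_for (x := d + 1) (N := σ.reg 3) (c := polyBound (c' + 6) (σ.reg 3)) (I := I)
    (p := .seq q (.seq (.assign d (.var (d + 2)))
      (.assign (d + 1) (.add (.var (d + 1)) (.const 1))))) ?_ ?_
    (σ := σ₁.setReg (d + 1) 0) ?_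
  · obtain ⟨σ₂, m₂, h5, h6, h7, h8, h9⟩ := hloop
    refine ⟨_, _, Exec.seq h1 (Exec.seq (Exec.assign _ _ _) h5), ?_, h7, ?_⟩
    · refine (Nat.add_le_add h2 ?_).trans (polyBound_add_le _ _ _)
      refine (Nat.add_le_add (le_polyBound 2 _) ?_).trans (polyBound_add_le _ _ _)
      refine h6.trans ?_
      refine (Nat.add_le_add ?_ (le_polyBound 4 _)).trans (polyBound_add_le _ _ _)
      refine (Nat.mul_le_mul_left _ ?_).trans (mul_polyBound_le _ _)
      exact (Nat.add_le_add_left (le_polyBound 4 _) _).trans (polyBound_add_le _ _ _)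
    · rw [h9]
      simp [Ctx.base_eq hd, State.global]
  · rintro i σ' ⟨h5, h6, -⟩
    exact ⟨h6, h5.1 3 (by omega)⟩
  · rintro i hi σ' ⟨h5, h6, h7⟩
    obtain ⟨σ₂, m₂, h8, h9, h10, h11⟩ := hq σ'
    refine ⟨_, _, Exec.seq h8 (Exec.seq (Exec.assign _ _ _) (Exec.assign _ _ _)), ?_, ?_, ?_, ?_⟩
    · rw [h5.1 3 (by omega)] at h9
      exact (Nat.add_le_add h9 (le_polyBound 6 _)).trans (polyBound_add_le _ _ _)
    · exact ((h5.trans (h10.mono (by omega))).trans (Agree.setReg _ _ le_rfl)).trans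
        (Agree.setReg _ _ (by omega))
    · simp [Expr.eval, h10.1 (d + 1) (by omega), h6]
    · simp only [Expr.eval]
      rw [State.setReg_reg_of_ne _ _ (by omega), State.setReg_reg_self, h11, Ctx.agree hd h5, h6, h7]
  · refine ⟨h3.trans (Agree.setReg _ _ (by omega)), by simp, ?_⟩
    exact (State.setReg_reg_of_ne _ _ (by omega)).trans h4

theorem Comp.sum {h : Γ → ℕ → ℕ} (hh : Comp fun γ : Γ × ℕ => h γ.1 γ.2) :
    Comp fun γ => ∑ i ∈ range ((Ctx.base γ).reg 3), h γ i := by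
  refine Comp.congr (Comp.iterate (h := fun γ i a => a + h γ i) (Comp.const 0)
    (Comp.var.add hh.weaken)) fun γ => ?_
  induction (Ctx.base γ).reg 3 with
  | zero => rfl
  | succ n ih => rw [sum_range_succ, ← ih]

/-- By truncation, `1 - (f - g)` is the truth value of the comparison. The logical connectives and
`min` also rest on truncated subtraction. -/
theorem CompP.le (hf : Comp f) (hg : Comp g) : CompP fun γ => f γ ≤ g γ :=
  Comp.congr ((Comp.const 1).sub (hf.sub hg)) fun γ => by split_ifs <;> omega

theorem CompP.not (hP : CompP P) : CompP fun γ => ¬ P γ :=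
  Comp.congr ((Comp.const 1).sub hP) fun γ => by by_cases h : P γ <;> simp [h]

theorem CompP.lt (hf : Comp f) (hg : Comp g) : CompP fun γ => f γ < g γ :=
  (CompP.le hg hf).not.congr fun _ => not_le

theorem CompP.or (hP : CompP P) (hQ : CompP Q) : CompP fun γ => P γ ∨ Q γ :=
  Comp.congr ((Comp.const 1).sub ((Comp.const 1).sub (hP.add hQ))) fun γ => by
    by_cases h : P γ <;> by_cases h' : Q γ <;> simp [h, h']

theorem CompP.and (hP : CompP P) (hQ : CompP Q) : CompP fun γ => P γ ∧ Q γ :=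
  (hP.not.or hQ.not).not.congr fun _ => by tauto

theorem CompP.imp (hP : CompP P) (hQ : CompP Q) : CompP fun γ => P γ → Q γ :=
  (hP.not.or hQ).congr fun _ => by tauto

theorem CompP.eq (hf : Comp f) (hg : Comp g) : CompP fun γ => f γ = g γ :=
  ((CompP.le hf hg).and (CompP.le hg hf)).congr fun _ => le_antisymm_iff.symm

theorem CompP.ne (hf : Comp f) (hg : Comp g) : CompP fun γ => f γ ≠ g γ :=
  (CompP.eq hf hg).not

theorem Comp.min (hf : Comp f) (hg : Comp g) : Comp fun γ => min (f γ) (g γ) :=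
  (hf.sub (hf.sub hg)).congr fun γ => by omega

open scoped Classical in
theorem CompP.exists {P : Γ → ℕ → Prop} (hP : CompP fun γ : Γ × ℕ => P γ.1 γ.2) :
    CompP fun γ => ∃ i < (Ctx.base γ).reg 3, P γ i :=
  (CompP.lt (Comp.const 0) (Comp.sum (h := fun γ i => if P γ i then 1 else 0) hP)).congr
    fun γ => by simp [Finset.Nonempty]

theorem CompP.forall {P : Γ → ℕ → Prop} (hP : CompP fun γ : Γ × ℕ => P γ.1 γ.2) :
    CompP fun γ => ∀ i < (Ctx.base γ).reg 3, P γ i :=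
  (CompP.exists (P := fun γ i => ¬ P γ i) hP.not).not.congr fun γ => by push Not; rfl

/-- A function of a smaller context is a function of a larger one. -/
theorem Comp.lift {Δ : Type} [Ctx Δ] {F : Δ → ℕ} {φ : Γ → Δ} (hF : Comp F)
    (hφ : ∀ d rd, Ctx.Valid (Γ := Γ) d rd → Ctx.Valid d fun σ => φ (rd σ)) :
    Comp fun γ => F (φ γ) :=
  fun d rd hd => hF d _ (hφ d rd hd)

theorem valid_base {d : ℕ} {rd : State → Γ} (hd : Ctx.Valid d rd) :
    Ctx.Valid d fun σ => Ctx.base (rd σ) :=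
  ⟨Ctx.ten_le hd, funext (Ctx.base_eq hd)⟩

theorem valid_prodMap {Δ : Type} [Ctx Δ] {φ : Γ → Δ}
    (hφ : ∀ d rd, Ctx.Valid (Γ := Γ) d rd → Ctx.Valid d fun σ => φ (rd σ)) {d : ℕ}
    {rd : State → Γ × ℕ} (hd : Ctx.Valid d rd) : Ctx.Valid d fun σ => (φ (rd σ).1, (rd σ).2) := by
  obtain ⟨rd', r, h1, h2, rfl⟩ := hd
  exact ⟨_, r, hφ d rd' h1, h2, rfl⟩

/-- Both arguments are stored in local variables, and then all other variables are forgotten. So a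
function of the memory and of two numbers has to be implemented in a single context only. -/
theorem Comp.subst₂ {F : State → ℕ → ℕ → ℕ}
    (hF : Comp fun γ : (State × ℕ) × ℕ => F γ.1.1 γ.1.2 γ.2) {f g : Γ → ℕ} (hf : Comp f)
    (hg : Comp g) : Comp fun γ => F (Ctx.base γ) (f γ) (g γ) :=
  Comp.bind (h := fun γ : Γ × ℕ => F (Ctx.base γ.1) γ.2 (g γ.1)) hf <|
    Comp.bind (h := fun γ : (Γ × ℕ) × ℕ => F (Ctx.base γ.1.1) γ.1.2 γ.2) hg.weaken <|
      hF.lift (φ := fun γ : (Γ × ℕ) × ℕ => ((Ctx.base γ.1.1, γ.1.2), γ.2))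
        fun _ _ => valid_prodMap (φ := fun γ : Γ × ℕ => (Ctx.base γ.1, γ.2))
          fun _ _ => valid_prodMap fun _ _ => valid_base

end Closure

/-! ## Arithmetic with loops of a fixed length -/

/-- The product of `a` and `b`, if `a` is at most the length of the loops. -/
def loopMul (σ : State) (a b : ℕ) : ℕ :=
  ∑ i ∈ range (σ.reg 3), if i < a then b else 0

/-- The power `b ^ e`, if `b` and `e` are at most the length of the loops. -/
def loopPow (σ : State) (b e : ℕ) : ℕ :=
  Nat.rec (motive := fun _ => ℕ) 1 (fun i a => if i < e then loopMul σ b a else a) (σ.reg 3)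

/-- The quotient of `x` by `y ≠ 0`, if `x` is at most the length of the loops. -/
def loopDiv (σ : State) (x y : ℕ) : ℕ :=
  ∑ q ∈ range (σ.reg 3), if loopMul σ (q + 1) y ≤ x then 1 else 0

/-- The digit `i` of `w` in base `b`. -/
def loopDigit (σ : State) (b w i : ℕ) : ℕ :=
  loopDiv σ w (loopPow σ b i) - loopMul σ (loopDiv σ (loopDiv σ w (loopPow σ b i)) b) b

theorem sum_range_ite_lt {a R : ℕ} (h : a ≤ R) (b : ℕ) :
    ∑ i ∈ range R, (if i < a then b else 0) = a * b := by
  rw [← sum_filter, sum_const, smul_eq_mul]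
  congr 1
  rw [show {i ∈ range R | i < a} = range a by ext i; simp only [mem_filter, mem_range]; omega,
    card_range]

theorem loopMul_eq {σ : State} {a : ℕ} (h : a ≤ σ.reg 3) (b : ℕ) : loopMul σ a b = a * b :=
  sum_range_ite_lt h b

theorem loopPow_eq {σ : State} {b e : ℕ} (hb : b ≤ σ.reg 3) (he : e ≤ σ.reg 3) :
    loopPow σ b e = b ^ e := by
  have : ∀ n, Nat.rec (motive := fun _ => ℕ) 1
      (fun i a => if i < e then loopMul σ b a else a) n = b ^ min n e := by
    intro n
    induction n with
    | zero => simp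
    | succ n ih =>
      change (if n < e then loopMul σ b (Nat.rec (motive := fun _ => ℕ) 1
        (fun i a => if i < e then loopMul σ b a else a) n) else _) = _
      rw [ih, loopMul_eq hb]
      split_ifs with h
      · rw [min_eq_left (by omega), min_eq_left (by omega), pow_succ, mul_comm]
      · rw [min_eq_right (by omega), min_eq_right (by omega)]
  rw [loopPow, this, min_eq_right he]

/-- The numbers `q` with `(q + 1) * y ≤ x` are exactly those below `x / y`. The divisor may exceed
the length of the loops. -/
theorem loopDiv_eq {σ : State} {x y : ℕ} (hx : x ≤ σ.reg 3) (hy : 0 < y) :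
    loopDiv σ x y = x / y := by
  have h1 : x / y ≤ σ.reg 3 := (Nat.div_le_self x y).trans hx
  rw [loopDiv, ← mul_one (x / y), ← sum_range_ite_lt h1]
  refine sum_congr rfl fun q hq => ?_
  rw [mem_range] at hq
  rw [loopMul_eq (by omega)]
  refine if_congr ?_ rfl rfl
  rw [← Nat.succ_le_iff, Nat.le_div_iff_mul_le hy]

/-- The power `b ^ i` occurs only as a divisor, so it need not be bounded by the length of the
loops. -/
theorem loopDigit_eq {σ : State} {b w i : ℕ} (hw : w ≤ σ.reg 3) (hb : b ≤ σ.reg 3) (hb0 : 0 < b)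
    (hi : i ≤ σ.reg 3) : loopDigit σ b w i = w / b ^ i % b := by
  have h1 : w / b ^ i ≤ σ.reg 3 := (Nat.div_le_self _ _).trans hw
  have h2 : w / b ^ i / b ≤ σ.reg 3 := (Nat.div_le_self _ _).trans h1
  rw [loopDigit, loopPow_eq hb hi, loopDiv_eq hw (pow_pos hb0 i), loopDiv_eq h1 hb0, loopMul_eq h2]
  have := Nat.div_add_mod (w / b ^ i) b
  rw [mul_comm] at this
  omega

theorem exists_digits {b : ℕ} (n : ℕ) (c : ℕ → ℕ) (hc : ∀ i < n, c i < b) :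
    ∃ w < b ^ n, ∀ i < n, w / b ^ i % b = c i := by
  let f : Fin n → Fin b := fun i => ⟨c i, hc i i.2⟩
  refine ⟨finFunctionFinEquiv f, (finFunctionFinEquiv f).2, fun i hi => ?_⟩
  have := finFunctionFinEquiv_symm_apply_val (finFunctionFinEquiv f) ⟨i, hi⟩
  rw [Equiv.symm_apply_apply] at this
  exact this.symm

/-! ## The setting and the plans in the memory -/

/-- The modulator: the marked vertices. -/
def modulator (σ : State) : Finset ℕ :=
  {v ∈ range (σ.reg 3) | v < σ.reg 0 ∧ σ.arr 1 v ≠ 0}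

/-- The clique: the vertices that are not marked. -/
def unmarked (σ : State) : Finset ℕ :=
  {v ∈ range (σ.reg 3) | v < σ.reg 0 ∧ σ.arr 1 v = 0}

/-- Adjacency according to the matrix in array `0`. -/
def loopAdj (σ : State) (u v : ℕ) : Prop :=
  u < σ.reg 0 ∧ v < σ.reg 0 ∧ σ.arr 0 (loopMul σ u (σ.reg 0) + v) ≠ 0

/-- The setting in the memory. -/
def setting (σ : State) : Setting ℕ where
  X := modulator σ
  C := unmarked σ
  A := loopAdj σ
  s := σ.reg 1
  t := σ.reg 2
  rk v := #{u ∈ modulator σ | u < v}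
  k := σ.reg 4

/-- The entry number `q` for the vertex `v` in the plan with code `w`. -/
def planEntry (σ : State) (w v q : ℕ) : ℕ :=
  -- The position is `q + 5 * rk v`, written with additions only.
  loopDigit σ (σ.reg 5) w (q + ((setting σ).rk v + (setting σ).rk v + (setting σ).rk v +
    (setting σ).rk v + (setting σ).rk v))

/-- The plan with code `w`. -/
def plan (σ : State) (w : ℕ) : Plan ℕ where
  -- The source has time `0` under every code, so the condition `root` need not be tested.
  time v := if v = (setting σ).s then 0 else planEntry σ w v 0
  parent v := planEntry σ w v 1
  leaves v := planEntry σ w v 2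
  slotTime v := planEntry σ w v 3
  slotParent v := planEntry σ w v 4

/-! ### Computability of the setting and of the entries of a plan -/

section Closure

variable {Γ : Type} [Ctx Γ] {f g h : Γ → ℕ}

theorem Comp.loopMul (hf : Comp f) (hg : Comp g) :
    Comp fun γ => loopMul (Ctx.base γ) (f γ) (g γ) :=
  Comp.subst₂ (F := TelephoneBroadcast.loopMul)
    (Comp.sum (.ite (.lt .var .var2) .var1 (.const 0))) hf hg

theorem Comp.loopPow (hf : Comp f) (hg : Comp g) :
    Comp fun γ => loopPow (Ctx.base γ) (f γ) (g γ) :=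
  Comp.subst₂ (F := TelephoneBroadcast.loopPow)
    (Comp.iterate (.const 1) (.ite (.lt .var1 .var2) (.loopMul .var3 .var) .var)) hf hg

theorem Comp.loopDiv (hf : Comp f) (hg : Comp g) :
    Comp fun γ => loopDiv (Ctx.base γ) (f γ) (g γ) :=
  Comp.subst₂ (F := TelephoneBroadcast.loopDiv)
    (Comp.sum (.ite (.le (.loopMul (.add .var (.const 1)) .var1) .var2) (.const 1) (.const 0))) hf hg

theorem Comp.loopDigit (hf : Comp f) (hg : Comp g) (hh : Comp h) :
    Comp fun γ => loopDigit (Ctx.base γ) (f γ) (g γ) (h γ) :=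
  Comp.sub (.loopDiv hg (.loopPow hf hh))
    (.loopMul (.loopDiv (.loopDiv hg (.loopPow hf hh)) hf) hf)

theorem Comp.sum_modulator {h : Γ → ℕ → ℕ} (hh : Comp fun γ : Γ × ℕ => h γ.1 γ.2) :
    Comp fun γ => ∑ i ∈ modulator (Ctx.base γ), h γ i :=
  Comp.congr (f := fun γ => ∑ i ∈ range ((Ctx.base γ).reg 3),
      if i < (Ctx.base γ).reg 0 ∧ (Ctx.base γ).arr 1 i ≠ 0 then h γ i else 0)
    (Comp.sum (.ite (.and (.lt .var (.reg 0 (by omega))) (.ne (.get 1 .var) (.const 0)))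
      hh (.const 0))) fun γ => by rw [modulator, sum_filter]

theorem Comp.sum_unmarked {h : Γ → ℕ → ℕ} (hh : Comp fun γ : Γ × ℕ => h γ.1 γ.2) :
    Comp fun γ => ∑ i ∈ unmarked (Ctx.base γ), h γ i :=
  Comp.congr (f := fun γ => ∑ i ∈ range ((Ctx.base γ).reg 3),
      if i < (Ctx.base γ).reg 0 ∧ (Ctx.base γ).arr 1 i = 0 then h γ i else 0)
    (Comp.sum (.ite (.and (.lt .var (.reg 0 (by omega))) (.eq (.get 1 .var) (.const 0)))
      hh (.const 0))) fun γ => by rw [unmarked, sum_filter]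

theorem Comp.card_X {P : Γ → ℕ → Prop} {_ : ∀ γ, DecidablePred (P γ)}
    (hP : CompP fun γ : Γ × ℕ => P γ.1 γ.2) :
    Comp fun γ => #{i ∈ (setting (Ctx.base γ)).X | P γ i} :=
  Comp.congr (Comp.sum_modulator (h := fun γ i => if P γ i then 1 else 0)
    (.ite hP (.const 1) (.const 0))) fun γ => by rw [card_filter]; rfl

theorem Comp.card_C {P : Γ → ℕ → Prop} {_ : ∀ γ, DecidablePred (P γ)}
    (hP : CompP fun γ : Γ × ℕ => P γ.1 γ.2) :
    Comp fun γ => #{i ∈ (setting (Ctx.base γ)).C | P γ i} :=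
  Comp.congr (Comp.sum_unmarked (h := fun γ i => if P γ i then 1 else 0)
    (.ite hP (.const 1) (.const 0))) fun γ => by rw [card_filter]; rfl

open scoped Classical in
theorem CompP.exists_X {P : Γ → ℕ → Prop} (hP : CompP fun γ : Γ × ℕ => P γ.1 γ.2) :
    CompP fun γ => ∃ i ∈ (setting (Ctx.base γ)).X, P γ i :=
  CompP.congr (CompP.lt (g := fun γ => #{i ∈ (setting (Ctx.base γ)).X | P γ i}) (.const 0)
    (.card_X hP)) fun γ => by simp [card_pos, Finset.Nonempty]

theorem CompP.forall_X {P : Γ → ℕ → Prop} (hP : CompP fun γ : Γ × ℕ => P γ.1 γ.2) :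
    CompP fun γ => ∀ i ∈ (setting (Ctx.base γ)).X, P γ i :=
  CompP.congr (CompP.exists_X (P := fun γ i => ¬ P γ i) hP.not).not fun γ => by push Not; rfl

theorem CompP.settingA (hf : Comp f) (hg : Comp g) :
    CompP fun γ => (setting (Ctx.base γ)).A (f γ) (g γ) :=
  CompP.and (.lt hf (.reg 0 (by omega))) <| .and (.lt hg (.reg 0 (by omega))) <|
    .ne (.get 0 (.add (.loopMul hf (.reg 0 (by omega))) hg)) (.const 0)

theorem Comp.sizeC : Comp fun γ : Γ => #(setting (Ctx.base γ)).C :=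
  Comp.congr (Comp.sum_unmarked (h := fun _ _ => 1) (.const 1)) fun γ => by simp; rfl

theorem Comp.settingS : Comp fun γ : Γ => (setting (Ctx.base γ)).s := Comp.reg 1 (by omega)

theorem Comp.settingT : Comp fun γ : Γ => (setting (Ctx.base γ)).t := Comp.reg 2 (by omega)

theorem Comp.settingK : Comp fun γ : Γ => (setting (Ctx.base γ)).k := Comp.reg 4 (by omega)

theorem Comp.settingRk (hf : Comp f) : Comp fun γ : Γ => (setting (Ctx.base γ)).rk (f γ) :=
  Comp.card_X (.lt .var hf.weaken)

theorem Comp.planEntry (q : ℕ) (hf : Comp f) (hg : Comp g) :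
    Comp fun γ => planEntry (Ctx.base γ) (f γ) (g γ) q :=
  Comp.loopDigit (.reg 5 (by omega)) hf (.add (.const q) (.add (.add (.add (.add
    (.settingRk hg) (.settingRk hg)) (.settingRk hg)) (.settingRk hg)) (.settingRk hg)))

theorem Comp.time (hf : Comp f) (hg : Comp g) :
    Comp fun γ => (plan (Ctx.base γ) (f γ)).time (g γ) :=
  Comp.ite (.eq hg .settingS) (.const 0) (.planEntry 0 hf hg)

theorem Comp.parent (hf : Comp f) (hg : Comp g) :
    Comp fun γ => (plan (Ctx.base γ) (f γ)).parent (g γ) := .planEntry 1 hf hg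

theorem Comp.leaves (hf : Comp f) (hg : Comp g) :
    Comp fun γ => (plan (Ctx.base γ) (f γ)).leaves (g γ) := .planEntry 2 hf hg

theorem Comp.slotTime (hf : Comp f) (hg : Comp g) :
    Comp fun γ => (plan (Ctx.base γ) (f γ)).slotTime (g γ) := .planEntry 3 hf hg

theorem Comp.slotParent (hf : Comp f) (hg : Comp g) :
    Comp fun γ => (plan (Ctx.base γ) (f γ)).slotParent (g γ) := .planEntry 4 hf hg

theorem Comp.busy (hf : Comp f) (hg : Comp g) :
    Comp fun γ => (plan (Ctx.base γ) (f γ)).busy (setting (Ctx.base γ)) (g γ) :=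
  Comp.card_X (.and (.ne .var .settingS) <| .and (.le .settingK (.parent hf.weaken .var))
    (.eq (.time hf.weaken .var) hg.weaken))

theorem Comp.pending (hf : Comp f) (hg : Comp g) :
    Comp fun γ => (plan (Ctx.base γ) (f γ)).pending (setting (Ctx.base γ)) (g γ) :=
  Comp.card_X (.and (.le .settingK (.slotParent hf.weaken .var))
    (.eq (.slotTime hf.weaken .var) hg.weaken))

theorem CompP.idle (hf : Comp f) (hg : Comp g) (hh : Comp h) :
    CompP fun γ => (plan (Ctx.base γ) (f γ)).Idle (setting (Ctx.base γ)) (g γ) (h γ) :=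
  CompP.and (.lt (.time hf hg) hh) <| .and
    (.forall_X (.imp (.ne .var .settingS) <| .imp
      (.eq (.parent hf.weaken .var) (.settingRk hg.weaken)) (.ne (.time hf.weaken .var) hh.weaken)))
    (.forall_X (.imp (.eq (.slotParent hf.weaken .var) (.settingRk hg.weaken))
      (.ne (.slotTime hf.weaken .var) hh.weaken)))

theorem CompP.fits (hf : Comp f) (hg : Comp g) (hh : Comp h) :
    CompP fun γ => (plan (Ctx.base γ) (f γ)).Fits (setting (Ctx.base γ)) (g γ) (h γ) :=
  CompP.and
    (.forall_X (.imp (.ne .var .settingS) <| .imp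
      (.eq (.parent hf.weaken .var) (.add .settingK (.settingRk hg.weaken)))
        (.settingA hh.weaken .var)))
    (.forall_X (.imp (.eq (.slotParent hf.weaken hg.weaken) (.settingRk .var))
      (.settingA .var hh.weaken)))

theorem Comp.free (hf : Comp f) :
    Comp fun γ => (plan (Ctx.base γ) (f γ)).free (setting (Ctx.base γ)) :=
  Comp.sub (.sub .sizeC (.card_X (.le (.slotTime hf.weaken .var) .settingT)))
    (.sum_modulator (.leaves hf.weaken .var))

end Closure

/-! ## The test of a plan -/

open scoped Classical in
/-- The number of rounds up to `r` in which `i` is idle. -/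
noncomputable def loopIdleCount (σ : State) (w i r : ℕ) : ℕ :=
  ∑ r' ∈ range (σ.reg 3), if r' < r + 1 ∧ (plan σ w).Idle (setting σ) i r' then 1 else 0

open scoped Classical in
/-- The number of slots and leaves that are informed by round `r`. -/
noncomputable def loopFixed (σ : State) (w r : ℕ) : ℕ :=
  #{j ∈ (setting σ).X | (plan σ w).slotTime j ≤ r} +
    ∑ i ∈ modulator σ, min ((plan σ w).leaves i) (loopIdleCount σ w i r)

/-- The number of free vertices that are informed by round `r`. -/
noncomputable def loopInformed (σ : State) (w r : ℕ) : ℕ :=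
  -- The value is frozen after `r` rounds, so the loop can run for its full length.
  Nat.rec (motive := fun _ => ℕ) 0 (fun j a => if j < r then min ((plan σ w).free (setting σ))
    (a + (a + loopFixed σ w j - (plan σ w).busy (setting σ) (j + 1) -
      (plan σ w).pending (setting σ) (j + 1))) else a) (σ.reg 3)

/-- Bit number `rk i` of `z` is set. -/
def loopBit (σ : State) (z i : ℕ) : Prop := loopDigit σ 2 z ((setting σ).rk i) ≠ 0

open scoped Classical in
/-- The condition of Hall, with sets given by numbers. -/
noncomputable def loopHall (σ : State) (w : ℕ) : Prop :=
  ∀ y < σ.reg 3, ∀ z < σ.reg 3,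
    (∑ i ∈ modulator σ, if loopBit σ y i then (plan σ w).leaves i else 0) +
      #{j ∈ (setting σ).X | loopBit σ z j ∧ (plan σ w).slotTime j ≤ (setting σ).t} ≤
    #{v ∈ (setting σ).C | (∃ i ∈ (setting σ).X, loopBit σ y i ∧ (setting σ).A i v) ∨
      ∃ j ∈ (setting σ).X, loopBit σ z j ∧ (plan σ w).slotTime j ≤ (setting σ).t ∧
        (plan σ w).Fits (setting σ) j v}

/-- The conditions on the times and the callers in the modulator. -/
def loopTimes (σ : State) (w : ℕ) : Prop :=
  (∀ i ∈ (setting σ).X, i ≠ (setting σ).s → (plan σ w).time i ≤ (setting σ).t) ∧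
  (∀ i ∈ (setting σ).X, i ≠ (setting σ).s →
    (∃ j ∈ (setting σ).X, (plan σ w).parent i = (setting σ).rk j ∧ (setting σ).A j i ∧
      (plan σ w).time j < (plan σ w).time i) ∨
    (∃ j ∈ (setting σ).X, (plan σ w).parent i = (setting σ).k + (setting σ).rk j ∧
      (plan σ w).slotTime j < (plan σ w).time i)) ∧
  (∀ j ∈ (setting σ).X, 1 ≤ (plan σ w).slotTime j) ∧
  (∀ j ∈ (setting σ).X, (plan σ w).slotTime j ≤ (setting σ).t → ∀ a ∈ (setting σ).X,
    (plan σ w).slotParent j = (setting σ).rk a → (plan σ w).time a < (plan σ w).slotTime j)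

/-- The condition that nobody calls two vertices in the same round. -/
def loopInj (σ : State) (w : ℕ) : Prop :=
  (∀ i ∈ (setting σ).X, ∀ i' ∈ (setting σ).X, i ≠ (setting σ).s → i' ≠ (setting σ).s →
    (plan σ w).parent i = (plan σ w).parent i' → (plan σ w).time i = (plan σ w).time i' →
    i = i') ∧
  (∀ j ∈ (setting σ).X, ∀ j' ∈ (setting σ).X, (plan σ w).slotTime j ≤ (setting σ).t →
    (plan σ w).slotTime j' ≤ (setting σ).t → (plan σ w).slotParent j < (setting σ).k →
    (plan σ w).slotParent j = (plan σ w).slotParent j' →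
    (plan σ w).slotTime j = (plan σ w).slotTime j' → j = j') ∧
  (∀ i ∈ (setting σ).X, i ≠ (setting σ).s → ∀ j ∈ (setting σ).X,
    (plan σ w).slotTime j ≤ (setting σ).t → (plan σ w).parent i < (setting σ).k →
    (plan σ w).parent i = (plan σ w).slotParent j →
    (plan σ w).time i ≠ (plan σ w).slotTime j)

/-- The conditions on the number of informed vertices in each round. -/
def loopCount (σ : State) (w : ℕ) : Prop :=
  (∀ r < σ.reg 3, r < (setting σ).t → (plan σ w).busy (setting σ) (r + 1) +
    (plan σ w).pending (setting σ) (r + 1) ≤ loopInformed σ w r + loopFixed σ w r) ∧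
  (plan σ w).free (setting σ) ≤ loopInformed σ w (setting σ).t ∧
  ∀ i ∈ (setting σ).X, (plan σ w).leaves i ≤ loopIdleCount σ w i (setting σ).t

/-- The test whether the plan with code `w` is valid. -/
def loopValid (σ : State) (w : ℕ) : Prop :=
  loopTimes σ w ∧ loopInj σ w ∧ loopHall σ w ∧ loopCount σ w

/-! ### Computability of the test -/

section Closure

variable {Γ : Type} [Ctx Γ] {f g h : Γ → ℕ}

theorem Comp.loopIdleCount (hf : Comp f) (hg : Comp g) (hh : Comp h) :
    Comp fun γ => loopIdleCount (Ctx.base γ) (f γ) (g γ) (h γ) :=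
  Comp.sum (.ite (.and (.lt .var (.add hh.weaken (.const 1))) (.idle hf.weaken hg.weaken .var))
    (.const 1) (.const 0))

theorem Comp.loopFixed (hf : Comp f) (hg : Comp g) :
    Comp fun γ => loopFixed (Ctx.base γ) (f γ) (g γ) :=
  Comp.add (.card_X (.le (.slotTime hf.weaken .var) hg.weaken)) (.sum_modulator
    (.min (.leaves hf.weaken .var) (.loopIdleCount hf.weaken .var hg.weaken)))

theorem Comp.loopInformed (hf : Comp f) (hg : Comp g) :
    Comp fun γ => loopInformed (Ctx.base γ) (f γ) (g γ) :=
  Comp.iterate (.const 0) (.ite (.lt .var1 hg.weaken.weaken) (.min (.free hf.weaken.weaken)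
    (.add .var (.sub (.sub (.add .var (.loopFixed hf.weaken.weaken .var1))
      (.busy hf.weaken.weaken (.add .var1 (.const 1))))
      (.pending hf.weaken.weaken (.add .var1 (.const 1)))))) .var)

theorem CompP.loopBit (hf : Comp f) (hg : Comp g) :
    CompP fun γ => loopBit (Ctx.base γ) (f γ) (g γ) :=
  CompP.ne (.loopDigit (.const 2) hf (.settingRk hg)) (.const 0)

theorem CompP.loopHall (hf : Comp f) : CompP fun γ => loopHall (Ctx.base γ) (f γ) := by
  refine CompP.forall <| CompP.forall <| CompP.le (.add (.sum_modulator (.ite (.loopBit .var2 .var)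
    (.leaves hf.weaken.weaken.weaken .var) (.const 0)))
    (.card_X (.and (.loopBit .var1 .var) (.le (.slotTime hf.weaken.weaken.weaken .var) .settingT))))
    (.card_C (.or (.exists_X (.and (.loopBit .var3 .var) (.settingA .var .var1)))
      (.exists_X (.and (.loopBit .var2 .var) (.and
        (.le (.slotTime hf.weaken.weaken.weaken.weaken .var) .settingT)
        (.fits hf.weaken.weaken.weaken.weaken .var .var1))))))

theorem CompP.loopTimes (hf : Comp f) : CompP fun γ => loopTimes (Ctx.base γ) (f γ) :=
  have hf1 := hf.weaken
  have hf2 := hf1.weaken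
  .and (.forall_X (.imp (.ne .var .settingS) (.le (.time hf1 .var) .settingT))) <|
  .and (.forall_X (.imp (.ne .var .settingS) (.or
    (.exists_X (.and (.eq (.parent hf2 .var1) (.settingRk .var)) (.and (.settingA .var .var1)
      (.lt (.time hf2 .var) (.time hf2 .var1)))))
    (.exists_X (.and (.eq (.parent hf2 .var1) (.add .settingK (.settingRk .var)))
      (.lt (.slotTime hf2 .var) (.time hf2 .var1))))))) <|
  .and (.forall_X (.le (.const 1) (.slotTime hf1 .var)))
    (.forall_X (.imp (.le (.slotTime hf1 .var) .settingT) (.forall_X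
      (.imp (.eq (.slotParent hf2 .var1) (.settingRk .var))
        (.lt (.time hf2 .var) (.slotTime hf2 .var1))))))

theorem CompP.loopInj (hf : Comp f) : CompP fun γ => loopInj (Ctx.base γ) (f γ) :=
  have hf1 := hf.weaken
  have hf2 := hf1.weaken
  .and (.forall_X (.forall_X (.imp (.ne .var1 .settingS) (.imp (.ne .var .settingS)
    (.imp (.eq (.parent hf2 .var1) (.parent hf2 .var)) (.imp
      (.eq (.time hf2 .var1) (.time hf2 .var)) (.eq .var1 .var))))))) <|
  .and (.forall_X (.forall_X (.imp (.le (.slotTime hf2 .var1) .settingT)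
    (.imp (.le (.slotTime hf2 .var) .settingT) (.imp (.lt (.slotParent hf2 .var1) .settingK)
      (.imp (.eq (.slotParent hf2 .var1) (.slotParent hf2 .var))
        (.imp (.eq (.slotTime hf2 .var1) (.slotTime hf2 .var)) (.eq .var1 .var)))))))) <|
  .forall_X (.imp (.ne .var .settingS) (.forall_X (.imp (.le (.slotTime hf2 .var) .settingT)
    (.imp (.lt (.parent hf2 .var1) .settingK) (.imp (.eq (.parent hf2 .var1) (.slotParent hf2 .var))
      (.ne (.time hf2 .var1) (.slotTime hf2 .var)))))))

theorem CompP.loopCount (hf : Comp f) : CompP fun γ => loopCount (Ctx.base γ) (f γ) :=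
  have hf1 := hf.weaken
  .and (.forall (.imp (.lt .var .settingT) (.le (.add (.busy hf1 (.add .var (.const 1)))
    (.pending hf1 (.add .var (.const 1)))) (.add (.loopInformed hf1 .var) (.loopFixed hf1 .var))))) <|
  .and (.le (.free hf) (.loopInformed hf .settingT))
    (.forall_X (.le (.leaves hf1 .var) (.loopIdleCount hf1 .var .settingT)))

theorem CompP.loopValid (hf : Comp f) : CompP fun γ => loopValid (Ctx.base γ) (f γ) :=
  .and (.loopTimes hf) <| .and (.loopInj hf) <| .and (.loopHall hf) (.loopCount hf)

end Closure

/-! ## Correctness of the test -/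

theorem card_filter_lt_lt {X : Finset ℕ} {v : ℕ} (hv : v ∈ X) : #{u ∈ X | u < v} < #X :=
  card_lt_card (filter_ssubset.2 ⟨v, hv, lt_irrefl v⟩)

theorem card_filter_lt_inj {X : Finset ℕ} {v w : ℕ} (hv : v ∈ X) (hw : w ∈ X)
    (h : #{u ∈ X | u < v} = #{u ∈ X | u < w}) : v = w := by
  have key : ∀ {v w : ℕ}, v ∈ X → v < w → #{u ∈ X | u < v} < #{u ∈ X | u < w} := by
    intro v w hv hvw
    refine card_lt_card (ssubset_iff_of_subset ?_ |>.2 ⟨v, by simp [hv, hvw], by simp⟩)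
    exact monotone_filter_right _ fun u _ hu => lt_trans hu hvw
  rcases lt_trichotomy v w with hlt | rfl | hlt
  · exact absurd h (key hv hlt).ne
  · rfl
  · exact absurd h (key hw hlt).ne'

/-- The rank is an injection of `X` into `range #X`, hence onto. -/
theorem exists_card_filter_lt_eq {X : Finset ℕ} {r : ℕ} (hr : r < #X) :
    ∃ v ∈ X, #{u ∈ X | u < v} = r := by
  have h : X.image (fun v => #{u ∈ X | u < v}) = range #X := by
    refine eq_of_subset_of_card_le ?_ ?_
    · intro x hx
      obtain ⟨v, hv, rfl⟩ := mem_image.1 hx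
      exact mem_range.2 (card_filter_lt_lt hv)
    · rw [card_range, card_image_of_injOn]
      exact fun v hv w hw e => card_filter_lt_inj hv hw e
  have := mem_range.2 hr
  rw [← h] at this
  exact mem_image.1 this

/-- The loops are long enough for the setting in the memory. -/
structure Ready (σ : State) : Prop where
  rounds_lt : σ.reg 2 < σ.reg 3
  card_eq : σ.reg 4 = #(modulator σ)
  card_le : 5 * σ.reg 4 + 5 ≤ σ.reg 3
  two_pow_le : 2 ^ σ.reg 4 ≤ σ.reg 3
  base_le : σ.reg 5 ≤ σ.reg 3
  -- The entries of a plan that comes from a schedule are digits in this base; by the next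
  -- condition, all codes with `5 * k` digits are within the range of the loops.
  le_base : 2 * σ.reg 4 + σ.reg 2 + 2 ≤ σ.reg 5
  base_pow_le : σ.reg 5 ^ (5 * σ.reg 4) ≤ σ.reg 3

theorem good_setting {σ : State} (h : σ.reg 4 = #(modulator σ)) (hs : σ.reg 1 ∈ modulator σ)
    (hclq : ∀ u ∈ unmarked σ, ∀ v ∈ unmarked σ, u ≠ v → loopAdj σ u v) : (setting σ).Good where
  source_mem := hs
  disj := by
    rw [disjoint_left]
    intro v hv hv'
    simp only [setting, modulator, unmarked, mem_filter] at hv hv'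
    exact hv.2.2 hv'.2.2
  clique := hclq
  rk_lt i hi := by
    change #{u ∈ modulator σ | u < i} < σ.reg 4
    rw [h]
    exact card_filter_lt_lt hi
  rk_inj i hi j hj e := card_filter_lt_inj hi hj e
  rk_surj r hr := by
    change r < σ.reg 4 at hr
    rw [h] at hr
    exact exists_card_filter_lt_eq hr

theorem loopIdleCount_eq {σ : State} {w i r : ℕ} (hr : r < σ.reg 3) :
    loopIdleCount σ w i r = (plan σ w).idleCount (setting σ) i r := by
  classical
  rw [loopIdleCount, Plan.idleCount, Nat.count_eq_card_filter_range, card_filter]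
  rw [← sum_subset (range_subset_range.2 (show r + 1 ≤ σ.reg 3 from hr))]
  · refine sum_congr rfl fun r' hr' => ?_
    simp [mem_range.1 hr']
  · intro r' _ hr'
    rw [mem_range] at hr'
    simp [hr']

theorem loopFixed_eq {σ : State} {w r : ℕ} (hr : r < σ.reg 3) :
    loopFixed σ w r = (plan σ w).fixed (setting σ) r := by
  rw [loopFixed, Plan.fixed]
  congr 1
  exact sum_congr rfl fun i _ => by rw [loopIdleCount_eq hr]

theorem loopInformed_eq {σ : State} {w r : ℕ} (hr : r ≤ σ.reg 3) :
    loopInformed σ w r = (plan σ w).informed (setting σ) r := by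
  rw [loopInformed]
  have : ∀ n ≤ σ.reg 3, Nat.rec (motive := fun _ => ℕ) 0 (fun j a => if j < r then
      min ((plan σ w).free (setting σ)) (a + (a + loopFixed σ w j -
      (plan σ w).busy (setting σ) (j + 1) - (plan σ w).pending (setting σ) (j + 1))) else a) n =
      (plan σ w).informed (setting σ) (min n r) := by
    intro n
    induction n with
    | zero => intro _; simp [Plan.informed]
    | succ n ih =>
      intro hn
      have ih := ih (by omega)
      dsimp only at ih ⊢
      rw [ih]
      split_ifs with h
      · rw [loopFixed_eq (by omega), min_eq_left (show n ≤ r by omega),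
          min_eq_left (show n + 1 ≤ r by omega)]
        rfl
      · rw [min_eq_right (by omega), min_eq_right (by omega)]
  rw [this _ le_rfl, min_eq_right hr]

/-- The loops have length at least `2 ^ k`, so the binary numbers below it encode all subsets of the
modulator. Two nested loops thus run through all pairs of subsets in Hall's condition. -/
theorem exists_loopBit {σ : State} (hσ : Ready σ) (hS : (setting σ).Good) (Y : Finset ℕ) :
    ∃ y < σ.reg 3, ∀ i ∈ (setting σ).X, loopBit σ y i ↔ i ∈ Y := by
  classical
  obtain ⟨y, hy, hd⟩ := exists_digits (b := 2) (σ.reg 4)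
    (fun r => if ∃ i ∈ Y, i ∈ (setting σ).X ∧ (setting σ).rk i = r then 1 else 0)
    (fun r _ => by split_ifs <;> omega)
  have hy' := hy.trans_le hσ.two_pow_le
  refine ⟨y, hy', fun i hi => ?_⟩
  have h1 : (setting σ).rk i < σ.reg 4 := hS.rk_lt i hi
  have h2 := hσ.card_le
  rw [loopBit, loopDigit_eq hy'.le (by omega) two_pos (by omega), hd _ h1]
  constructor
  · intro h
    split_ifs at h with h'
    · obtain ⟨j, hj, hjX, e⟩ := h'
      rwa [← hS.rk_inj j hjX i hi e]
    · exact absurd rfl h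
  · intro h
    rw [if_pos ⟨i, h, hi, rfl⟩]
    exact one_ne_zero

open scoped Classical in
theorem loopHall_iff {σ : State} (hσ : Ready σ) (hS : (setting σ).Good) (w : ℕ) :
    loopHall σ w ↔ ∀ Y ⊆ (setting σ).X, ∀ Z ⊆ (setting σ).X,
      ∑ i ∈ Y, (plan σ w).leaves i + #{j ∈ Z | (plan σ w).slotTime j ≤ (setting σ).t} ≤
      #{v ∈ (setting σ).C | (∃ i ∈ Y, (setting σ).A i v) ∨
        ∃ j ∈ Z, (plan σ w).slotTime j ≤ (setting σ).t ∧ (plan σ w).Fits (setting σ) j v} := by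
  have key : ∀ (y z : ℕ) (Y Z : Finset ℕ), Y = {i ∈ (setting σ).X | loopBit σ y i} →
      Z = {i ∈ (setting σ).X | loopBit σ z i} →
      (((∑ i ∈ modulator σ, if loopBit σ y i then (plan σ w).leaves i else 0) +
        #{j ∈ (setting σ).X | loopBit σ z j ∧ (plan σ w).slotTime j ≤ (setting σ).t} ≤
      #{v ∈ (setting σ).C | (∃ i ∈ (setting σ).X, loopBit σ y i ∧ (setting σ).A i v) ∨
        ∃ j ∈ (setting σ).X, loopBit σ z j ∧ (plan σ w).slotTime j ≤ (setting σ).t ∧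
          (plan σ w).Fits (setting σ) j v}) ↔
      ∑ i ∈ Y, (plan σ w).leaves i + #{j ∈ Z | (plan σ w).slotTime j ≤ (setting σ).t} ≤
      #{v ∈ (setting σ).C | (∃ i ∈ Y, (setting σ).A i v) ∨
        ∃ j ∈ Z, (plan σ w).slotTime j ≤ (setting σ).t ∧ (plan σ w).Fits (setting σ) j v}) := by
    rintro y z _ _ rfl rfl
    rw [sum_filter, filter_filter]
    simp only [mem_filter, and_assoc]
    rfl
  constructor
  · intro h Y hY Z hZ
    obtain ⟨y, hy, hyY⟩ := exists_loopBit hσ hS Y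
    obtain ⟨z, hz, hzZ⟩ := exists_loopBit hσ hS Z
    refine (key y z Y Z ?_ ?_).1 (h y hy z hz)
    · rw [filter_congr hyY, filter_mem_eq_inter, inter_eq_right.2 hY]
    · rw [filter_congr hzZ, filter_mem_eq_inter, inter_eq_right.2 hZ]
  · intro h y _ z _
    exact (key y z _ _ rfl rfl).2 (h _ (filter_subset _ _) _ (filter_subset _ _))

theorem loopValid_iff {σ : State} (hσ : Ready σ) (hS : (setting σ).Good) (w : ℕ) :
    loopValid σ w ↔ (plan σ w).Valid (setting σ) := by
  have ht : (setting σ).t < σ.reg 3 := hσ.rounds_lt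
  have hcount : loopCount σ w ↔
      (∀ r < (setting σ).t, (plan σ w).busy (setting σ) (r + 1) +
        (plan σ w).pending (setting σ) (r + 1) ≤
          (plan σ w).informed (setting σ) r + (plan σ w).fixed (setting σ) r) ∧
      (plan σ w).free (setting σ) ≤ (plan σ w).informed (setting σ) (setting σ).t ∧
      ∀ i ∈ (setting σ).X, (plan σ w).leaves i ≤
        (plan σ w).idleCount (setting σ) i (setting σ).t := by
    rw [loopCount, loopInformed_eq ht.le]
    simp only [loopIdleCount_eq ht]
    refine and_congr_left fun _ => ⟨fun h r hr => ?_, fun h r hr hrt => ?_⟩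
    · have := h r (hr.trans ht) hr
      rwa [loopInformed_eq (hr.trans ht).le, loopFixed_eq (hr.trans ht)] at this
    · rw [loopInformed_eq hr.le, loopFixed_eq hr]
      exact h r hrt
  rw [loopValid, hcount, loopHall_iff hσ hS]
  constructor
  · rintro ⟨⟨h1, h2, h3, h4⟩, ⟨h5, h6, h7⟩, h8, h9, h10, h11⟩
    exact ⟨by simp [plan], h1, h2, h3, h4, h5, h6, h7, h8, h9, h10, h11⟩
  · rintro ⟨-, h1, h2, h3, h4, h5, h6, h7, h8, h9, h10, h11⟩
    exact ⟨⟨h1, h2, h3, h4⟩, ⟨h5, h6, h7⟩, h8, h9, h10, h11⟩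

/-- Validity depends only on the entries of a plan for the vertices of the modulator. -/
theorem Plan.Valid.of_eqOn {V : Type*} {S : Setting V} (hs : S.s ∈ S.X) {π π' : Plan V}
    (h : π.Valid S) (h1 : ∀ i ∈ S.X, π'.time i = π.time i)
    (h2 : ∀ i ∈ S.X, π'.parent i = π.parent i) (h3 : ∀ i ∈ S.X, π'.leaves i = π.leaves i)
    (h4 : ∀ i ∈ S.X, π'.slotTime i = π.slotTime i)
    (h5 : ∀ i ∈ S.X, π'.slotParent i = π.slotParent i) : π'.Valid S := by
  classical
  have hbusy : π'.busy S = π.busy S := by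
    funext r
    rw [busy, busy]
    congr 1
    exact filter_congr fun i hi => by rw [h1 i hi, h2 i hi]
  have hpend : π'.pending S = π.pending S := by
    funext r
    rw [pending, pending]
    congr 1
    exact filter_congr fun i hi => by rw [h4 i hi, h5 i hi]
  have hidle : ∀ i ∈ S.X, π'.Idle S i = π.Idle S i := by
    intro i hi
    funext r
    rw [Idle, Idle, h1 i hi, eq_iff_iff]
    refine and_congr_right fun _ => and_congr (forall₂_congr fun j hj => ?_)
      (forall₂_congr fun j hj => ?_)
    · rw [h1 j hj, h2 j hj]
    · rw [h4 j hj, h5 j hj]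
  have hcount : ∀ i ∈ S.X, π'.idleCount S i = π.idleCount S i := by
    intro i hi
    funext r
    rw [idleCount, idleCount]
    simp only [hidle i hi]
  have hused : ∀ r, #{j ∈ S.X | π'.slotTime j ≤ r} = #{j ∈ S.X | π.slotTime j ≤ r} := fun r => by
    congr 1
    exact filter_congr fun i hi => by rw [h4 i hi]
  have hfixed : π'.fixed S = π.fixed S := by
    funext r
    rw [fixed, fixed, hused]
    congr 1
    exact sum_congr rfl fun i hi => by rw [h3 i hi, hcount i hi]
  have hfree : π'.free S = π.free S := by
    rw [free, free, hused]
    congr 1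
    exact sum_congr rfl h3
  have hinf : π'.informed S = π.informed S := by
    funext r
    induction r with
    | zero => rfl
    | succ r ih => rw [informed, informed, ih, hfixed, hbusy, hpend, hfree]
  have hfits : ∀ j ∈ S.X, ∀ v, π'.Fits S j v ↔ π.Fits S j v := by
    intro j hj v
    rw [Fits, Fits, h5 j hj]
    exact and_congr_left fun _ => forall₂_congr fun i hi => by rw [h2 i hi]
  constructor
  · rw [h1 _ hs]; exact h.root
  · intro i hi his
    rw [h1 i hi]; exact h.time_le i hi his
  · intro i hi his
    rw [h1 i hi, h2 i hi]
    rcases h.parent i hi his with ⟨j, hj, h⟩ | ⟨j, hj, h⟩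
    · exact Or.inl ⟨j, hj, by rwa [h1 j hj]⟩
    · exact Or.inr ⟨j, hj, by rwa [h4 j hj]⟩
  · intro j hj
    rw [h4 j hj]; exact h.slot_pos j hj
  · intro j hj hjt a ha
    rw [h4 j hj] at hjt ⊢
    rw [h5 j hj, h1 a ha]
    exact h.slot_parent j hj hjt a ha
  · intro i hi j hj
    rw [h1 i hi, h1 j hj, h2 i hi, h2 j hj]
    exact h.inj i hi j hj
  · intro i hi j hj
    rw [h4 i hi, h4 j hj, h5 i hi, h5 j hj]
    exact h.slot_inj i hi j hj
  · intro i hi his j hj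
    rw [h4 j hj, h5 j hj, h1 i hi, h2 i hi]
    exact h.mixed i hi his j hj
  · intro Y hY Z hZ
    convert h.hall Y hY Z hZ using 2
    · exact sum_congr rfl fun i hi => h3 i (hY hi)
    · congr 1
      exact filter_congr fun j hj => by rw [h4 j (hZ hj)]
    · refine filter_congr fun v _ => or_congr_right (exists_congr fun j => ?_)
      exact and_congr_right fun hj => by rw [h4 j (hZ hj), hfits j (hZ hj)]
  · rw [hbusy, hpend, hinf, hfixed]
    exact h.room
  · rw [hfree, hinf]
    exact h.final
  · intro i hi
    rw [h3 i hi, hcount i hi]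
    exact h.leaves_le i hi

/-- The plan of a schedule has small entries, hence a code in the range of the loops. The decoded
plan agrees with it only on the modulator, which suffices by `Plan.Valid.of_eqOn`. -/
theorem exists_loopValid_iff {σ : State} (hσ : Ready σ) (hS : (setting σ).Good) :
    (∃ w < σ.reg 3, loopValid σ w) ↔
      HasSchedule ((setting σ).X ∪ (setting σ).C) (setting σ).A (setting σ).s (setting σ).t := by
  classical
  constructor
  · rintro ⟨w, -, hw⟩
    convert ((loopValid_iff hσ hS w).1 hw).hasSchedule hS
  · rintro ⟨p, τ, h⟩
    obtain ⟨π, hπ, hb⟩ := IsSchedule.exists_plan hS (p := p) (τ := τ) (by convert h)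
    have hb' : ∀ i ∈ (setting σ).X, π.time i ≤ σ.reg 2 ∧ π.parent i < 2 * σ.reg 4 ∧
      π.leaves i ≤ σ.reg 2 + 1 ∧ π.slotTime i ≤ σ.reg 2 + 1 ∧ π.slotParent i ≤ σ.reg 4 := hb
    have hbase := hσ.le_base
    have hcard := hσ.card_le
    let entry : ℕ → ℕ → ℕ := fun i q =>
      if q = 0 then π.time i else if q = 1 then π.parent i else if q = 2 then π.leaves i else
        if q = 3 then π.slotTime i else π.slotParent i
    have hinv : ∀ r, ∃ i, r < σ.reg 4 → i ∈ (setting σ).X ∧ (setting σ).rk i = r := fun r => by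
      by_cases hr : r < σ.reg 4
      · obtain ⟨i, hi⟩ := hS.rk_surj r hr
        exact ⟨i, fun _ => hi⟩
      · exact ⟨0, fun h => absurd h hr⟩
    choose v hv using hinv
    -- Digit number `x` is the entry `x % 5` of the modulator vertex of rank `x / 5`.
    obtain ⟨w, hw, hd⟩ := exists_digits (b := σ.reg 5) (5 * σ.reg 4)
      (fun x => entry (v (x / 5)) (x % 5)) (fun x hx => by
        have h := hb' _ (hv (x / 5) (by omega)).1
        dsimp only [entry]
        split_ifs <;> omega)
    have hw' := hw.trans_le hσ.base_pow_le
    have hentry : ∀ i ∈ (setting σ).X, ∀ q < 5, planEntry σ w i q = entry i q := by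
      intro i hi q hq
      have h1 : (setting σ).rk i < σ.reg 4 := hS.rk_lt i hi
      have h2 := hv _ h1
      rw [planEntry, loopDigit_eq hw'.le hσ.base_le (by omega) (by omega), hd _ (by omega)]
      rw [show (q + ((setting σ).rk i + (setting σ).rk i + (setting σ).rk i + (setting σ).rk i +
        (setting σ).rk i)) / 5 = (setting σ).rk i by omega,
        show (q + ((setting σ).rk i + (setting σ).rk i + (setting σ).rk i + (setting σ).rk i +
        (setting σ).rk i)) % 5 = q by omega, hS.rk_inj _ h2.1 i hi h2.2]
    refine ⟨w, hw', (loopValid_iff hσ hS w).2 (hπ.of_eqOn hS.source_mem ?_ ?_ ?_ ?_ ?_)⟩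
    · intro i hi
      by_cases his : i = (setting σ).s
      · rw [his, hπ.root]; simp [plan]
      · simp only [plan, his, if_false]
        exact hentry i hi 0 (by omega)
    · exact fun i hi => hentry i hi 1 (by omega)
    · exact fun i hi => hentry i hi 2 (by omega)
    · exact fun i hi => hentry i hi 3 (by omega)
    · exact fun i hi => hentry i hi 4 (by omega)

/-! ## The time bound -/

/-- For `n = ⌈log₂ (l + 1)⌉` this bounds the squared logarithm linearly in `l`. The factor `2` is
needed for `n = 3` only. -/
theorem sq_le_two_mul_two_pow (n : ℕ) : n ^ 2 ≤ 2 * 2 ^ n := by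
  rcases Nat.lt_or_ge n 4 with h | h
  · interval_cases n <;> norm_num
  · have h1 : n ^ 2 ≤ 2 ^ n := by
      induction n, h using Nat.le_induction with
      | base => norm_num
      | succ n hn ih =>
        rw [pow_succ 2 n]
        nlinarith
    omega

theorem two_pow_clog_le {n : ℕ} (hn : 0 < n) : 2 ^ Nat.clog 2 n ≤ 2 * n := by
  rcases Nat.lt_or_ge 1 n with h | h
  · have h1 := Nat.pow_pred_clog_lt_self one_lt_two h
    have h2 := Nat.clog_pos one_lt_two h
    obtain ⟨m, hm⟩ := Nat.exists_eq_succ_of_ne_zero h2.ne'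
    rw [hm, Nat.pred_succ] at h1
    rw [hm, pow_succ]
    omega
  · rw [Nat.clog_of_right_le_one h]
    omega

/-- With `q = ⌈log₂ (l + 1)⌉` the exponent `q K` is at most `q² + K²`, and `q² ≤ 2 * 2 ^ q ≤ 4 (l +
1)`. When `l` is a logarithm of the order, this separates `2 ^ K²` from a polynomial factor. -/
theorem succ_pow_le (l K : ℕ) : (l + 1) ^ K ≤ 2 ^ (K ^ 2 + 4 * l + 4) := by
  have h1 := Nat.le_pow_clog one_lt_two (l + 1)
  have h2 := two_pow_clog_le (Nat.succ_pos l)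
  have h3 := sq_le_two_mul_two_pow (Nat.clog 2 (l + 1))
  calc (l + 1) ^ K ≤ (2 ^ Nat.clog 2 (l + 1)) ^ K := Nat.pow_le_pow_left h1 K
    _ = 2 ^ (Nat.clog 2 (l + 1) * K) := by rw [← pow_mul]
    _ ≤ 2 ^ (K ^ 2 + 4 * l + 4) := by
      refine Nat.pow_le_pow_right two_pos ?_
      rw [Nat.succ_eq_add_one] at h2
      set q := Nat.clog 2 (l + 1)
      have h4 : q * K ≤ q ^ 2 + K ^ 2 := by nlinarith [sq_nonneg ((q : ℤ) - K), two_mul_le_add_sq q K]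
      omega

/-- The inequality `4 K + l + 2 ≤ 2 ^ (K + 3) * (l + 1)` separates `K` from `l`, and `succ_pow_le`
treats the second factor. -/
theorem base_pow_le {K l : ℕ} (hK : 1 ≤ K) :
    (4 * K + l + 2) ^ (5 * K) ≤ 2 ^ (25 * K ^ 2 + 20) * (2 ^ l) ^ 20 := by
  have h1 : 4 * K + 2 ≤ 2 ^ (K + 3) := by
    have := @Nat.lt_two_pow_self K
    rw [pow_add]
    omega
  have h2 : 4 * K + l + 2 ≤ 2 ^ (K + 3) * (l + 1) := by nlinarith
  calc (4 * K + l + 2) ^ (5 * K) ≤ (2 ^ (K + 3) * (l + 1)) ^ (5 * K) := Nat.pow_le_pow_left h2 _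
    _ = 2 ^ ((K + 3) * (5 * K)) * ((l + 1) ^ K) ^ 5 := by
      rw [mul_pow, ← pow_mul, ← pow_mul, mul_comm K 5]
    _ ≤ 2 ^ (20 * K ^ 2) * (2 ^ (K ^ 2 + 4 * l + 4)) ^ 5 := by
      refine Nat.mul_le_mul (Nat.pow_le_pow_right two_pos (by nlinarith))
        (Nat.pow_le_pow_left (succ_pow_le l K) 5)
    _ = 2 ^ (25 * K ^ 2 + 20) * (2 ^ l) ^ 20 := by
      rw [← pow_mul, ← pow_mul, ← pow_add, ← pow_add]
      ring_nf

/-- The length of the loops, in terms of the distance to clique `κ` and `n = |V| - κ`. -/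
theorem size_le {κ n k B : ℕ} (hn : 1 ≤ n) (hk : k ≤ 2 * κ + 1)
    (hB : B ≤ 4 * k + Nat.clog 2 (n + κ) + 2) :
    B ^ (5 * k) + (10 * (n + κ) + 10) + 1 ≤ 2 ^ (220 * κ ^ 2 + 71) * n ^ 20 := by
  -- Replacing `|V| = n + κ` by `n ≥ 1` costs at most the factor `κ + 1 ≤ 2 ^ κ ^ 2`.
  have hN : n + κ ≤ n * 2 ^ κ ^ 2 := by
    have h1 : κ + 1 ≤ 2 ^ κ := Nat.lt_two_pow_self
    have h2 : 2 ^ κ ≤ 2 ^ κ ^ 2 := Nat.pow_le_pow_right two_pos (Nat.le_self_pow two_ne_zero κ)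
    nlinarith
  have hK := base_pow_le (K := 2 * κ + 1) (l := Nat.clog 2 (n + κ)) (by omega)
  have hl := two_pow_clog_le (show 0 < n + κ by omega)
  set l := Nat.clog 2 (n + κ)
  have h1 : B ^ (5 * k) ≤ (4 * (2 * κ + 1) + l + 2) ^ (5 * (2 * κ + 1)) :=
    (Nat.pow_le_pow_left (by omega) _).trans (Nat.pow_le_pow_right (by omega) (by omega))
  have h2 : (2 ^ l) ^ 20 ≤ 2 ^ 20 * (n * 2 ^ κ ^ 2) ^ 20 := by
    rw [← mul_pow]
    exact Nat.pow_le_pow_left (hl.trans (Nat.mul_le_mul_left 2 hN)) 20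
  have h3 : (n * 2 ^ κ ^ 2) ^ 20 = n ^ 20 * 2 ^ (20 * κ ^ 2) := by
    rw [mul_pow, ← pow_mul, mul_comm (κ ^ 2) 20]
  -- The exponent on the left is `100 κ² + 100 κ + 45`, and `κ ≤ κ²`.
  have h4 : 2 ^ (25 * (2 * κ + 1) ^ 2 + 20) ≤ 2 ^ (200 * κ ^ 2 + 45) :=
    Nat.pow_le_pow_right two_pos (by nlinarith [Nat.le_self_pow two_ne_zero κ])
  have h5 : B ^ (5 * k) ≤ 2 ^ (220 * κ ^ 2 + 65) * n ^ 20 := by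
    refine h1.trans (hK.trans ((Nat.mul_le_mul h4 h2).trans (le_of_eq ?_)))
    rw [h3, show 220 * κ ^ 2 + 65 = (200 * κ ^ 2 + 45) + 20 + 20 * κ ^ 2 by ring, pow_add, pow_add]
    ring
  have h6 : n + κ ≤ 2 ^ (220 * κ ^ 2 + 65) * n ^ 20 := by
    refine hN.trans ?_
    rw [mul_comm]
    exact Nat.mul_le_mul (Nat.pow_le_pow_right two_pos (by nlinarith))
      (Nat.le_self_pow (by norm_num) n)
  -- The three summands take at most `1 + 10 + 11 = 22` copies of the common bound, and `22 ≤ 64`.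
  have h7 : 2 ^ (220 * κ ^ 2 + 71) * n ^ 20 = 64 * (2 ^ (220 * κ ^ 2 + 65) * n ^ 20) := by
    rw [show 220 * κ ^ 2 + 71 = (220 * κ ^ 2 + 65) + 6 by ring, pow_add]
    ring
  rw [h7]
  omega

/-- A single constant has to serve as factor, as coefficient of `κ ^ 2` and as exponent of `n`; the
sum dominates the three values `C * 2 ^ (71 * C)`, `220 * C` and `20 * C`. -/
theorem polyBound_size_le {κ n k B C : ℕ} (hn : 1 ≤ n) (hk : k ≤ 2 * κ + 1)
    (hB : B ≤ 4 * k + Nat.clog 2 (n + κ) + 2) :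
    polyBound C (B ^ (5 * k) + (10 * (n + κ) + 10)) ≤
      (C * 2 ^ (71 * C) + 220 * C) * 2 ^ ((C * 2 ^ (71 * C) + 220 * C) * κ ^ 2) *
        n ^ (C * 2 ^ (71 * C) + 220 * C) := by
  have hC : C ≤ C * 2 ^ (71 * C) := Nat.le_mul_of_pos_right _ (by positivity)
  rw [polyBound]
  calc C * (B ^ (5 * k) + (10 * (n + κ) + 10) + 1) ^ C
      ≤ C * (2 ^ (220 * κ ^ 2 + 71) * n ^ 20) ^ C :=
        Nat.mul_le_mul_left _ (Nat.pow_le_pow_left (size_le hn hk hB) C)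
    _ = C * 2 ^ (71 * C) * 2 ^ (220 * C * κ ^ 2) * n ^ (20 * C) := by
      rw [mul_pow, ← pow_mul, ← pow_mul, show (220 * κ ^ 2 + 71) * C = 71 * C + 220 * C * κ ^ 2 by
        ring, pow_add]
      ring
    _ ≤ _ := by
      refine Nat.mul_le_mul (Nat.mul_le_mul (by omega) (Nat.pow_le_pow_right two_pos
        (Nat.mul_le_mul_right _ (by omega)))) (Nat.pow_le_pow_right hn (by omega))

theorem computable_mul_two_pow (c : ℕ) : Computable fun k : ℕ => c * 2 ^ (c * k ^ 2) := by
  have hsq : Primrec fun k : ℕ => k ^ 2 :=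
    (Primrec.nat_mul.comp .id .id).of_eq fun k => by simp [sq]
  have h2 : Primrec fun k : ℕ => 2 ^ k :=
    (Primrec.nat_rec₁ (f := fun _ b => 2 * b) 1
      (Primrec.nat_mul.comp (Primrec.const 2) Primrec.snd).to₂).of_eq fun k => by
      induction k with
      | zero => rfl
      | succ k ih => rw [pow_succ, ← ih, mul_comm]
  exact (Primrec.nat_mul.comp (.const c)
    (h2.comp (Primrec.nat_mul.comp (.const c) hsq))).to_comp

/-! ## The program -/

theorem Comp.exec_assign {f : State → ℕ} (hf : Comp f) (x : ℕ) :
    ∃ (p : Program) (c : ℕ), ∀ σ : State, ∃ (σ' : State) (m : ℕ), Exec p σ σ' m ∧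
      m ≤ polyBound c (σ.reg 3) ∧ (∀ y < 10, σ'.reg y = if y = x then f σ.global else σ.reg y) ∧
      σ'.arr = σ.arr := by
  obtain ⟨p, c, hp⟩ := hf 10 State.global ⟨le_rfl, rfl⟩
  refine ⟨.seq p (.assign x (.var 10)), c + 2, fun σ => ?_⟩
  obtain ⟨σ', m, h1, h2, h3, h4⟩ := hp σ
  refine ⟨_, _, Exec.seq h1 (Exec.assign _ _ _), ?_, ?_, h3.2⟩
  · exact (Nat.add_le_add h2 (le_polyBound 2 _)).trans (polyBound_add_le _ _ _)
  · intro y hy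
    simp only [Expr.eval, State.setReg, Function.update_apply, h4, h3.1 y hy]

theorem Comp.exec_store {f g : State → ℕ} (hf : Comp f) (hg : Comp g) (a : ℕ) :
    ∃ (p : Program) (c : ℕ), ∀ σ : State, ∃ (σ' : State) (m : ℕ), Exec p σ σ' m ∧
      m ≤ polyBound c (σ.reg 3) ∧ (∀ y < 10, σ'.reg y = σ.reg y) ∧
      σ'.arr = Function.update σ.arr a
        (Function.update (σ.arr a) (f σ.global) (g σ.global)) := by
  obtain ⟨p, c, hp⟩ := hf 10 State.global ⟨le_rfl, rfl⟩
  obtain ⟨q, c', hq⟩ := hg 11 State.global ⟨by omega, rfl⟩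
  refine ⟨.seq p (.seq q (.store a (.var 10) (.var 11))), c + (c' + 3), fun σ => ?_⟩
  obtain ⟨σ', m, h1, h2, h3, h4⟩ := hp σ
  obtain ⟨σ'', m', h5, h6, h7, h8⟩ := hq σ'
  refine ⟨_, _, Exec.seq h1 (Exec.seq h5 (Exec.store _ _ _ _)), ?_, ?_, ?_⟩
  · rw [h3.1 3 (by omega)] at h6
    refine (Nat.add_le_add h2 ?_).trans (polyBound_add_le _ _ _)
    exact (Nat.add_le_add h6 (le_polyBound 3 _)).trans (polyBound_add_le _ _ _)
  · intro y hy
    exact (h7.1 y (by omega)).trans (h3.1 y hy)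
  · simp only [State.setArr, Expr.eval, h8, h7.1 10 (by omega), h4, h7.2, h3.2,
      h3.global_eq le_rfl]

/-! ### Construction of a modulator by 2-approximation -/

/-- The vertex `u` is not marked and not adjacent to the unmarked vertex in register `6`. -/
def Candidate (σ : State) (u : ℕ) : Prop :=
  σ.reg 6 < σ.reg 0 ∧ σ.arr 1 (σ.reg 6) = 0 ∧ u < σ.reg 0 ∧ u ≠ σ.reg 6 ∧ σ.arr 1 u = 0 ∧
    ¬ loopAdj σ (σ.reg 6) u

open scoped Classical in
/-- A candidate, or the number of vertices if there is none. -/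
noncomputable def candidate (σ : State) : ℕ :=
  Nat.rec (motive := fun _ => ℕ) (σ.reg 0) (fun u a => if Candidate σ u then u else a) (σ.reg 3)

theorem candidate_spec (σ : State) :
    Candidate σ (candidate σ) ∨ candidate σ = σ.reg 0 ∧ ∀ u < σ.reg 3, ¬ Candidate σ u := by
  classical
  rw [candidate]
  induction σ.reg 3 with
  | zero => exact Or.inr ⟨rfl, by simp⟩
  | succ n ih =>
    dsimp only
    split_ifs with h
    · exact Or.inl h
    · refine ih.imp_right fun h' => ⟨h'.1, fun u hu => ?_⟩
      rcases Nat.lt_succ_iff_lt_or_eq.1 hu with hu | rfl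
      · exact h'.2 u hu
      · exact h

open scoped Classical in
theorem comp_candidate : Comp candidate := by
  refine Comp.iterate (Γ := State) (f := fun σ => σ.reg 0)
    (h := fun σ u a => if Candidate σ u then u else a)
    (.reg 0 (by omega)) (.ite (.and (.lt (.reg 6 (by omega)) (.reg 0 (by omega))) <| .and
    (.eq (.get 1 (.reg 6 (by omega))) (.const 0)) <| .and (.lt .var1 (.reg 0 (by omega))) <| .and
    (.ne .var1 (.reg 6 (by omega))) <| .and (.eq (.get 1 .var1) (.const 0)) <| .not
    (.settingA (.reg 6 (by omega)) .var1)) .var1 .var)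

theorem mem_modulator {σ : State} (h : σ.reg 0 ≤ σ.reg 3) {v : ℕ} :
    v ∈ modulator σ ↔ v < σ.reg 0 ∧ σ.arr 1 v ≠ 0 := by
  simp only [modulator, mem_filter, mem_range, and_iff_right_iff_imp]
  omega

theorem mem_unmarked {σ : State} (h : σ.reg 0 ≤ σ.reg 3) {v : ℕ} :
    v ∈ unmarked σ ↔ v < σ.reg 0 ∧ σ.arr 1 v = 0 := by
  simp only [unmarked, mem_filter, mem_range, and_iff_right_iff_imp]
  omega

theorem modulator_union_unmarked {σ : State} (h : σ.reg 0 ≤ σ.reg 3) :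
    modulator σ ∪ unmarked σ = range (σ.reg 0) := by
  ext v
  rw [mem_union, mem_modulator h, mem_unmarked h, mem_range]
  by_cases h : σ.arr 1 v = 0 <;> simp [h]

theorem loopAdj_iff {σ : State} (h : σ.reg 0 ≤ σ.reg 3) {u v : ℕ} :
    loopAdj σ u v ↔ u < σ.reg 0 ∧ v < σ.reg 0 ∧ σ.arr 0 (u * σ.reg 0 + v) ≠ 0 := by
  rw [loopAdj]
  refine and_congr_right fun hu => ?_
  rw [loopMul_eq (by omega)]

/-- Adjacency in a graph given by a matrix that is stored row by row. -/
def MatrixAdj (N : ℕ) (M : ℕ → ℕ) (u v : ℕ) : Prop := u < N ∧ v < N ∧ M (u * N + v) ≠ 0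

/-- The invariant of the construction of a modulator: the first `i` vertices have been processed. -/
structure MarkInvariant (N s : ℕ) (M : ℕ → ℕ) (i : ℕ) (mark : ℕ → ℕ) : Prop where
  source : mark s ≠ 0
  -- The marked vertices other than the source come in disjoint pairs of non-adjacent vertices, and
  -- each pair meets every `Y` whose complement is a clique.
  card_le : ∀ Y : Finset ℕ, (∀ u < N, ∀ v < N, u ∉ Y → v ∉ Y → u ≠ v → MatrixAdj N M u v) →
    #{v ∈ range N | mark v ≠ 0} ≤ 2 * #{v ∈ range N | mark v ≠ 0 ∧ v ∈ Y} + 1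
  -- Marking further vertices preserves this, so one pass over the vertices is enough.
  adj : ∀ i' < i, i' < N → mark i' = 0 → ∀ u < N, u ≠ i' → mark u = 0 → MatrixAdj N M i' u

theorem MarkInvariant.zero {N s : ℕ} {M : ℕ → ℕ} {mark : ℕ → ℕ}
    (h : ∀ v, mark v ≠ 0 ↔ v = s) : MarkInvariant N s M 0 mark where
  source := (h s).2 rfl
  card_le Y _ := by
    have : {v ∈ range N | mark v ≠ 0} ⊆ {s} := by
      intro v hv
      rw [mem_filter, h] at hv
      simp [hv.2]
    have := card_le_card this
    rw [card_singleton] at this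
    omega
  adj i' hi' := absurd hi' (Nat.not_lt_zero _)

theorem MarkInvariant.succ_of_not {N s : ℕ} {M : ℕ → ℕ} {i : ℕ} {mark mark' : ℕ → ℕ}
    (h : MarkInvariant N s M i mark) (hm : ∀ v < N, mark' v = mark v) (hs : s < N)
    (hi : i < N → mark i = 0 → ∀ u < N, u ≠ i → mark u = 0 → MatrixAdj N M i u) :
    MarkInvariant N s M (i + 1) mark' where
  source := by rw [hm s hs]; exact h.source
  card_le Y hY := by
    have h1 : {v ∈ range N | mark' v ≠ 0} = {v ∈ range N | mark v ≠ 0} :=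
      filter_congr fun v hv => by rw [hm v (mem_range.1 hv)]
    have h2 : {v ∈ range N | mark' v ≠ 0 ∧ v ∈ Y} = {v ∈ range N | mark v ≠ 0 ∧ v ∈ Y} :=
      filter_congr fun v hv => by rw [hm v (mem_range.1 hv)]
    rw [h1, h2]
    exact h.card_le Y hY
  adj i' hi' hi'N h0 u hu hui hu0 := by
    rw [hm i' hi'N] at h0
    rw [hm u hu] at hu0
    rcases Nat.lt_succ_iff_lt_or_eq.1 hi' with hlt | rfl
    · exact h.adj i' hlt hi'N h0 u hu hui hu0
    · exact hi hi'N h0 u hu hui hu0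

theorem MarkInvariant.succ_of_pair {N s : ℕ} {M : ℕ → ℕ} {i u : ℕ} {mark mark' : ℕ → ℕ}
    (h : MarkInvariant N s M i mark) (hm : ∀ v, mark' v ≠ 0 ↔ mark v ≠ 0 ∨ v = i ∨ v = u)
    (hi : i < N) (hi0 : mark i = 0) (hu : u < N) (hui : u ≠ i) (hu0 : mark u = 0)
    (hA : ¬ MatrixAdj N M i u) : MarkInvariant N s M (i + 1) mark' where
  source := (hm s).2 (Or.inl h.source)
  card_le Y hY := by
    have h1 : {v ∈ range N | mark' v ≠ 0} = insert i (insert u {v ∈ range N | mark v ≠ 0}) := by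
      ext v
      simp only [mem_filter, mem_range, mem_insert, hm]
      constructor
      · rintro ⟨h1, h2 | h2 | h2⟩
        · exact Or.inr (Or.inr ⟨h1, h2⟩)
        · exact Or.inl h2
        · exact Or.inr (Or.inl h2)
      · rintro (rfl | rfl | ⟨h1, h2⟩)
        · exact ⟨hi, Or.inr (Or.inl rfl)⟩
        · exact ⟨hu, Or.inr (Or.inr rfl)⟩
        · exact ⟨h1, Or.inl h2⟩
    have h2 : #{v ∈ range N | mark' v ≠ 0} = #{v ∈ range N | mark v ≠ 0} + 2 := by
      rw [h1, card_insert_of_notMem, card_insert_of_notMem] <;> simp [hi0, hu0, hui.symm]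
    obtain ⟨x, hxY, hx⟩ : ∃ x ∈ Y, x = i ∨ x = u := by
      by_contra! hcon
      exact hA (hY i hi u hu (fun hY => (hcon i hY).1 rfl) (fun hY => (hcon u hY).2 rfl) hui.symm)
    have h3 : insert x {v ∈ range N | mark v ≠ 0 ∧ v ∈ Y} ⊆
        {v ∈ range N | mark' v ≠ 0 ∧ v ∈ Y} := by
      intro v hv
      rw [mem_insert, mem_filter] at hv
      rw [mem_filter, hm, mem_range]
      rcases hv with rfl | ⟨h4, h5, h6⟩
      · exact ⟨by rcases hx with rfl | rfl <;> assumption, Or.inr hx, hxY⟩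
      · exact ⟨mem_range.1 h4, Or.inl h5, h6⟩
    have h4 := card_le_card h3
    rw [card_insert_of_notMem (by rcases hx with rfl | rfl <;> simp [hi0, hu0])] at h4
    have h5 := h.card_le Y hY
    omega
  adj i' hi' hi'N h0 v hv hvi hv0 := by
    have h0' : mark i' = 0 := by
      by_contra hne
      exact (hm i').2 (Or.inl hne) h0
    have hv0' : mark v = 0 := by
      by_contra hne
      exact (hm v).2 (Or.inl hne) hv0
    rcases Nat.lt_succ_iff_lt_or_eq.1 hi' with hlt | rfl
    · exact h.adj i' hlt hi'N h0' v hv hvi hv0'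
    · exact absurd h0 ((hm i').2 (Or.inr (Or.inl rfl)))

/-- The construction of a modulator. -/
theorem exists_mark_program : ∃ (p : Program) (c : ℕ), ∀ σ : State, σ.reg 6 = 0 →
    σ.reg 0 ≤ σ.reg 3 → σ.reg 1 < σ.reg 0 → (∀ v, σ.arr 1 v ≠ 0 ↔ v = σ.reg 1) →
    ∃ (σ' : State) (m : ℕ), Exec p σ σ' m ∧ m ≤ polyBound c (σ.reg 3) ∧
      (∀ y < 6, σ'.reg y = σ.reg y) ∧ σ'.arr 0 = σ.arr 0 ∧
      MarkInvariant (σ.reg 0) (σ.reg 1) (σ.arr 0) (σ.reg 3) (σ'.arr 1) := by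
  classical
  obtain ⟨p₁, c₁, h₁⟩ := comp_candidate.exec_assign 7
  -- Without a candidate, register `7` holds the number of vertices. Then this store rewrites the
  -- old value, and the next one marks a cell beyond the vertices, so no branching is necessary.
  obtain ⟨p₂, c₂, h₂⟩ := Comp.exec_store (f := fun σ => σ.reg 6)
    (g := fun σ => if σ.reg 7 < σ.reg 0 then 1 else σ.arr 1 (σ.reg 6))
    (Comp.reg (Γ := State) 6 (by omega)) (Comp.ite (Γ := State) (CompP.lt
      (Comp.reg (Γ := State) 7 (by omega)) (Comp.reg (Γ := State) 0 (by omega)))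
      (.const 1) (Comp.get (Γ := State) 1 (Comp.reg (Γ := State) 6 (by omega)))) 1
  obtain ⟨p₃, c₃, h₃⟩ := Comp.exec_store (f := fun σ => σ.reg 7) (g := fun _ => 1)
    (Comp.reg (Γ := State) 7 (by omega)) (.const 1) 1
  obtain ⟨p₄, c₄, h₄⟩ := Comp.exec_assign (f := fun σ => σ.reg 6 + 1)
    (Comp.add (Comp.reg (Γ := State) 6 (by omega)) (.const 1)) 6
  refine ⟨.loop (.sub (.var 3) (.var 6)) (.seq p₁ (.seq p₂ (.seq p₃ p₄))),
    c₁ + (c₂ + (c₃ + c₄)) + 4 + 1 + 4, ?_⟩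
  intro σ h6 hN hs hmark
  let I : ℕ → State → Prop := fun i σ' => (∀ y < 6, σ'.reg y = σ.reg y) ∧ σ'.reg 6 = i ∧
    σ'.arr 0 = σ.arr 0 ∧ MarkInvariant (σ.reg 0) (σ.reg 1) (σ.arr 0) i (σ'.arr 1)
  have hstep : ∀ i < σ.reg 3, ∀ τ, I i τ → ∃ τ' m, Exec (.seq p₁ (.seq p₂ (.seq p₃ p₄))) τ τ' m ∧
      m ≤ polyBound (c₁ + (c₂ + (c₃ + c₄))) (σ.reg 3) ∧ I (i + 1) τ' := by
    rintro i hi τ ⟨hr, hr6, ha, hinv⟩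
    obtain ⟨τ₁, m₁, e₁, b₁, r₁, a₁⟩ := h₁ τ
    obtain ⟨τ₂, m₂, e₂, b₂, r₂, a₂⟩ := h₂ τ₁
    obtain ⟨τ₃, m₃, e₃, b₃, r₃, a₃⟩ := h₃ τ₂
    obtain ⟨τ₄, m₄, e₄, b₄, r₄, a₄⟩ := h₄ τ₃
    have r₁' : ∀ y < 7, τ₁.reg y = τ.reg y := fun y hy => by
      rw [r₁ y (by omega), if_neg (by omega)]
    have r17 : τ₁.reg 7 = candidate τ.global := by rw [r₁ 7 (by omega), if_pos rfl]
    have g0 : τ.global.reg 0 = σ.reg 0 := by simp [State.global, hr 0]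
    have g3 : τ.global.reg 3 = σ.reg 3 := by simp [State.global, hr 3]
    have g6 : τ.global.reg 6 = i := by simp [State.global, hr6]
    have gl₁ : ∀ y < 10, τ₁.global.reg y = τ₁.reg y := fun y hy => by simp [State.global, hy]
    have gl₂ : ∀ y < 10, τ₂.global.reg y = τ₂.reg y := fun y hy => by simp [State.global, hy]
    have gl₃ : ∀ y < 10, τ₃.global.reg y = τ₃.reg y := fun y hy => by simp [State.global, hy]
    set j := candidate τ.global with hj
    have a₂' : τ₂.arr 1 = Function.update (τ.arr 1) i (if j < σ.reg 0 then 1 else τ.arr 1 i) := by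
      rw [a₂, Function.update_self, gl₁ 6 (by omega), gl₁ 7 (by omega), gl₁ 0 (by omega), r17,
        r₁' 6 (by omega), r₁' 0 (by omega), hr6, hr 0 (by omega), a₁,
        show τ₁.global.arr = τ₁.arr from rfl, a₁]
    have a₃' : τ₃.arr 1 = Function.update (τ₂.arr 1) j 1 := by
      rw [a₃, Function.update_self, gl₂ 7 (by omega), r₂ 7 (by omega), r17]
    have hcand : ∀ u, Candidate τ.global u ↔ i < σ.reg 0 ∧ τ.arr 1 i = 0 ∧ u < σ.reg 0 ∧ u ≠ i ∧
        τ.arr 1 u = 0 ∧ ¬ MatrixAdj (σ.reg 0) (σ.arr 0) i u := by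
      intro u
      rw [Candidate, loopAdj_iff (by rw [g0, g3]; exact hN), g6, g0, MatrixAdj, ← ha]
      rfl
    refine ⟨τ₄, _, .seq e₁ (.seq e₂ (.seq e₃ e₄)), ?_, ?_, ?_, ?_, ?_⟩
    · rw [hr 3 (by omega)] at b₁
      rw [r₁' 3 (by omega), hr 3 (by omega)] at b₂
      rw [r₂ 3 (by omega), r₁' 3 (by omega), hr 3 (by omega)] at b₃
      rw [r₃ 3 (by omega), r₂ 3 (by omega), r₁' 3 (by omega), hr 3 (by omega)] at b₄
      refine (Nat.add_le_add b₁ ?_).trans (polyBound_add_le _ _ _)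
      refine (Nat.add_le_add b₂ ?_).trans (polyBound_add_le _ _ _)
      exact (Nat.add_le_add b₃ b₄).trans (polyBound_add_le _ _ _)
    · intro y hy
      rw [r₄ y (by omega), if_neg (by omega), r₃ y (by omega), r₂ y (by omega), r₁' y (by omega),
        hr y hy]
    · rw [r₄ 6 (by omega), if_pos rfl, gl₃ 6 (by omega), r₃ 6 (by omega), r₂ 6 (by omega),
        r₁' 6 (by omega), hr6]
    · rw [a₄, a₃, Function.update_of_ne (by omega), a₂, Function.update_of_ne (by omega), a₁, ha]
    · rw [a₄, a₃', a₂']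
      rcases candidate_spec τ.global with hc | ⟨hc, hnc⟩
      · rw [← hj, hcand] at hc
        obtain ⟨c1, c2, c3, c4, c5, c6⟩ := hc
        refine hinv.succ_of_pair (u := j) ?_ c1 c2 c3 c4 c5 c6
        intro v
        rw [if_pos c3]
        by_cases hvj : v = j
        · simp [hvj]
        · by_cases hvi : v = i
          · rw [Function.update_of_ne hvj, hvi, Function.update_self]; simp
          · rw [Function.update_of_ne hvj, Function.update_of_ne hvi]; simp [hvj, hvi]
      · rw [← hj, g0] at hc
        rw [hc, if_neg (lt_irrefl _), Function.update_eq_self]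
        refine hinv.succ_of_not (fun v hv => Function.update_of_ne (by omega) _ _) hs ?_
        intro hi' hi0 u hu hui hu0
        by_contra hA
        exact hnc u (by omega) ((hcand u).2 ⟨hi', hi0, hu, hui, hu0, hA⟩)
  obtain ⟨σ', m, he, hm, hI⟩ := exec_for (x := 6) (N := σ.reg 3)
    (c := polyBound (c₁ + (c₂ + (c₃ + c₄))) (σ.reg 3)) (I := I)
    (p := .seq p₁ (.seq p₂ (.seq p₃ p₄)))
    (fun i σ' h => ⟨h.2.1, h.1 3 (by omega)⟩) hstep (σ := σ) ⟨fun _ _ => rfl, h6, rfl, .zero hmark⟩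
  refine ⟨σ', m, he, hm.trans ?_, hI.1, hI.2.2.1, hI.2.2.2⟩
  refine (Nat.add_le_add ?_ (le_polyBound 4 _)).trans (polyBound_add_le _ _ _)
  refine (Nat.mul_le_mul_left _ ?_).trans (mul_polyBound_le _ _)
  exact (Nat.add_le_add_left (le_polyBound 4 _) _).trans (polyBound_add_le _ _ _)

theorem polyBound_mono_right (c : ℕ) {x y : ℕ} (h : x ≤ y) : polyBound c x ≤ polyBound c y :=
  Nat.mul_le_mul_left _ (Nat.pow_le_pow_left (by omega) _)

theorem Comp.const_mul {Γ : Type} [Ctx Γ] {f : Γ → ℕ} (n : ℕ) (hf : Comp f) :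
    Comp fun γ => n * f γ := by
  induction n with
  | zero => exact (Comp.const 0).congr fun γ => (Nat.zero_mul _).symm
  | succ n ih => exact (ih.add hf).congr fun γ => (Nat.succ_mul _ _).symm

theorem Instance.input_arr_one (I : Instance) (v : ℕ) : I.input.arr 1 v = 0 := by
  simp [Instance.input]

theorem Instance.matrixAdj_iff (I : Instance) (u v : Fin I.order) :
    MatrixAdj I.order (I.input.arr 0) u v ↔ I.graph.Adj u v := by
  have key : ∀ i j : Fin I.order, (u : ℕ) * I.order + v = i * I.order + j → u = i ∧ v = j := by
    intro i j h
    have h1 := congrArg (· % I.order) h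
    have h2 := congrArg (· / I.order) h
    have hN : 0 < I.order := u.pos
    simp only [Nat.mul_add_mod_self_right, Nat.mod_eq_of_lt v.2,
      Nat.mod_eq_of_lt j.2] at h1
    simp only [Nat.mul_comm _ I.order, Nat.mul_add_div hN, Nat.div_eq_of_lt v.2,
      Nat.div_eq_of_lt j.2, add_zero] at h2
    exact ⟨Fin.ext h2, Fin.ext h1⟩
  simp only [MatrixAdj, u.2, v.2, true_and, Instance.input]
  constructor
  · intro h
    by_contra hA
    refine h (if_neg ?_)
    rintro ⟨-, i, j, hij, he⟩
    obtain ⟨rfl, rfl⟩ := key i j he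
    exact hA hij
  · intro h
    rw [if_pos ⟨rfl, u, v, h, rfl⟩]
    exact one_ne_zero

/-- The first part of the algorithm: the construction of a modulator. -/
theorem exists_modulator_program : ∃ (p : Program) (c : ℕ), ∀ I : Instance,
    ∃ (σ : State) (m : ℕ), Exec p I.input σ m ∧ m ≤ polyBound c (10 * I.order + 10) ∧
      σ.reg 0 = I.order ∧ σ.reg 1 = I.source ∧ σ.reg 2 = I.rounds ∧
      σ.reg 3 = 10 * I.order + 10 ∧ σ.arr 0 = I.input.arr 0 ∧
      MarkInvariant I.order I.source (I.input.arr 0) (σ.reg 3) (σ.arr 1) := by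
  -- The first length of the loops. It is enough for `|V|`, for `5 * k` and for the base of the
  -- codes, because `k ≤ |V|` and the capped number of rounds is at most `3 * |V|`. Register `3`
  -- still holds `0` while this assignment runs.
  obtain ⟨p₁, c₁, h₁⟩ := Comp.exec_assign (f := fun σ => 10 * σ.reg 0 + 10)
    (Comp.add (.const_mul 10 (Comp.reg (Γ := State) 0 (by omega))) (.const 10)) 3
  obtain ⟨p₂, c₂, h₂⟩ := Comp.exec_store (f := fun σ => σ.reg 1) (g := fun _ => 1)
    (Comp.reg (Γ := State) 1 (by omega)) (.const 1) 1
  obtain ⟨p₃, c₃, h₃⟩ := exists_mark_program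
  refine ⟨.seq p₁ (.seq p₂ p₃), c₁ + (c₂ + c₃), fun I => ?_⟩
  obtain ⟨σ₁, m₁, e₁, b₁, r₁, a₁⟩ := h₁ I.input
  obtain ⟨σ₂, m₂, e₂, b₂, r₂, a₂⟩ := h₂ σ₁
  have g0 : σ₁.reg 0 = I.order := by rw [r₁ 0 (by omega)]; rfl
  have g1 : σ₁.reg 1 = I.source := by rw [r₁ 1 (by omega)]; rfl
  have g2 : σ₁.reg 2 = I.rounds := by rw [r₁ 2 (by omega)]; rfl
  have g3 : σ₁.reg 3 = 10 * I.order + 10 := by rw [r₁ 3 (by omega)]; rfl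
  have g6 : σ₁.reg 6 = 0 := by rw [r₁ 6 (by omega)]; rfl
  have k0 := (r₂ 0 (by omega)).trans g0
  have k1 := (r₂ 1 (by omega)).trans g1
  have k2 := (r₂ 2 (by omega)).trans g2
  have k3 := (r₂ 3 (by omega)).trans g3
  have k6 := (r₂ 6 (by omega)).trans g6
  have ka : σ₂.arr 0 = I.input.arr 0 := by rw [a₂, Function.update_of_ne (by omega), a₁]
  obtain ⟨σ₃, m₃, e₃, b₃, r₃, a₃, hM⟩ := h₃ σ₂ k6 (by omega) (by rw [k1, k0]; exact I.source.2) (by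
    intro v
    rw [k1, a₂, Function.update_self, show σ₁.global.reg 1 = I.source from g1, a₁]
    by_cases hv : v = I.source
    · simp [hv]
    · rw [Function.update_of_ne hv, I.input_arr_one]
      simp [hv])
  rw [k0, k1, ka, ← r₃ 3 (by omega)] at hM
  refine ⟨σ₃, _, .seq e₁ (.seq e₂ e₃), ?_, (r₃ 0 (by omega)).trans k0, (r₃ 1 (by omega)).trans k1,
    (r₃ 2 (by omega)).trans k2, (r₃ 3 (by omega)).trans k3, a₃.trans ka, hM⟩
  rw [g3] at b₂
  rw [k3] at b₃
  refine (Nat.add_le_add (b₁.trans (polyBound_mono_right _ ?_))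
    ((Nat.add_le_add b₂ b₃).trans (polyBound_add_le _ _ _))).trans (polyBound_add_le _ _ _)
  exact Nat.zero_le _

/-! ### Testing all plans -/

/-- The rounded logarithm is the number of powers of two below `n`, which a loop can count. -/
theorem sum_range_two_pow_lt {n R : ℕ} (h : n ≤ R) (h0 : 2 ≤ R) (σ : State) (hσ : σ.reg 3 = R) :
    ∑ i ∈ range R, (if loopPow σ 2 i < n then 1 else 0) = Nat.clog 2 n := by
  have h1 : Nat.clog 2 n ≤ R :=
    (Nat.clog_le_of_le_pow Nat.lt_two_pow_self.le).trans h
  rw [← mul_one (Nat.clog 2 n), ← sum_range_ite_lt h1]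
  refine sum_congr rfl fun i hi => if_congr ?_ rfl rfl
  rw [mem_range] at hi
  rw [loopPow_eq (by omega) (by omega), Nat.lt_clog_iff_pow_lt one_lt_two]

/-- The number of rounds that the second part of the algorithm tests. -/
def cappedRounds (σ : State) : ℕ :=
  min (σ.reg 2) (2 * #(modulator σ) + Nat.clog 2 (σ.reg 0))

/-- The base in which the plans are encoded. -/
def planBase (σ : State) : ℕ := 2 * #(modulator σ) + cappedRounds σ + 2

open scoped Classical in
/-- The second part of the algorithm: the test of all plans. -/
theorem exists_test_program : ∃ (p : Program) (c : ℕ), ∀ σ : State,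
    σ.reg 3 = 10 * σ.reg 0 + 10 → σ.reg 1 ∈ modulator σ →
    (∀ u ∈ unmarked σ, ∀ v ∈ unmarked σ, u ≠ v → loopAdj σ u v) →
    ∃ (σ' : State) (m : ℕ), Exec p σ σ' m ∧
      m ≤ polyBound c (planBase σ ^ (5 * #(modulator σ)) + σ.reg 3) ∧
      σ'.reg 0 =
        if HasSchedule (range (σ.reg 0)) (loopAdj σ) (σ.reg 1) (cappedRounds σ) then 1 else 0 := by
  have hreg : ∀ x < 10, Comp fun σ : State => σ.reg x := fun x hx => Comp.reg (Γ := State) x hx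
  obtain ⟨p₁, c₁, h₁⟩ := Comp.exec_assign (f := fun σ => ∑ i ∈ modulator σ, 1)
    (Comp.sum_modulator (Γ := State) (h := fun _ _ => 1) (.const 1)) 4
  obtain ⟨p₂, c₂, h₂⟩ := Comp.exec_assign (f := fun σ => min (σ.reg 2) (2 * σ.reg 4 +
      ∑ i ∈ range (σ.reg 3), if loopPow σ 2 i < σ.reg 0 then 1 else 0))
    (.min (hreg 2 (by omega)) (.add (.const_mul 2 (hreg 4 (by omega)))
      (.sum (Γ := State) (h := fun σ i => if loopPow σ 2 i < σ.reg 0 then 1 else 0)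
        (.ite (.lt (.loopPow (.const 2) .var) (.reg 0 (by omega))) (.const 1) (.const 0))))) 2
  obtain ⟨p₃, c₃, h₃⟩ := Comp.exec_assign (f := fun σ => 2 * σ.reg 4 + σ.reg 2 + 2)
    (.add (.add (.const_mul 2 (hreg 4 (by omega))) (hreg 2 (by omega))) (.const 2)) 5
  -- The loops are lengthened so that they cover all codes of plans; only the final test runs with
  -- this length.
  obtain ⟨p₄, c₄, h₄⟩ := Comp.exec_assign
    (f := fun σ => loopPow σ (σ.reg 5) (5 * σ.reg 4) + σ.reg 3)
    (.add (.loopPow (Γ := State) (hreg 5 (by omega)) (.const_mul 5 (hreg 4 (by omega))))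
      (hreg 3 (by omega))) 3
  obtain ⟨p₅, c₅, h₅⟩ := Comp.exec_assign
    (f := fun σ => if ∃ w < σ.reg 3, loopValid σ w then 1 else 0)
    (.ite (.exists (Γ := State) (P := loopValid) (.loopValid .var)) (.const 1) (.const 0)) 0
  refine ⟨.seq p₁ (.seq p₂ (.seq p₃ (.seq p₄ p₅))), c₁ + (c₂ + (c₃ + (c₄ + c₅))), ?_⟩
  intro σ hR hs hclq
  have hN : σ.reg 0 ≤ σ.reg 3 := by omega
  obtain ⟨σ₁, m₁, e₁, b₁, r₁, a₁⟩ := h₁ σ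
  obtain ⟨σ₂, m₂, e₂, b₂, r₂, a₂⟩ := h₂ σ₁
  obtain ⟨σ₃, m₃, e₃, b₃, r₃, a₃⟩ := h₃ σ₂
  obtain ⟨σ₄, m₄, e₄, b₄, r₄, a₄⟩ := h₄ σ₃
  obtain ⟨σ₅, m₅, e₅, b₅, r₅, a₅⟩ := h₅ σ₄
  set k := #(modulator σ) with hk
  set t := cappedRounds σ with ht
  have hkN : k ≤ σ.reg 0 := by
    rw [hk, ← card_range (σ.reg 0)]
    refine card_le_card fun v hv => ?_
    exact mem_range.2 ((mem_modulator hN).1 hv).1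
  have htN : t ≤ 3 * σ.reg 0 := by
    have h1 : Nat.clog 2 (σ.reg 0) ≤ σ.reg 0 := Nat.clog_le_of_le_pow Nat.lt_two_pow_self.le
    have h2 : t ≤ 2 * k + Nat.clog 2 (σ.reg 0) := min_le_right _ _
    omega
  have gk : ∀ y < 10, σ₁.reg y = if y = 4 then k else σ.reg y := fun y hy => by
    rw [r₁ y hy, sum_const, smul_eq_mul, mul_one]; rfl
  have gt : ∀ y < 10, σ₂.reg y = if y = 2 then t else σ₁.reg y := fun y hy => by
    rw [r₂ y hy, sum_range_two_pow_lt (R := σ₁.global.reg 3) ?_ ?_ _ rfl]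
    · simp only [State.global, gk 2 (by omega), gk 4 (by omega), gk 0 (by omega), if_pos,
        Nat.reduceLT, Nat.reduceEqDiff]
      rfl
    · simp only [State.global, gk 0 (by omega), gk 3 (by omega), Nat.reduceLT, if_pos,
        Nat.reduceEqDiff, if_false]
      simpa using hN
    · simp only [State.global, gk 3 (by omega), Nat.reduceLT, if_pos,
        Nat.reduceEqDiff, if_false]
      omega
  have gB : ∀ y < 10, σ₃.reg y = if y = 5 then planBase σ else σ₂.reg y := fun y hy => by
    rw [r₃ y hy]
    simp only [State.global, gt 2 (by omega), gt 4 (by omega), gk 4 (by omega), if_pos,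
        Nat.reduceLT, Nat.reduceEqDiff, if_false]
    rfl
  have hB : planBase σ = 2 * k + t + 2 := rfl
  have gR : ∀ y < 10, σ₄.reg y =
      if y = 3 then planBase σ ^ (5 * k) + σ.reg 3 else σ₃.reg y := fun y hy => by
    rw [r₄ y hy, loopPow_eq]
    · simp only [State.global, gB 5 (by omega), gB 4 (by omega), gB 3 (by omega), gt 3 (by omega),
        gt 4 (by omega), gk 4 (by omega), gk 3 (by omega), if_pos, Nat.reduceLT,
        Nat.reduceEqDiff, if_false]
    · simp only [State.global, gB 5 (by omega), gB 3 (by omega), gt 3 (by omega),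
        gk 3 (by omega), if_pos, Nat.reduceLT, Nat.reduceEqDiff, if_false]
      omega
    · simp only [State.global, gB 4 (by omega), gB 3 (by omega), gt 3 (by omega),
        gt 4 (by omega), gk 4 (by omega), gk 3 (by omega), if_pos, Nat.reduceLT,
        Nat.reduceEqDiff, if_false]
      omega
  have q0 : σ₄.global.reg 0 = σ.reg 0 := by
    simp [State.global, gR 0, gB 0, gt 0, gk 0]
  have q1 : σ₄.global.reg 1 = σ.reg 1 := by
    simp [State.global, gR 1, gB 1, gt 1, gk 1]
  have q2 : σ₄.global.reg 2 = t := by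
    simp [State.global, gR 2, gB 2, gt 2]
  have q3 : σ₄.global.reg 3 = planBase σ ^ (5 * k) + σ.reg 3 := by
    simp [State.global, gR 3]
  have q4 : σ₄.global.reg 4 = k := by
    simp [State.global, gR 4, gB 4, gt 4, gk 4]
  have q5 : σ₄.global.reg 5 = planBase σ := by
    simp [State.global, gR 5, gB 5]
  have qa : σ₄.global.arr = σ.arr := by
    rw [show σ₄.global.arr = σ₄.arr from rfl, a₄, a₃, a₂, a₁]
  have hN' : σ₄.global.reg 0 ≤ σ₄.global.reg 3 := by omega
  have hmod : modulator σ₄.global = modulator σ := by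
    ext v
    rw [mem_modulator hN', mem_modulator hN, q0, qa]
  have hunm : unmarked σ₄.global = unmarked σ := by
    ext v
    rw [mem_unmarked hN', mem_unmarked hN, q0, qa]
  have hadj : loopAdj σ₄.global = loopAdj σ := by
    funext u v
    rw [eq_iff_iff, loopAdj_iff hN', loopAdj_iff hN, q0, qa]
  have hready : Ready σ₄.global := by
    refine ⟨?_, ?_, ?_, ?_, ?_, ?_, ?_⟩
    · rw [q2, q3]; omega
    · rw [q4, hmod]
    · rw [q4, q3]; omega
    · rw [q4, q3]
      have h1 : 2 ^ k ≤ planBase σ ^ k := Nat.pow_le_pow_left (by omega) k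
      have h2 : planBase σ ^ k ≤ planBase σ ^ (5 * k) :=
        Nat.pow_le_pow_right (by omega) (by omega)
      omega
    · rw [q5, q3]; omega
    · rw [q4, q5, q2]; omega
    · rw [q4, q5, q3]; omega
  have hgood : (setting σ₄.global).Good := good_setting hready.card_eq (by rwa [q1, hmod])
    (by rwa [hadj, hunm])
  refine ⟨σ₅, _, .seq e₁ (.seq e₂ (.seq e₃ (.seq e₄ e₅))), ?_, ?_⟩
  · have s1 : σ₁.reg 3 = σ.reg 3 := gk 3 (by omega)
    have s2 : σ₂.reg 3 = σ.reg 3 := (gt 3 (by omega)).trans s1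
    have s3 : σ₃.reg 3 = σ.reg 3 := (gB 3 (by omega)).trans s2
    have s4 : σ₄.reg 3 = planBase σ ^ (5 * k) + σ.reg 3 := gR 3 (by omega)
    rw [s1] at b₂
    rw [s2] at b₃
    rw [s3] at b₄
    rw [s4] at b₅
    have hle : σ.reg 3 ≤ planBase σ ^ (5 * k) + σ.reg 3 := Nat.le_add_left _ _
    refine (Nat.add_le_add (b₁.trans (polyBound_mono_right _ hle)) ?_).trans (polyBound_add_le _ _ _)
    refine (Nat.add_le_add (b₂.trans (polyBound_mono_right _ hle)) ?_).trans (polyBound_add_le _ _ _)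
    refine (Nat.add_le_add (b₃.trans (polyBound_mono_right _ hle)) ?_).trans (polyBound_add_le _ _ _)
    exact (Nat.add_le_add (b₄.trans (polyBound_mono_right _ hle)) b₅).trans (polyBound_add_le _ _ _)
  · rw [r₅ 0 (by omega), if_pos rfl]
    refine if_congr ?_ rfl rfl
    rw [exists_loopValid_iff hready hgood]
    change HasSchedule (modulator _ ∪ unmarked _) (loopAdj _) (σ₄.global.reg 1)
      (σ₄.global.reg 2) ↔ _
    rw [modulator_union_unmarked hN', hadj, q0, q1, q2]

/-! ## Correctness and running time -/

theorem hasSchedule_range_iff {n t : ℕ} {A : Fin n → Fin n → Prop} {B : ℕ → ℕ → Prop}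
    (h : ∀ u v : Fin n, B u v ↔ A u v) (s : Fin n) :
    HasSchedule (range n) B s t ↔ HasSchedule univ A s t := by
  have hne : ∀ v : Fin n, v ≠ s → (v : ℕ) ≠ s := fun v hv h => hv (Fin.ext h)
  constructor
  · rintro ⟨p, τ, hp⟩
    have hlt : ∀ v : Fin n, v ≠ s → p v < n := fun v hv =>
      mem_range.1 (hp.mem v (mem_range.2 v.2) (hne v hv))
    let q : Fin n → Fin n := fun v => if h : p v < n then ⟨p v, h⟩ else s
    have hq : ∀ v, v ≠ s → (q v : ℕ) = p v := fun v hv => by simp only [q, dif_pos (hlt v hv)]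
    refine ⟨q, fun v => τ v, hp.root, fun _ _ _ => mem_univ _, fun v _ hv => ?_, fun v _ hv => ?_,
      fun v _ hv => hp.le v (mem_range.2 v.2) (hne v hv), fun v _ w _ hv hw hvw hτ => ?_⟩
    · rw [← h, hq v hv]
      exact hp.adj v (mem_range.2 v.2) (hne v hv)
    · rw [hq v hv]
      exact hp.lt v (mem_range.2 v.2) (hne v hv)
    · refine Fin.ext (hp.inj v (mem_range.2 v.2) w (mem_range.2 w.2) (hne v hv) (hne w hw) ?_ hτ)
      rw [← hq v hv, ← hq w hw, hvw]
  · rintro ⟨p, τ, hp⟩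
    let q : ℕ → ℕ := fun v => if h : v < n then p ⟨v, h⟩ else 0
    let ρ : ℕ → ℕ := fun v => if h : v < n then τ ⟨v, h⟩ else 0
    have hq : ∀ v : Fin n, q v = p v := fun v => by simp only [q, dif_pos v.2]
    have hρ : ∀ v : Fin n, ρ v = τ v := fun v => by simp only [ρ, dif_pos v.2]
    have hmem : ∀ P : ℕ → Prop, (∀ v : Fin n, v ≠ s → P v) →
        ∀ v ∈ range n, v ≠ (s : ℕ) → P v := fun P hP v hv hvs =>
      hP ⟨v, mem_range.1 hv⟩ fun h => hvs (congrArg Fin.val h)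
    refine ⟨q, ρ, (hρ s).trans hp.root, hmem _ fun v hv => ?_, hmem _ fun v hv => ?_,
      hmem _ fun v hv => ?_, hmem _ fun v hv => ?_, ?_⟩
    · rw [hq]
      exact mem_range.2 (p v).2
    · rw [hq, h]
      exact hp.adj v (mem_univ _) hv
    · rw [hq, hρ, hρ]
      exact hp.lt v (mem_univ _) hv
    · rw [hρ]
      exact hp.le v (mem_univ _) hv
    · intro v hv w hw hvs hws
      refine hmem (fun v => q v = q w → ρ v = ρ w → v = w) (fun v hv => ?_) v hv hvs
      refine hmem (fun w => q v = q w → ρ v = ρ w → (v : ℕ) = w) (fun w hw => ?_) w hw hws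
      rw [hq, hq, hρ, hρ]
      intro h1 h2
      rw [hp.inj v (mem_univ _) w (mem_univ _) hv hw (Fin.ext h1) h2]

/-- All vertices but the source form a modulator. So `n = |V| - κ` is positive, which the estimates
by powers of `n` require. -/
theorem Instance.dtc_lt (I : Instance) : I.dtc < I.order := by
  have h : I.dtc ≤ #(univ.erase I.source) := by
    refine Nat.sInf_le ⟨univ.erase I.source, rfl, ?_⟩
    intro u hu v hv huv
    simp only [Set.mem_ofPred_eq, mem_erase, mem_univ, and_true, not_not] at hu hv
    exact absurd (hu.trans hv.symm) huv
  rw [card_erase_of_mem (mem_univ _), card_univ, Fintype.card_fin] at h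
  have := I.source.pos
  omega

theorem Instance.exists_modulator (I : Instance) :
    ∃ X : Finset (Fin I.order), X.card = I.dtc ∧ I.graph.IsClique {v | v ∉ X} :=
  Nat.sInf_mem (s := {k | ∃ X : Finset (Fin I.order), X.card = k ∧ I.graph.IsClique {v | v ∉ X}})
    ⟨_, univ, rfl, fun u hu => absurd (mem_univ u) hu⟩

theorem MarkInvariant.card_modulator_le {I : Instance} {σ : State} {i : ℕ}
    (h : MarkInvariant I.order I.source (I.input.arr 0) i (σ.arr 1)) (h0 : σ.reg 0 = I.order)
    (h3 : σ.reg 0 ≤ σ.reg 3) : #(modulator σ) ≤ 2 * I.dtc + 1 := by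
  obtain ⟨X, hX, hclq⟩ := I.exists_modulator
  have h1 : modulator σ = {v ∈ range I.order | σ.arr 1 v ≠ 0} := by
    ext v
    rw [mem_modulator h3, mem_filter, mem_range, h0]
  have h2 := h.card_le (X.map Fin.valEmbedding) fun u hu v hv huX hvX huv => by
    refine (I.matrixAdj_iff ⟨u, hu⟩ ⟨v, hv⟩).2 (hclq ?_ ?_ fun h => huv (congrArg Fin.val h))
    · exact fun h => huX (mem_map_of_mem Fin.valEmbedding h)
    · exact fun h => hvX (mem_map_of_mem Fin.valEmbedding h)
  have h3 : #{v ∈ range I.order | σ.arr 1 v ≠ 0 ∧ v ∈ X.map Fin.valEmbedding} ≤ I.dtc := by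
    rw [← hX, ← card_map Fin.valEmbedding]
    exact card_le_card fun v hv => (mem_filter.1 hv).2.2
  rw [h1]
  omega

/-- From the general upper bound on, every answer is yes. The cap makes the base of the codes, and
hence the number of plans, independent of the size of `t`. -/
theorem Instance.isYes_iff_of_modulator (I : Instance) {X : Finset (Fin I.order)}
    (hX : I.graph.IsClique {v | v ∉ X}) :
    I.IsYes ↔ HasSchedule univ I.graph.Adj I.source
      (min I.rounds (2 * #X + Nat.clog 2 I.order)) := by
  rw [Instance.IsYes, broadcastTime_le_iff I.connected]
  have h := hasSchedule_of_isClique_compl I.connected hX I.source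
  rw [Fintype.card_fin] at h
  rcases min_choice I.rounds (2 * #X + Nat.clog 2 I.order) with hm | hm
  · rw [hm]
  · refine ⟨fun _ => by rwa [hm], fun h' => h'.mono (min_le_left _ _)⟩

/-- Telephone Broadcast can be solved in time `2 ^ O(k ^ 2) * n ^ O(1)`. -/
theorem exists_solvesInTime : ∃ (p : Program) (c : ℕ),
    SolvesInTime p (fun I => c * 2 ^ (c * I.dtc ^ 2) * (I.order - I.dtc) ^ c) := by
  classical
  obtain ⟨p₁, c₁, h₁⟩ := exists_modulator_program
  obtain ⟨p₂, c₂, h₂⟩ := exists_test_program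
  refine ⟨.seq p₁ p₂, (c₁ + c₂) * 2 ^ (71 * (c₁ + c₂)) + 220 * (c₁ + c₂), fun I => ?_⟩
  obtain ⟨σ, m, he, hm, g0, g1, g2, g3, ga, hM⟩ := h₁ I
  have hN : σ.reg 0 ≤ σ.reg 3 := by omega
  have hadj : ∀ u v : Fin I.order, loopAdj σ u v ↔ I.graph.Adj u v := by
    intro u v
    rw [loopAdj_iff hN, g0, ga, ← I.matrixAdj_iff]
    rfl
  have hclq : ∀ u ∈ unmarked σ, ∀ v ∈ unmarked σ, u ≠ v → loopAdj σ u v := by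
    intro u hu v hv huv
    rw [mem_unmarked hN, g0] at hu hv
    rw [loopAdj_iff hN, g0, ga]
    exact hM.adj u (by omega) hu.1 hu.2 v hv.1 huv.symm hv.2
  obtain ⟨σ', m', he', hm', hr⟩ := h₂ σ (by omega)
    ((mem_modulator hN).2 ⟨by rw [g0, g1]; exact I.source.2, by rw [g1]; exact hM.source⟩) hclq
  refine ⟨σ', _, .seq he he', ?_, ?_⟩
  · have hk := hM.card_modulator_le g0 hN
    have hlt := I.dtc_lt
    have hB : planBase σ ≤
        4 * #(modulator σ) + Nat.clog 2 (I.order - I.dtc + I.dtc) + 2 := by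
      rw [Nat.sub_add_cancel hlt.le, planBase, cappedRounds, g0]
      omega
    refine le_trans ?_ (polyBound_size_le (C := c₁ + c₂) (n := I.order - I.dtc)
      (by omega) hk hB)
    rw [Nat.sub_add_cancel hlt.le, ← g3]
    refine (Nat.add_le_add (hm.trans (polyBound_mono_right _ ?_)) hm').trans
      (polyBound_add_le _ _ _)
    omega
  · rw [hr]
    refine if_congr ?_ rfl rfl
    let X : Finset (Fin I.order) := {v | σ.arr 1 v ≠ 0}
    have hX : I.graph.IsClique {v | v ∉ X} := by
      intro u hu v hv huv
      simp only [X, Set.mem_ofPred_eq, mem_filter, mem_univ, true_and, not_not] at hu hv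
      refine (hadj u v).1 (hclq u ?_ v ?_ fun h => huv (Fin.ext h))
      · rw [mem_unmarked hN, g0]; exact ⟨u.2, hu⟩
      · rw [mem_unmarked hN, g0]; exact ⟨v.2, hv⟩
    have hcard : #X = #(modulator σ) := by
      rw [← card_map Fin.valEmbedding]
      congr 1
      ext v
      rw [mem_modulator hN, g0]
      simp only [X, mem_map, mem_filter, mem_univ, true_and, Fin.valEmbedding_apply]
      exact ⟨fun ⟨u, hu, huv⟩ => huv ▸ ⟨u.2, hu⟩, fun h => ⟨⟨v, h.1⟩, h.2, rfl⟩⟩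
    rw [I.isYes_iff_of_modulator hX, hcard, ← hasSchedule_range_iff hadj, cappedRounds, g0, g1, g2]

end TelephoneBroadcast

/-- Telephone Broadcast is fixed-parameter tractable parameterized by distance to clique `k`, and it
can be solved in time `2 ^ O(k ^ 2) * n ^ O(1)`, where `n = |V| - k`. -/
theorem mainTheorem7 :
    TelephoneBroadcast.IsFixedParameterTractable TelephoneBroadcast.Instance.dtc ∧
    ∃ (p : TelephoneBroadcast.Program) (c : ℕ),
      TelephoneBroadcast.SolvesInTime p
        (fun I => c * 2 ^ (c * I.dtc ^ 2) * (I.order - I.dtc) ^ c) := by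
  refine ⟨?_, TelephoneBroadcast.exists_solvesInTime⟩
  obtain ⟨p, c, h⟩ := TelephoneBroadcast.exists_solvesInTime
  -- The same program serves, since `(|V| - k) ^ c ≤ |V| ^ c`.
  refine ⟨p, _, c, TelephoneBroadcast.computable_mul_two_pow c, fun I => ?_⟩
  obtain ⟨σ, m, he, hm, hr⟩ := h I
  exact ⟨σ, m, he, hm.trans (Nat.mul_le_mul_left _ (Nat.pow_le_pow_left (Nat.sub_le _ _) _)), hr⟩
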